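/- **Theorem 1 (quantum complexity for the thermal-state preparation problem).** *Setting.* Let $\mathcal H_s\cong\mathcal H_{s'}\cong\mathbb C^{N}$, $N=2^{n}$, be spaces of $n$ qubits, let $H_0,H_1$ be Hamiltonians (Hermitian operators) on $\mathcal H_s$, let $\beta\ge 0$ and $0<\epsilon\le 1$, and put $\mathcal Z_a=\mathrm{tr}(e^{-\beta H_a})$, $\rho_a=e^{-\beta H_a}/\mathcal Z_a$ for $a=0,1$, and $\Delta A=-\frac1\beta\ln(\mathcal Z_1/\mathcal Z_0)$ (only $\beta\,\Delta A=-\ln(\mathcal Z_1/\mathcal Z_0)$ matters, which is $0$ at $\beta=0$). Let $\{|\phi_{0,m}\rangle\}$ and $\{|\phi_{1,k}\rangle\}$ be orthonormal eigenbases of $H_0$ and $H_1$ with eigenvalues $\varepsilon_{0,m}$ and $\varepsilon_{1,k}$. Let $U_0$ be a unitary on $\mathcal H_s\otimes\mathcal H_{s'}$ that prepares the purification $U_0|0\rangle=|\Psi_0\rangle=\mathcal Z_0^{-1/2}\sum_m e^{-\beta\varepsilon_{0,m}/2}|\phi_{0,m}\rangle|\phi_{0,m}^*\rangle$ of $\rho_0$,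 where $^*$ is complex conjugation in the computational basis. Let $\mathcal U$ be any unitary on $\mathcal H_s$, and let $$P(w)=\sum_{m,k:\ \varepsilon_{1,k}-\varepsilon_{0,m}=w}|\langle\phi_{1,k}|\mathcal U|\phi_{0,m}\rangle|^2\,\frac{e^{-\beta\varepsilon_{0,m}}}{\mathcal Z_0}$$ be its work distribution. Let $w_{\min}\le w_{\max}$ be such that $P$ is supported in $[w_{\min},w_{\max}]$, and let $w_l\in[w_{\min},w_{\max}]$ be a work cutoff, that is, $$\sum_{w<w_l}P(w)\,e^{-\beta(w-\Delta A)}\le\left(\frac{\epsilon}{6}\right)^2 .$$ *Claim.* There is an amplitude amplification algorithm that stops with probability one and then outputs a state $\tau_1$ of $\mathcal H_s$ with $\frac12\|\tau_1-\rho_1\|_1\le\epsilon$, where $\|\cdot\|_1$ is the trace norm. The expected number of amplitude amplification rounds (the initial state preparation of each attempt being counted as one more round) is $$Q=\mathcal O\!\left(e^{\sqrt{\ln(1/\epsilon)}}\,e^{\frac\beta2(\Delta A-w_l)}\right).$$ Each round consists of one reflection about the state $|0\rangle$ of the ancilla register, one reflection about the computational basis state $|0\rangle$ of all registers, one use each of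 $\mathcal U$, $\mathcal U^\dagger$, $U_0$ and $U_0^\dagger$, $$\mathcal O\!\left(\bigl(\ln(1/\epsilon)+\beta(w_{\max}-w_l)\bigr)^{3/2}\right)$$ uses of the controlled-$U$ operation and its inverse, where $U=e^{i\delta\beta W/2}$, $W=H_1\otimes 1-1\otimes H_0^*$ and $0<\delta\le\pi/16$, and a number of further two-qubit gates of the same order. The number of ancilla qubits is of this order too. The constants in $\mathcal O(\cdot)$ are absolute. The circuits, the parameter $\delta$ and the randomized numbers of rounds depend only on $n,\beta,\epsilon,w_l,w_{\max}$; otherwise $H_0,H_1,\mathcal U,U_0$ enter only through the operations $\mathcal U$, $U_0$ and controlled-$U$ and their inverses. -/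

import Mathlib

open Matrix Kronecker Filter Topology ComplexOrder

noncomputable section

namespace ThermalPrep

/-! ### Thermal states, their purifications, and the work distribution -/

/-- Computational basis of `n` qubits; the Hilbert space is `ℂ^N` with `N = 2 ^ n`. -/
abbrev Sys (n : ℕ) : Type := Fin n → Fin 2

/-- A pure computational basis vector. -/
def ket {ι : Type*} [DecidableEq ι] (i : ι) : ι → ℂ := Pi.single i 1

/-- The operator `e^{-β H}`. -/
def gibbsOp {n : ℕ} (β : ℝ) (H : Matrix (Sys n) (Sys n) ℂ) : Matrix (Sys n) (Sys n) ℂ :=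
  NormedSpace.exp ((-(β : ℂ)) • H)

/-- The partition function `tr e^{-β H}` (a positive real number for Hermitian `H`). -/
def partitionFn {n : ℕ} (β : ℝ) (H : Matrix (Sys n) (Sys n) ℂ) : ℝ :=
  (gibbsOp β H).trace.re

/-- The thermal state `e^{-β H} / tr e^{-β H}`. -/
def thermalState {n : ℕ} (β : ℝ) (H : Matrix (Sys n) (Sys n) ℂ) : Matrix (Sys n) (Sys n) ℂ :=
  ((partitionFn β H : ℂ))⁻¹ • gibbsOp β H

/-- The free-energy difference `ΔA = -(1/β) ln (Z₁ / Z₀)`. Only `β * ΔA` matters below, so that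
the value at `β = 0` (where both partition functions equal `N`) is immaterial. -/
def freeEnergyDiff {n : ℕ} (β : ℝ) (H₀ H₁ : Matrix (Sys n) (Sys n) ℂ) : ℝ :=
  -(1 / β) * Real.log (partitionFn β H₁ / partitionFn β H₀)

/-- The purification `Z₀^{-1/2} ∑ₘ e^{-β ε₀ₘ / 2} |φ₀ₘ⟩ |φ₀ₘ*⟩` of the thermal state, where the
`φ₀ₘ` are an orthonormal eigenbasis of `H₀`. (The vector does not depend on this basis.) -/
def purification {n : ℕ} (β : ℝ) {H₀ : Matrix (Sys n) (Sys n) ℂ} (h₀ : H₀.IsHermitian) :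
    Sys n × Sys n → ℂ :=
  fun x => ((Real.sqrt (partitionFn β H₀) : ℝ) : ℂ)⁻¹ *
    ∑ m, ((Real.exp (-β * h₀.eigenvalues m / 2) : ℝ) : ℂ) *
      (h₀.eigenvectorBasis m x.1 * star (h₀.eigenvectorBasis m x.2))

/-- The transition probability `|⟨φ₁ₙ| 𝒰 |φ₀ₘ⟩|²`. -/
def transitionProb {n : ℕ} {H₀ H₁ : Matrix (Sys n) (Sys n) ℂ}
    (h₀ : H₀.IsHermitian) (h₁ : H₁.IsHermitian) (𝒰 : Matrix (Sys n) (Sys n) ℂ)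
    (m k : Sys n) : ℝ :=
  ‖∑ i, star (h₁.eigenvectorBasis k i) * ∑ j, 𝒰 i j * h₀.eigenvectorBasis m j‖ ^ 2

/-- The work distribution of the two-time measurement scheme:
`P(w) = ∑ |⟨φ₁ₖ| 𝒰 |φ₀ₘ⟩|² e^{-β ε₀ₘ} / Z₀` over all `m, k` with `ε₁ₖ - ε₀ₘ = w`. -/
def workDist {n : ℕ} (β : ℝ) {H₀ H₁ : Matrix (Sys n) (Sys n) ℂ}
    (h₀ : H₀.IsHermitian) (h₁ : H₁.IsHermitian) (𝒰 : Matrix (Sys n) (Sys n) ℂ) (w : ℝ) : ℝ :=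
  ∑ m, ∑ k, if h₁.eigenvalues k - h₀.eigenvalues m = w then
    transitionProb h₀ h₁ 𝒰 m k * (Real.exp (-β * h₀.eigenvalues m) / partitionFn β H₀) else 0

/-- The finite set of all energy differences `ε₁ₖ - ε₀ₘ`, outside of which `P` vanishes. -/
def workValues {n : ℕ} {H₀ H₁ : Matrix (Sys n) (Sys n) ℂ}
    (h₀ : H₀.IsHermitian) (h₁ : H₁.IsHermitian) : Finset ℝ :=
  Finset.univ.image fun p : Sys n × Sys n => h₁.eigenvalues p.1 - h₀.eigenvalues p.2

/-- The weighted lower tail `∑_{w < w_l} P(w) e^{-β (w - ΔA)}` of the work distribution. -/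
def workTail {n : ℕ} (β : ℝ) {H₀ H₁ : Matrix (Sys n) (Sys n) ℂ}
    (h₀ : H₀.IsHermitian) (h₁ : H₁.IsHermitian) (𝒰 : Matrix (Sys n) (Sys n) ℂ) (wl : ℝ) : ℝ :=
  ∑ w ∈ (workValues h₀ h₁).filter (fun w => w < wl),
    workDist β h₀ h₁ 𝒰 w * Real.exp (-β * (w - freeEnergyDiff β H₀ H₁))

/-- The work operator `W = H₁ ⊗ 1 - 1 ⊗ H₀*`. -/
def workOp {n : ℕ} (H₀ H₁ : Matrix (Sys n) (Sys n) ℂ) :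
    Matrix (Sys n × Sys n) (Sys n × Sys n) ℂ :=
  H₁ ⊗ₖ (1 : Matrix (Sys n) (Sys n) ℂ) - (1 : Matrix (Sys n) (Sys n) ℂ) ⊗ₖ H₀.map star

/-- The short-time evolution `U = e^{i δ β W / 2}`. -/
def evolution {n : ℕ} (δ β : ℝ) (H₀ H₁ : Matrix (Sys n) (Sys n) ℂ) :
    Matrix (Sys n × Sys n) (Sys n × Sys n) ℂ :=
  NormedSpace.exp ((Complex.I * (δ * β / 2 : ℝ)) • workOp H₀ H₁)

/-- The trace norm `tr √(A† A)`, the sum of the singular values of `A`. -/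
def traceNorm {ι : Type*} [Fintype ι] [DecidableEq ι] (A : Matrix ι ι ℂ) : ℝ :=
  ∑ i, Real.sqrt ((isHermitian_conjTranspose_mul_self A).eigenvalues i)

/-! ### Oracle circuits

The registers are `a` ancilla qubits, the system `s` and its copy `s'` (`n` qubits each). -/

/-- Computational basis of all registers. -/
abbrev Basis (a n : ℕ) : Type := Sys a × (Sys n × Sys n)

/-- Labels of the individual qubits. -/
abbrev Qubit (a n : ℕ) : Type := Fin a ⊕ (Fin n ⊕ Fin n)

/-- The value of one qubit in a computational basis state. -/
def bit {a n : ℕ} (x : Basis a n) : Qubit a n → Fin 2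
  | .inl i => x.1 i
  | .inr (.inl i) => x.2.1 i
  | .inr (.inr i) => x.2.2 i

/-- Elementary operations of a circuit: an arbitrary gate on two distinct qubits (one-qubit gates
are a special case), the unitaries `𝒰`, `U₀` and their inverses, the controlled-`U` operation and
its inverse (controlled on an ancilla qubit), the reflection about the state `|0⟩` of the ancilla
register, and the reflection about the state `|0⟩` of all registers. -/
inductive Gate (a n : ℕ) : Type
  | twoQubit (p q : Qubit a n) (hpq : p ≠ q) (M : Matrix.unitaryGroup (Fin 2 × Fin 2) ℂ) : Gate a n
  | drive : Gate a n
  | driveInv : Gate a n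
  | prep : Gate a n
  | prepInv : Gate a n
  | ctrlU (c : Fin a) : Gate a n
  | ctrlUInv (c : Fin a) : Gate a n
  | reflAnc : Gate a n
  | reflAll : Gate a n

/-- The types of elementary operations. -/
inductive Kind : Type
  | twoQubit | drive | driveInv | prep | prepInv | ctrlU | ctrlUInv | reflAnc | reflAll
  deriving DecidableEq

/-- The type of an elementary operation. -/
def Gate.kind {a n : ℕ} : Gate a n → Kind
  | .twoQubit _ _ _ _ => .twoQubit
  | .drive => .drive
  | .driveInv => .driveInv
  | .prep => .prep
  | .prepInv => .prepInv
  | .ctrlU _ => .ctrlU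
  | .ctrlUInv _ => .ctrlUInv
  | .reflAnc => .reflAnc
  | .reflAll => .reflAll

/-- The inverse of an elementary operation. -/
def Gate.inv {a n : ℕ} : Gate a n → Gate a n
  | .twoQubit p q h M => .twoQubit p q h M⁻¹
  | .drive => .driveInv
  | .driveInv => .drive
  | .prep => .prepInv
  | .prepInv => .prep
  | .ctrlU c => .ctrlUInv c
  | .ctrlUInv c => .ctrlU c
  | .reflAnc => .reflAnc
  | .reflAll => .reflAll

/-- The operator `|0⟩⟨0| ⊗ 1 + |1⟩⟨1| ⊗ V`, controlled on the ancilla qubit `c`. -/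
def controlled {a n : ℕ} (c : Fin a) (V : Matrix (Sys n × Sys n) (Sys n × Sys n) ℂ) :
    Matrix (Basis a n) (Basis a n) ℂ :=
  fun x y => if x.1 = y.1 then
    (if y.1 c = 1 then V x.2 y.2 else (1 : Matrix (Sys n × Sys n) (Sys n × Sys n) ℂ) x.2 y.2) else 0

/-- The operator that acts as the `4 × 4` matrix `M` on the qubits `p`, `q` and trivially on the
others. -/
def onTwoQubits {a n : ℕ} (p q : Qubit a n) (M : Matrix (Fin 2 × Fin 2) (Fin 2 × Fin 2) ℂ) :
    Matrix (Basis a n) (Basis a n) ℂ :=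
  fun x y => if ∀ r, r ≠ p → r ≠ q → bit x r = bit y r then
    M (bit x p, bit x q) (bit y p, bit y q) else 0

/-- The operator of an elementary operation, given the unitaries `𝒰`, `U₀` and `U`. -/
def Gate.op {a n : ℕ} (𝒰 : Matrix (Sys n) (Sys n) ℂ)
    (U₀ U : Matrix (Sys n × Sys n) (Sys n × Sys n) ℂ) :
    Gate a n → Matrix (Basis a n) (Basis a n) ℂ
  | .twoQubit p q _ M => onTwoQubits p q M.1
  | .drive => (1 : Matrix (Sys a) (Sys a) ℂ) ⊗ₖ (𝒰 ⊗ₖ (1 : Matrix (Sys n) (Sys n) ℂ))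
  | .driveInv => (1 : Matrix (Sys a) (Sys a) ℂ) ⊗ₖ (𝒰ᴴ ⊗ₖ (1 : Matrix (Sys n) (Sys n) ℂ))
  | .prep => (1 : Matrix (Sys a) (Sys a) ℂ) ⊗ₖ U₀
  | .prepInv => (1 : Matrix (Sys a) (Sys a) ℂ) ⊗ₖ U₀ᴴ
  | .ctrlU c => controlled c U
  | .ctrlUInv c => controlled c Uᴴ
  | .reflAnc => 1 - (2 : ℂ) • Matrix.diagonal fun x => if x.1 = 0 then 1 else 0
  | .reflAll => 1 - (2 : ℂ) • Matrix.diagonal fun x => if x = 0 then 1 else 0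

/-- A circuit is a list of elementary operations, the first one being applied first. -/
abbrev Circuit (a n : ℕ) : Type := List (Gate a n)

/-- The inverse circuit. -/
def Circuit.inv {a n : ℕ} (c : Circuit a n) : Circuit a n := (c.map Gate.inv).reverse

/-- The number of uses of a type of elementary operation. -/
def Circuit.uses {a n : ℕ} (c : Circuit a n) (k : Kind) : ℕ := (c.map Gate.kind).count k

/-- The state of all registers after running a circuit on the state `v`. -/
def Circuit.run {a n : ℕ} (𝒰 : Matrix (Sys n) (Sys n) ℂ)
    (U₀ U : Matrix (Sys n × Sys n) (Sys n × Sys n) ℂ) (c : Circuit a n) (v : Basis a n → ℂ) :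
    Basis a n → ℂ :=
  c.foldl (fun v g => g.op 𝒰 U₀ U *ᵥ v) v

/-! ### Amplitude amplification -/

/-- An amplitude amplification algorithm: a circuit `A` for the state to be amplified, and for each
attempt `t = 0, 1, 2, …` the distribution of the number of rounds done in this attempt. In an
attempt with `k` rounds, `A` is applied to `|0⟩`, then `k` rounds are applied, and then the ancilla
register is measured. If the outcome is `|0⟩` the algorithm stops and outputs the register `s`;
otherwise the next attempt starts. -/
structure AmpAlgorithm (n : ℕ) : Type where
  /-- the number of ancilla qubits -/
  anc : ℕ
  /-- the circuit `A` -/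
  A : Circuit anc n
  /-- the distribution of the number of rounds in each attempt -/
  schedule : ℕ → PMF ℕ

namespace AmpAlgorithm

variable {n : ℕ}

/-- One amplitude amplification round: the reflection about the ancilla state `|0⟩`, followed by
the reflection `A (1 - 2 |0⟩⟨0|) A†` about the state `A |0⟩`. -/
def round (𝒜 : AmpAlgorithm n) : Circuit 𝒜.anc n :=
  [Gate.reflAnc] ++ Circuit.inv 𝒜.A ++ [Gate.reflAll] ++ 𝒜.A

/-- The state after `k` rounds, before the measurement. -/
def state (𝒜 : AmpAlgorithm n) (𝒰 : Matrix (Sys n) (Sys n) ℂ)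
    (U₀ U : Matrix (Sys n × Sys n) (Sys n × Sys n) ℂ) (k : ℕ) : Basis 𝒜.anc n → ℂ :=
  (Circuit.run 𝒰 U₀ U 𝒜.round)^[k] (Circuit.run 𝒰 U₀ U 𝒜.A (ket 0))

/-- The probability that the measurement after `k` rounds has outcome `|0⟩`. -/
def successProb (𝒜 : AmpAlgorithm n) (𝒰 : Matrix (Sys n) (Sys n) ℂ)
    (U₀ U : Matrix (Sys n × Sys n) (Sys n × Sys n) ℂ) (k : ℕ) : ℝ :=
  ∑ x, if x.1 = 0 then ‖𝒜.state 𝒰 U₀ U k x‖ ^ 2 else 0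

/-- The probability that the measurement after `k` rounds has another outcome. -/
def failureProb (𝒜 : AmpAlgorithm n) (𝒰 : Matrix (Sys n) (Sys n) ℂ)
    (U₀ U : Matrix (Sys n × Sys n) (Sys n × Sys n) ℂ) (k : ℕ) : ℝ :=
  ∑ x, if x.1 = 0 then 0 else ‖𝒜.state 𝒰 U₀ U k x‖ ^ 2

/-- The unnormalized state of the register `s` after outcome `|0⟩` in an attempt with `k` rounds:
the partial trace over `s'` of the projected pure state. Its trace is the success probability. -/
def outcome (𝒜 : AmpAlgorithm n) (𝒰 : Matrix (Sys n) (Sys n) ℂ)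
    (U₀ U : Matrix (Sys n × Sys n) (Sys n × Sys n) ℂ) (k : ℕ) : Matrix (Sys n) (Sys n) ℂ :=
  fun i j => ∑ l, 𝒜.state 𝒰 U₀ U k (0, (i, l)) * star (𝒜.state 𝒰 U₀ U k (0, (j, l)))

/-- The probability that the attempts `0, …, t - 1` all fail. -/
def reachProb (𝒜 : AmpAlgorithm n) (𝒰 : Matrix (Sys n) (Sys n) ℂ)
    (U₀ U : Matrix (Sys n × Sys n) (Sys n × Sys n) ℂ) (t : ℕ) : ENNReal :=
  ∏ s ∈ Finset.range t,
    ∑' k, 𝒜.schedule s k * ENNReal.ofReal (𝒜.failureProb 𝒰 U₀ U k)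

/-- The expected total number of amplitude amplification rounds. The application of `A` at the
start of each attempt is counted as one more round, so that also the number of attempts is
accounted for. -/
def expectedRounds (𝒜 : AmpAlgorithm n) (𝒰 : Matrix (Sys n) (Sys n) ℂ)
    (U₀ U : Matrix (Sys n × Sys n) (Sys n × Sys n) ℂ) : ENNReal :=
  ∑' t, 𝒜.reachProb 𝒰 U₀ U t * ∑' k, 𝒜.schedule t k * ((k : ENNReal) + 1)

end AmpAlgorithm

end ThermalPrep

end

/-! Regard a vector of `s ⊗ s'` as a matrix M, so that its reduced state on `s` is M Mᴴ. The driven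
purification is the matrix 𝒰 √ρ₀. The operator e^{-β(W - w_l)/2} multiplies it by e^{-βH₁/2} from
the left and by e^{βH₀/2} from the right, up to a scalar. The result is a multiple of √ρ₁ 𝒰, whose
reduced state is exactly ρ₁ (`thermalState_eq`). By Jarzynski's equality its norm is κ = e^{-β(ΔA -
w_l)/2} (`sum_target_sq`). Hence it suffices to implement a multiple r e^{-x} of the exponential of
x = β(W - w_l)/2 and to amplify an amplitude of order r κ.

The factor need not be accurate everywhere. On 0 ≤ x ≤ X, with X = β(w_max - w_l)/2, a relative
error ε/6 is required; for x < 0 a bounded relative error is enough, because the cutoff condition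
makes that part of the target small. `filter_estimate` turns this into ε-closeness of the normalized
vectors, and `traceNorm_sub_le` passes to reduced states.

The filter is a one-sided exponential, made periodic with period 2ρ and convolved with a power of a
cosine that is almost a Gaussian. Convolution reproduces e^{-z} up to a constant, except near the
jump at 0. With l = ln(1/ε), moving the origin by √l + 3 makes the Gaussian remainder smaller than
ε; the price is r ≈ e^{-√l}, the origin of the factor e^{√(ln(1/ε))}. The cosine power has degree ρ²
but binomial coefficients, so a Chernoff bound allows truncation at degree k ρ with error e^{-k²}.
Taking ρ of order L = ln(1/ε) + β(w_max - w_l) and k of order √ρ yields degree L^{3/2}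
(`exists_exp_approx`).

The Fourier coefficients have absolute sum at most one, so the filter is a subnormalized linear
combination of powers of `U`. Horner's scheme with one ancilla qubit per step implements it with
linearly many gates (`exists_encodes`, `exists_laurent`). The good amplitude sin θ is unknown to the
algorithm; attempts with randomized, geometrically growing numbers of rounds still cost only O(1 /
sin θ) in expectation (`expectedRounds_le`). When L is small the resource bound may be below one;
there the driven purification is itself close enough and no ancilla is needed
(`achievable_of_small`). -/

noncomputable section

namespace ThermalPrep

/-! ### Two-qubit gates -/

section Gates

variable {a n : ℕ}

/-- A computational basis state is determined by the values of its qubits. -/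
def bitEquiv (a n : ℕ) : Basis a n ≃ (Qubit a n → Fin 2) where
  toFun x := bit x
  invFun f := (fun i => f (.inl i), fun i => f (.inr (.inl i)), fun i => f (.inr (.inr i)))
  left_inv _ := rfl
  right_inv f := by
    funext q
    rcases q with i | i | i <;> rfl

/-- Overwrite the values of the qubits `p` and `q`. -/
def setBits (x : Basis a n) (p q : Qubit a n) (s : Fin 2 × Fin 2) : Basis a n :=
  (bitEquiv a n).symm (Function.update (Function.update (bit x) p s.1) q s.2)

lemma bit_setBits (x : Basis a n) (p q : Qubit a n) (s : Fin 2 × Fin 2) :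
    bit (setBits x p q s) = Function.update (Function.update (bit x) p s.1) q s.2 :=
  (bitEquiv a n).apply_symm_apply _

lemma bit_injective : Function.Injective (bit : Basis a n → Qubit a n → Fin 2) :=
  (bitEquiv a n).injective

lemma setBits_self (x : Basis a n) (p q : Qubit a n) :
    setBits x p q (bit x p, bit x q) = x := by
  apply bit_injective
  rw [bit_setBits]
  simp

lemma setBits_setBits (x : Basis a n) {p q : Qubit a n} (hpq : p ≠ q) (s t : Fin 2 × Fin 2) :
    setBits (setBits x p q s) p q t = setBits x p q t := by
  apply bit_injective
  simp only [bit_setBits]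
  rw [Function.update_comm hpq.symm, Function.update_idem, Function.update_idem]

lemma bit_setBits_fst (x : Basis a n) {p q : Qubit a n} (hpq : p ≠ q) (s : Fin 2 × Fin 2) :
    bit (setBits x p q s) p = s.1 := by
  simp [bit_setBits, hpq]

lemma bit_setBits_snd (x : Basis a n) (p q : Qubit a n) (s : Fin 2 × Fin 2) :
    bit (setBits x p q s) q = s.2 := by
  simp [bit_setBits]

/-- The basis states that agree with `x` off the two qubits are exactly the four obtained by
overwriting them. In this form products of gates reduce to products of 4 × 4 matrices. -/
lemma onTwoQubits_mulVec {p q : Qubit a n} (hpq : p ≠ q)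
    (M : Matrix (Fin 2 × Fin 2) (Fin 2 × Fin 2) ℂ) (v : Basis a n → ℂ) (x : Basis a n) :
    (onTwoQubits p q M *ᵥ v) x =
      ∑ s, M (bit x p, bit x q) s * v (setBits x p q s) := by
  simp only [mulVec, dotProduct, onTwoQubits, ite_mul, zero_mul]
  rw [← Finset.sum_filter]
  symm
  refine Finset.sum_bij' (fun s _ => setBits x p q s) (fun y _ => (bit y p, bit y q)) ?_ ?_ ?_ ?_ ?_
  · intro s _
    simp only [Finset.mem_filter, Finset.mem_univ, true_and]
    intro r hr hr'
    simp [bit_setBits, hr, hr']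
  · simp
  · intro s _
    simp [bit_setBits_fst x hpq, bit_setBits_snd]
  · intro y hy
    simp only [Finset.mem_filter, Finset.mem_univ, true_and] at hy
    apply bit_injective
    rw [bit_setBits]
    funext r
    by_cases hq : r = q
    · subst hq; simp
    by_cases hp : r = p
    · subst hp; simp [hq]
    simp [hq, hp, hy r hp hq]
  · intro s _
    simp [bit_setBits_fst x hpq, bit_setBits_snd]

lemma onTwoQubits_mul {p q : Qubit a n} (hpq : p ≠ q)
    (M N : Matrix (Fin 2 × Fin 2) (Fin 2 × Fin 2) ℂ) :
    onTwoQubits p q M * onTwoQubits p q N = onTwoQubits (a := a) (n := n) p q (M * N) := by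
  apply Matrix.mulVec_injective
  funext v x
  rw [← mulVec_mulVec, onTwoQubits_mulVec hpq, onTwoQubits_mulVec hpq]
  simp only [onTwoQubits_mulVec hpq, bit_setBits_fst x hpq, bit_setBits_snd,
    setBits_setBits x hpq, Finset.mul_sum, mul_apply, Finset.sum_mul]
  rw [Finset.sum_comm]
  simp only [mul_assoc]

lemma onTwoQubits_one (p q : Qubit a n) (hpq : p ≠ q) :
    onTwoQubits (a := a) (n := n) p q 1 = 1 := by
  apply Matrix.mulVec_injective
  funext v x
  rw [onTwoQubits_mulVec hpq, one_mulVec]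
  simp [one_apply, setBits_self]

lemma conjTranspose_onTwoQubits (p q : Qubit a n)
    (M : Matrix (Fin 2 × Fin 2) (Fin 2 × Fin 2) ℂ) :
    (onTwoQubits (a := a) (n := n) p q M)ᴴ = onTwoQubits p q Mᴴ := by
  ext x y
  simp only [conjTranspose_apply, onTwoQubits]
  rw [apply_ite star, star_zero]
  simp only [eq_comm]

lemma controlled_mulVec (c : Fin a) (V : Matrix (Sys n × Sys n) (Sys n × Sys n) ℂ)
    (v : Basis a n → ℂ) (z : Sys a) (y : Sys n × Sys n) :
    (controlled c V *ᵥ v) (z, y) =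
      if z c = 1 then (V *ᵥ fun y => v (z, y)) y else v (z, y) := by
  simp only [mulVec, dotProduct, controlled, ite_mul, zero_mul]
  rw [Fintype.sum_prod_type, Finset.sum_eq_single z]
  · simp only [if_true]
    split_ifs
    · rfl
    · simp [one_apply]
  · intro b _ hb
    simp [Ne.symm hb]
  · simp

lemma controlled_mul (c : Fin a) (V V' : Matrix (Sys n × Sys n) (Sys n × Sys n) ℂ) :
    controlled c V * controlled c V' = controlled c (V * V') := by
  apply Matrix.mulVec_injective
  funext v x
  obtain ⟨z, y⟩ := x
  rw [← mulVec_mulVec, controlled_mulVec, controlled_mulVec]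
  simp only [controlled_mulVec]
  split_ifs with h
  · rw [← mulVec_mulVec]
  · rfl

lemma controlled_one (c : Fin a) :
    controlled c (1 : Matrix (Sys n × Sys n) (Sys n × Sys n) ℂ) = 1 := by
  apply Matrix.mulVec_injective
  funext v x
  obtain ⟨z, y⟩ := x
  rw [controlled_mulVec]
  simp

lemma conjTranspose_controlled (c : Fin a) (V : Matrix (Sys n × Sys n) (Sys n × Sys n) ℂ) :
    (controlled c V)ᴴ = controlled c Vᴴ := by
  ext x y
  simp only [conjTranspose_apply, controlled]
  by_cases h : x.1 = y.1
  · rw [if_pos h, if_pos h.symm, h]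
    split_ifs
    · rfl
    · simp [one_apply, apply_ite star, eq_comm]
  · rw [if_neg h, if_neg (Ne.symm h), star_zero]

lemma reflection_isHermitian {ι : Type*} [DecidableEq ι] (P : ι → Prop)
    [DecidablePred P] :
    (1 - (2 : ℂ) • Matrix.diagonal fun x : ι => if P x then (1 : ℂ) else 0)ᴴ =
      1 - (2 : ℂ) • Matrix.diagonal fun x => if P x then 1 else 0 := by
  rw [conjTranspose_sub, conjTranspose_one, conjTranspose_smul, diagonal_conjTranspose]
  congr 2
  · simp
  · congr 1
    funext x
    simp [apply_ite star]

lemma reflection_mul_self {ι : Type*} [DecidableEq ι] [Fintype ι] (P : ι → Prop)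
    [DecidablePred P] :
    (1 - (2 : ℂ) • Matrix.diagonal fun x : ι => if P x then (1 : ℂ) else 0) *
      (1 - (2 : ℂ) • Matrix.diagonal fun x => if P x then (1 : ℂ) else 0) = 1 := by
  ext i j
  rw [show (1 - (2 : ℂ) • Matrix.diagonal fun x : ι => if P x then (1 : ℂ) else 0) =
    Matrix.diagonal fun x => if P x then -1 else 1 from ?_, diagonal_mul_diagonal,
    ← diagonal_one]
  · congr 2
    funext x
    split_ifs <;> norm_num
  · rw [← diagonal_one, ← diagonal_smul, diagonal_sub]
    congr 1
    funext x
    simp only [Pi.smul_apply, smul_eq_mul]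
    split_ifs <;> norm_num

variable (𝒰 : Matrix (Sys n) (Sys n) ℂ) (U₀ U : Matrix (Sys n × Sys n) (Sys n × Sys n) ℂ)

lemma Gate.op_inv (g : Gate a n) : g.inv.op 𝒰 U₀ U = (g.op 𝒰 U₀ U)ᴴ := by
  cases g with
  | twoQubit p q h M =>
    simp only [Gate.inv, Gate.op, conjTranspose_onTwoQubits]
    rfl
  | drive => simp [Gate.inv, Gate.op, conjTranspose_kronecker]
  | driveInv => simp [Gate.inv, Gate.op, conjTranspose_kronecker]
  | prep => simp [Gate.inv, Gate.op, conjTranspose_kronecker]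
  | prepInv => simp [Gate.inv, Gate.op, conjTranspose_kronecker]
  | ctrlU c => simp [Gate.inv, Gate.op, conjTranspose_controlled]
  | ctrlUInv c => simp [Gate.inv, Gate.op, conjTranspose_controlled]
  | reflAnc => exact (reflection_isHermitian _).symm
  | reflAll => exact (reflection_isHermitian _).symm

variable {𝒰 U₀ U}

lemma Gate.op_mul_conjTranspose (h𝒰 : 𝒰 * 𝒰ᴴ = 1) (hU₀ : U₀ * U₀ᴴ = 1) (hU : U * Uᴴ = 1)
    (g : Gate a n) : g.op 𝒰 U₀ U * (g.op 𝒰 U₀ U)ᴴ = 1 := by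
  have h𝒰' := mul_eq_one_comm.mp h𝒰
  have hU₀' := mul_eq_one_comm.mp hU₀
  have hU' := mul_eq_one_comm.mp hU
  cases g with
  | twoQubit p q h M =>
    simp only [Gate.op, conjTranspose_onTwoQubits]
    rw [onTwoQubits_mul h, ← star_eq_conjTranspose, (mem_unitaryGroup_iff).mp M.2,
      onTwoQubits_one p q h]
  | drive => simp [Gate.op, conjTranspose_kronecker, ← mul_kronecker_mul, h𝒰]
  | driveInv => simp [Gate.op, conjTranspose_kronecker, ← mul_kronecker_mul, h𝒰']
  | prep => simp [Gate.op, conjTranspose_kronecker, ← mul_kronecker_mul, hU₀]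
  | prepInv => simp [Gate.op, conjTranspose_kronecker, ← mul_kronecker_mul, hU₀']
  | ctrlU c => simp [Gate.op, conjTranspose_controlled, controlled_mul, hU, controlled_one]
  | ctrlUInv c => simp [Gate.op, conjTranspose_controlled, controlled_mul, hU', controlled_one]
  | reflAnc =>
    rw [Gate.op, reflection_isHermitian, reflection_mul_self]
  | reflAll =>
    rw [Gate.op, reflection_isHermitian, reflection_mul_self]

end Gates

/-! ### Circuits -/

section Circuits

variable {a n : ℕ} (𝒰 : Matrix (Sys n) (Sys n) ℂ)
  (U₀ U : Matrix (Sys n × Sys n) (Sys n × Sys n) ℂ)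

/-- The operator of a circuit. -/
def Circuit.mat : Circuit a n → Matrix (Basis a n) (Basis a n) ℂ
  | [] => 1
  | g :: c => Circuit.mat c * g.op 𝒰 U₀ U

lemma Circuit.run_eq_mat (c : Circuit a n) (v : Basis a n → ℂ) :
    Circuit.run 𝒰 U₀ U c v = Circuit.mat 𝒰 U₀ U c *ᵥ v := by
  induction c generalizing v with
  | nil => simp [Circuit.run, Circuit.mat]
  | cons g c ih =>
    rw [Circuit.mat, ← mulVec_mulVec, ← ih]
    rfl

lemma Circuit.run_append (c d : Circuit a n) (v : Basis a n → ℂ) :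
    Circuit.run 𝒰 U₀ U (c ++ d) v = Circuit.run 𝒰 U₀ U d (Circuit.run 𝒰 U₀ U c v) := by
  simp [Circuit.run]

lemma Circuit.mat_append (c d : Circuit a n) :
    Circuit.mat 𝒰 U₀ U (c ++ d) = Circuit.mat 𝒰 U₀ U d * Circuit.mat 𝒰 U₀ U c := by
  induction c with
  | nil => simp [Circuit.mat]
  | cons g c ih => simp [Circuit.mat, ih, mul_assoc]

lemma Circuit.mat_inv (c : Circuit a n) :
    Circuit.mat 𝒰 U₀ U c.inv = (Circuit.mat 𝒰 U₀ U c)ᴴ := by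
  induction c with
  | nil => simp [Circuit.mat, Circuit.inv]
  | cons g c ih =>
    have : Circuit.inv (g :: c) = Circuit.inv c ++ [g.inv] := by simp [Circuit.inv]
    rw [this, Circuit.mat_append, ih, Circuit.mat, Circuit.mat, Circuit.mat, conjTranspose_mul,
      one_mul, Gate.op_inv]

variable {𝒰 U₀ U} in
lemma Circuit.mat_mul_conjTranspose (h𝒰 : 𝒰 * 𝒰ᴴ = 1) (hU₀ : U₀ * U₀ᴴ = 1) (hU : U * Uᴴ = 1)
    (c : Circuit a n) : Circuit.mat 𝒰 U₀ U c * (Circuit.mat 𝒰 U₀ U c)ᴴ = 1 := by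
  induction c with
  | nil => simp [Circuit.mat]
  | cons g c ih =>
    rw [Circuit.mat, conjTranspose_mul, mul_assoc, ← mul_assoc (g.op _ _ _),
      Gate.op_mul_conjTranspose h𝒰 hU₀ hU, one_mul, ih]

lemma Circuit.uses_append (c d : Circuit a n) (k : Kind) :
    Circuit.uses (c ++ d) k = Circuit.uses c k + Circuit.uses d k := by
  simp [Circuit.uses]

/-- The type of the inverse of an operation. -/
def Kind.inv : Kind → Kind
  | .twoQubit => .twoQubit
  | .drive => .driveInv
  | .driveInv => .drive
  | .prep => .prepInv
  | .prepInv => .prep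
  | .ctrlU => .ctrlUInv
  | .ctrlUInv => .ctrlU
  | .reflAnc => .reflAnc
  | .reflAll => .reflAll

lemma Circuit.uses_inv (c : Circuit a n) (k : Kind) :
    Circuit.uses c.inv k = Circuit.uses c k.inv := by
  have hk : ∀ g : Gate a n, g.inv.kind = k ↔ g.kind = k.inv := by
    intro g
    cases g <;> cases k <;> simp [Gate.inv, Gate.kind, Kind.inv]
  induction c with
  | nil => simp [Circuit.uses, Circuit.inv]
  | cons g c ih =>
    have h1 : Circuit.inv (g :: c) = Circuit.inv c ++ [g.inv] := by simp [Circuit.inv]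
    have h2 : Circuit.uses [g.inv] k = Circuit.uses [g] k.inv := by
      simp only [Circuit.uses, List.map_cons, List.map_nil, List.count_singleton, beq_iff_eq, hk]
    have h3 : Circuit.uses (g :: c) k.inv = Circuit.uses [g] k.inv + Circuit.uses c k.inv :=
      Circuit.uses_append [g] c _
    rw [h1, Circuit.uses_append, ih, h2, h3, add_comm]

lemma AmpAlgorithm.uses_round (𝒜 : AmpAlgorithm n) (k : Kind) :
    𝒜.round.uses k = Circuit.uses 𝒜.A k + Circuit.uses 𝒜.A k.inv +
      ((if k = .reflAnc then 1 else 0) + if k = .reflAll then 1 else 0) := by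
  have h1 : Circuit.uses [(Gate.reflAnc : Gate 𝒜.anc n)] k = if k = .reflAnc then 1 else 0 := by
    cases k <;> simp [Circuit.uses, Gate.kind]
  have h2 : Circuit.uses [(Gate.reflAll : Gate 𝒜.anc n)] k = if k = .reflAll then 1 else 0 := by
    cases k <;> simp [Circuit.uses, Gate.kind]
  rw [AmpAlgorithm.round, Circuit.uses_append, Circuit.uses_append, Circuit.uses_append,
    Circuit.uses_inv, h1, h2]
  ring

end Circuits

/-! ### Dynamics of amplitude amplification -/

/-- The coefficients of the unnormalized good and bad components after `k` rounds, where `p` is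
the initial weight of the good component. -/
def ampCoeff (p : ℝ) : ℕ → ℝ × ℝ
  | 0 => (1, 1)
  | k + 1 =>
    ((2 * p - 1) * (ampCoeff p k).1 - 2 * (1 - p) * (ampCoeff p k).2,
      2 * p * (ampCoeff p k).1 + (2 * p - 1) * (ampCoeff p k).2)

/-- A round is a product of two reflections of the plane spanned by the good and the bad component:
a rotation by 2θ up to sign, whence the factor (-1)^k. The coefficients are multiplied by sin θ and
cos θ, so that nothing is divided by a component that may vanish. -/
lemma ampCoeff_mul_sin_cos (θ : ℝ) (k : ℕ) :
    (ampCoeff (Real.sin θ ^ 2) k).1 * Real.sin θ = (-1) ^ k * Real.sin ((2 * k + 1) * θ) ∧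
    (ampCoeff (Real.sin θ ^ 2) k).2 * Real.cos θ = (-1) ^ k * Real.cos ((2 * k + 1) * θ) := by
  induction k with
  | zero => simp [ampCoeff]
  | succ k ih =>
    obtain ⟨h1, h2⟩ := ih
    have hc := Real.sin_sq_add_cos_sq θ
    have e : (2 * ((k + 1 : ℕ) : ℝ) + 1) * θ = (2 * k + 1) * θ + 2 * θ := by push_cast; ring
    rw [e, Real.sin_add, Real.cos_add, Real.cos_two_mul, Real.sin_two_mul]
    have hs : Real.sin θ ^ 2 = 1 - Real.cos θ ^ 2 := by linarith
    constructor
    · simp only [ampCoeff]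
      linear_combination (2 * Real.sin θ ^ 2 - 1) * h1 - 2 * Real.sin θ * Real.cos θ * h2 +
        2 * (-1) ^ k * Real.sin ((2 * k + 1) * θ) * hs +
        2 * (ampCoeff (Real.sin θ ^ 2) k).2 * Real.sin θ * hs
    · simp only [ampCoeff]
      linear_combination (2 * Real.sin θ ^ 2 - 1) * h2 + 2 * Real.sin θ * Real.cos θ * h1 +
        2 * (-1) ^ k * Real.cos ((2 * k + 1) * θ) * hs

namespace AmpAlgorithm

variable {n : ℕ} (𝒜 : AmpAlgorithm n) (𝒰 : Matrix (Sys n) (Sys n) ℂ)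
  (U₀ U : Matrix (Sys n × Sys n) (Sys n × Sys n) ℂ)

/-- The unnormalized state of `s` and `s'` on the branch of `A |0⟩` with ancilla state `|0⟩`. -/
def good : Sys n × Sys n → ℂ := fun y => Circuit.run 𝒰 U₀ U 𝒜.A (ket 0) (0, y)

/-- The probability of the ancilla outcome `|0⟩` in the state `A |0⟩`. -/
def goodProb : ℝ := ∑ y, ‖𝒜.good 𝒰 U₀ U y‖ ^ 2

/-- The projection of a vector on the ancilla state `|0⟩`. -/
def ancProj {a n : ℕ} (v : Basis a n → ℂ) : Basis a n → ℂ := fun x => if x.1 = 0 then v x else 0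

lemma dotProduct_star_self {ι : Type*} [Fintype ι] (v : ι → ℂ) :
    star v ⬝ᵥ v = ((∑ x, ‖v x‖ ^ 2 : ℝ) : ℂ) := by
  simp only [dotProduct, Pi.star_apply, Complex.ofReal_sum]
  refine Finset.sum_congr rfl fun x _ => ?_
  rw [Complex.star_def, ← Complex.normSq_eq_conj_mul_self, Complex.normSq_eq_norm_sq]

lemma sum_norm_sq_ancProj {a n : ℕ} (v : Basis a n → ℂ) :
    ∑ x, ‖ancProj v x‖ ^ 2 = ∑ y, ‖v (0, y)‖ ^ 2 := by
  rw [Fintype.sum_prod_type, Finset.sum_eq_single 0]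
  · simp [ancProj]
  · intro z _ hz
    simp [ancProj, hz]
  · simp

lemma star_dotProduct_ancProj {a n : ℕ} (v : Basis a n → ℂ) :
    star v ⬝ᵥ ancProj v = ((∑ y, ‖v (0, y)‖ ^ 2 : ℝ) : ℂ) := by
  rw [← sum_norm_sq_ancProj, ← dotProduct_star_self]
  simp only [dotProduct, ancProj, Pi.star_apply]
  refine Finset.sum_congr rfl fun x _ => ?_
  split_ifs <;> simp

variable {𝒰 U₀ U}

lemma sum_norm_sq_run (h𝒰 : 𝒰 * 𝒰ᴴ = 1) (hU₀ : U₀ * U₀ᴴ = 1) (hU : U * Uᴴ = 1) {a : ℕ}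
    (c : Circuit a n) (v : Basis a n → ℂ) :
    ∑ x, ‖Circuit.run 𝒰 U₀ U c v x‖ ^ 2 = ∑ x, ‖v x‖ ^ 2 := by
  have h := mul_eq_one_comm.mp (Circuit.mat_mul_conjTranspose h𝒰 hU₀ hU c)
  rw [← Complex.ofReal_inj, ← dotProduct_star_self, ← dotProduct_star_self, Circuit.run_eq_mat,
    star_mulVec, ← dotProduct_mulVec, mulVec_mulVec, h, one_mulVec]

lemma run_round (h𝒰 : 𝒰 * 𝒰ᴴ = 1) (hU₀ : U₀ * U₀ᴴ = 1) (hU : U * Uᴴ = 1)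
    (v : Basis 𝒜.anc n → ℂ) :
    Circuit.run 𝒰 U₀ U 𝒜.round v = (v - (2 : ℂ) • ancProj v) -
      (2 * (star (Circuit.run 𝒰 U₀ U 𝒜.A (ket 0)) ⬝ᵥ (v - (2 : ℂ) • ancProj v))) •
        Circuit.run 𝒰 U₀ U 𝒜.A (ket 0) := by
  have h := Circuit.mat_mul_conjTranspose h𝒰 hU₀ hU 𝒜.A
  set M := Circuit.mat 𝒰 U₀ U 𝒜.A with hM
  have hanc : Circuit.run 𝒰 U₀ U [Gate.reflAnc] v = v - (2 : ℂ) • ancProj v := by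
    simp only [Circuit.run, List.foldl_cons, List.foldl_nil, Gate.op, sub_mulVec, one_mulVec,
      smul_mulVec]
    congr 2
    funext x
    simp [mulVec_diagonal, ancProj]
  have hall : ∀ w : Basis 𝒜.anc n → ℂ,
      Circuit.run 𝒰 U₀ U [Gate.reflAll] w = w - (2 * w 0) • ket 0 := by
    intro w
    simp only [Circuit.run, List.foldl_cons, List.foldl_nil, Gate.op, sub_mulVec, one_mulVec,
      smul_mulVec, mul_smul]
    congr 2
    funext x
    by_cases hx : x = 0
    · subst hx; simp [mulVec_diagonal, ket]
    · simp [mulVec_diagonal, ket, hx]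
  rw [AmpAlgorithm.round, Circuit.run_append, Circuit.run_append, Circuit.run_append, hanc, hall]
  set w := v - (2 : ℂ) • ancProj v
  rw [Circuit.run_eq_mat, Circuit.run_eq_mat, Circuit.run_eq_mat, Circuit.mat_inv, ← hM,
    mulVec_sub, mulVec_mulVec, h, one_mulVec, mulVec_smul]
  congr 3
  rw [star_mulVec, ← dotProduct_mulVec]
  simp [dotProduct, ket, Pi.single_apply, apply_ite star]

/-- The span of A|0⟩ and its projection is invariant under both reflections, and the action there
depends only on the weight of the good component. So the state after any number of rounds is
described by two real coefficients. -/
lemma state_eq (h𝒰 : 𝒰 * 𝒰ᴴ = 1) (hU₀ : U₀ * U₀ᴴ = 1) (hU : U * Uᴴ = 1) (k : ℕ) :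
    𝒜.state 𝒰 U₀ U k =
      ((ampCoeff (𝒜.goodProb 𝒰 U₀ U) k).1 : ℂ) •
        ancProj (Circuit.run 𝒰 U₀ U 𝒜.A (ket 0)) +
      ((ampCoeff (𝒜.goodProb 𝒰 U₀ U) k).2 : ℂ) •
        (Circuit.run 𝒰 U₀ U 𝒜.A (ket 0) - ancProj (Circuit.run 𝒰 U₀ U 𝒜.A (ket 0))) := by
  have hnorm : star (Circuit.run 𝒰 U₀ U 𝒜.A (ket 0)) ⬝ᵥ Circuit.run 𝒰 U₀ U 𝒜.A (ket 0) = 1 := by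
    rw [dotProduct_star_self, sum_norm_sq_run h𝒰 hU₀ hU, Finset.sum_eq_single 0]
    · simp [ket]
    · intro x _ hx
      simp [ket, hx]
    · simp
  have hg := star_dotProduct_ancProj (Circuit.run 𝒰 U₀ U 𝒜.A (ket 0))
  change _ = ((𝒜.goodProb 𝒰 U₀ U : ℝ) : ℂ) at hg
  induction k with
  | zero => simp [state, ampCoeff]
  | succ k ih =>
    rw [state, Function.iterate_succ_apply', ← state, ih, run_round 𝒜 h𝒰 hU₀ hU]
    set ψ := Circuit.run 𝒰 U₀ U 𝒜.A (ket 0)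
    set p := 𝒜.goodProb 𝒰 U₀ U
    set a := (ampCoeff p k).1
    set d := (ampCoeff p k).2
    have h1 : (a : ℂ) • ancProj ψ + (d : ℂ) • (ψ - ancProj ψ) -
        (2 : ℂ) • ancProj ((a : ℂ) • ancProj ψ + (d : ℂ) • (ψ - ancProj ψ)) =
        (-a - d : ℂ) • ancProj ψ + (d : ℂ) • ψ := by
      funext x
      simp only [ancProj, Pi.add_apply, Pi.sub_apply, Pi.smul_apply, smul_eq_mul]
      split_ifs <;> ring
    rw [h1, dotProduct_add, dotProduct_smul, dotProduct_smul, hg, hnorm]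
    funext x
    simp only [Pi.add_apply, Pi.sub_apply, Pi.smul_apply, smul_eq_mul, ampCoeff]
    push_cast
    ring

lemma goodProb_add (h𝒰 : 𝒰 * 𝒰ᴴ = 1) (hU₀ : U₀ * U₀ᴴ = 1) (hU : U * Uᴴ = 1) :
    ∑ x : Basis 𝒜.anc n, (if x.1 = 0 then 0 else
      ‖Circuit.run 𝒰 U₀ U 𝒜.A (ket 0) x‖ ^ 2) = 1 - 𝒜.goodProb 𝒰 U₀ U := by
  have h1 : ∑ x, ‖Circuit.run 𝒰 U₀ U 𝒜.A (ket 0) x‖ ^ 2 = 1 := by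
    rw [sum_norm_sq_run h𝒰 hU₀ hU, Finset.sum_eq_single 0]
    · simp [ket]
    · intro x _ hx
      simp [ket, hx]
    · simp
  have h2 := sum_norm_sq_ancProj (Circuit.run 𝒰 U₀ U 𝒜.A (ket 0))
  change _ = 𝒜.goodProb 𝒰 U₀ U at h2
  rw [← h1, ← h2, ← Finset.sum_sub_distrib]
  refine Finset.sum_congr rfl fun x _ => ?_
  simp only [ancProj]
  split_ifs <;> simp

lemma state_zero_anc (h𝒰 : 𝒰 * 𝒰ᴴ = 1) (hU₀ : U₀ * U₀ᴴ = 1) (hU : U * Uᴴ = 1) (k : ℕ)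
    (y : Sys n × Sys n) :
    𝒜.state 𝒰 U₀ U k (0, y) = (ampCoeff (𝒜.goodProb 𝒰 U₀ U) k).1 * 𝒜.good 𝒰 U₀ U y := by
  rw [state_eq 𝒜 h𝒰 hU₀ hU]
  simp [ancProj, good]

lemma successProb_eq (h𝒰 : 𝒰 * 𝒰ᴴ = 1) (hU₀ : U₀ * U₀ᴴ = 1) (hU : U * Uᴴ = 1) (k : ℕ) :
    𝒜.successProb 𝒰 U₀ U k =
      (ampCoeff (𝒜.goodProb 𝒰 U₀ U) k).1 ^ 2 * 𝒜.goodProb 𝒰 U₀ U := by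
  rw [successProb, Fintype.sum_prod_type, Finset.sum_eq_single 0, goodProb, Finset.mul_sum]
  · refine Finset.sum_congr rfl fun y _ => ?_
    rw [state_zero_anc 𝒜 h𝒰 hU₀ hU]
    simp [mul_pow, goodProb]
  · intro z _ hz
    simp [hz]
  · simp

lemma failureProb_eq (h𝒰 : 𝒰 * 𝒰ᴴ = 1) (hU₀ : U₀ * U₀ᴴ = 1) (hU : U * Uᴴ = 1) (k : ℕ) :
    𝒜.failureProb 𝒰 U₀ U k =
      (ampCoeff (𝒜.goodProb 𝒰 U₀ U) k).2 ^ 2 * (1 - 𝒜.goodProb 𝒰 U₀ U) := by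
  rw [failureProb, ← goodProb_add 𝒜 h𝒰 hU₀ hU, Finset.mul_sum]
  refine Finset.sum_congr rfl fun x _ => ?_
  rw [state_eq 𝒜 h𝒰 hU₀ hU]
  by_cases h : x.1 = 0
  · simp [h]
  · simp [ancProj, h, mul_pow]

/-- The number of rounds enters only through a scalar. Hence the normalized output is the same in
every successful attempt, and randomizing the schedule does not disturb it. -/
lemma outcome_eq (h𝒰 : 𝒰 * 𝒰ᴴ = 1) (hU₀ : U₀ * U₀ᴴ = 1) (hU : U * Uᴴ = 1) (k : ℕ) :
    𝒜.outcome 𝒰 U₀ U k = (((ampCoeff (𝒜.goodProb 𝒰 U₀ U) k).1 ^ 2 : ℝ) : ℂ) •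
      fun i j => ∑ l, 𝒜.good 𝒰 U₀ U (i, l) * star (𝒜.good 𝒰 U₀ U (j, l)) := by
  ext i j
  simp only [outcome, Pi.smul_apply, smul_eq_mul, Finset.mul_sum]
  refine Finset.sum_congr rfl fun l _ => ?_
  rw [state_zero_anc 𝒜 h𝒰 hU₀ hU, state_zero_anc 𝒜 h𝒰 hU₀ hU]
  simp
  ring

lemma failureProb_eq_cos_sq (h𝒰 : 𝒰 * 𝒰ᴴ = 1) (hU₀ : U₀ * U₀ᴴ = 1) (hU : U * Uᴴ = 1) {θ : ℝ}
    (hθ : 𝒜.goodProb 𝒰 U₀ U = Real.sin θ ^ 2) (k : ℕ) :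
    𝒜.failureProb 𝒰 U₀ U k = Real.cos ((2 * k + 1) * θ) ^ 2 := by
  have h := congrArg (· ^ 2) (ampCoeff_mul_sin_cos θ k).2
  simp only [mul_pow, ← pow_mul, mul_comm k 2] at h
  rw [failureProb_eq 𝒜 h𝒰 hU₀ hU, hθ, ← Real.cos_sq', h]
  simp [pow_mul]

end AmpAlgorithm

/-! ### The randomized numbers of rounds -/

/-- The upper bound on the number of rounds in attempt `t`. -/
def roundBound (t : ℕ) : ℕ := ⌊(6 / 5 : ℝ) ^ t⌋₊ + 1

/-- The number of rounds in attempt `t` is uniformly distributed below `roundBound t`. -/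
def growingSchedule (t : ℕ) : PMF ℕ :=
  PMF.uniformOfFinset (Finset.range (roundBound t)) (Finset.nonempty_range_iff.mpr (Nat.succ_ne_zero _))

lemma tsum_growingSchedule (t : ℕ) (f : ℕ → ENNReal) :
    ∑' k, growingSchedule t k * f k =
      (roundBound t : ENNReal)⁻¹ * ∑ k ∈ Finset.range (roundBound t), f k := by
  rw [tsum_eq_sum (s := Finset.range (roundBound t)), Finset.mul_sum]
  · refine Finset.sum_congr rfl fun k hk => ?_
    rw [growingSchedule, PMF.uniformOfFinset_apply_of_mem _ hk, Finset.card_range]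
  · intro k hk
    rw [growingSchedule, PMF.uniformOfFinset_apply_of_notMem _ hk, zero_mul]

/-- After cos² is written through the double angle, multiplication by sin(2θ) makes the sum
telescope. -/
lemma sum_cos_sq (θ : ℝ) (m : ℕ) :
    2 * Real.sin (2 * θ) * ∑ k ∈ Finset.range m, Real.cos ((2 * k + 1) * θ) ^ 2 =
      m * Real.sin (2 * θ) + Real.sin (4 * m * θ) / 2 := by
  induction m with
  | zero => simp
  | succ m ih =>
    rw [Finset.sum_range_succ, mul_add, ih]
    have e1 : 4 * ((m + 1 : ℕ) : ℝ) * θ = 2 * ((2 * m + 1) * θ) + 2 * θ := by push_cast; ring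
    have e2 : 4 * (m : ℝ) * θ = 2 * ((2 * m + 1) * θ) - 2 * θ := by ring
    rw [e1, e2, Real.sin_add, Real.sin_sub, Real.cos_sq]
    push_cast
    ring

/-- The mean of cos² is 1/2 plus an oscillating term of size at most 1 / (4 m sin 2θ). The bound on
the cosine gives sin θ ≤ sin 2θ, so this term is at most 1/4 once m sin θ ≥ 1. -/
lemma sum_cos_sq_le {θ : ℝ} (h0 : 0 < Real.sin θ) (hc : 1 / 2 ≤ Real.cos θ) {m : ℕ}
    (hm : 1 / Real.sin θ ≤ m) :
    ∑ k ∈ Finset.range m, Real.cos ((2 * k + 1) * θ) ^ 2 ≤ 3 / 4 * m := by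
  have h := sum_cos_sq θ m
  have h2 : Real.sin θ ≤ Real.sin (2 * θ) := by
    rw [Real.sin_two_mul]; nlinarith
  have h3 := Real.sin_le_one (4 * m * θ)
  rw [div_le_iff₀ h0] at hm
  have h5 : 1 ≤ m * Real.sin (2 * θ) := hm.trans (by gcongr)
  have h4 : 0 < Real.sin (2 * θ) := h0.trans_le h2
  refine le_of_mul_le_mul_left ?_ (mul_pos two_pos h4)
  rw [h]
  nlinarith

lemma roundBound_pos (t : ℕ) : 0 < roundBound t := Nat.succ_pos _

lemma le_roundBound (t : ℕ) : (6 / 5 : ℝ) ^ t ≤ roundBound t := by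
  have := Nat.lt_floor_add_one ((6 / 5 : ℝ) ^ t)
  rw [roundBound]
  push_cast
  exact this.le

lemma roundBound_le (t : ℕ) : (roundBound t : ℝ) ≤ 2 * (6 / 5 : ℝ) ^ t := by
  have := Nat.floor_le (show 0 ≤ (6 / 5 : ℝ) ^ t by positivity)
  have h1 : (1 : ℝ) ≤ (6 / 5) ^ t := one_le_pow₀ (by norm_num)
  rw [roundBound]
  push_cast
  linarith

/-! ### Termination and expected number of rounds for the growing schedule. -/

section Expectation

variable {n : ℕ} (𝒜 : AmpAlgorithm n) {𝒰 : Matrix (Sys n) (Sys n) ℂ}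
  {U₀ U : Matrix (Sys n × Sys n) (Sys n × Sys n) ℂ}

lemma tsum_growingSchedule_ofReal (t : ℕ) {f : ℕ → ℝ} (hf : ∀ k, 0 ≤ f k) :
    ∑' k, growingSchedule t k * ENNReal.ofReal (f k) =
      ENNReal.ofReal ((∑ k ∈ Finset.range (roundBound t), f k) / roundBound t) := by
  rw [tsum_growingSchedule, ← ENNReal.ofReal_sum_of_nonneg fun k _ => hf k,
    ENNReal.ofReal_div_of_pos (by exact_mod_cast roundBound_pos t), ENNReal.ofReal_natCast,
    div_eq_mul_inv, mul_comm]

lemma expected_succ_le (t : ℕ) :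
    ∑' k, growingSchedule t k * ((k : ENNReal) + 1) ≤
      ENNReal.ofReal (2 * (6 / 5 : ℝ) ^ t) := by
  have h : ∀ k : ℕ, (k : ENNReal) + 1 = ENNReal.ofReal ((k : ℝ) + 1) := by
    intro k
    rw [ENNReal.ofReal_add (by positivity) (by positivity)]
    simp
  simp only [h]
  rw [tsum_growingSchedule_ofReal t fun k => by positivity]
  apply ENNReal.ofReal_le_ofReal
  refine le_trans ?_ (roundBound_le t)
  have hpos : (0 : ℝ) < roundBound t := by exact_mod_cast roundBound_pos t
  rw [div_le_iff₀ hpos]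
  calc ∑ k ∈ Finset.range (roundBound t), ((k : ℝ) + 1)
      ≤ ∑ k ∈ Finset.range (roundBound t), (roundBound t : ℝ) := by
        refine Finset.sum_le_sum fun k hk => ?_
        exact_mod_cast Finset.mem_range.mp hk
    _ = _ := by simp

variable (h𝒰 : 𝒰 * 𝒰ᴴ = 1) (hU₀ : U₀ * U₀ᴴ = 1) (hU : U * Uᴴ = 1) {θ : ℝ}
  (hθ : 𝒜.goodProb 𝒰 U₀ U = Real.sin θ ^ 2) (hsch : 𝒜.schedule = growingSchedule)
  (h0 : 0 < Real.sin θ) (hc : 1 / 2 ≤ Real.cos θ)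

include h𝒰 hU₀ hU hθ

lemma reachFactor_eq (t : ℕ) :
    ∑' k, growingSchedule t k * ENNReal.ofReal (𝒜.failureProb 𝒰 U₀ U k) =
      ENNReal.ofReal ((∑ k ∈ Finset.range (roundBound t), Real.cos ((2 * k + 1) * θ) ^ 2) /
        roundBound t) := by
  simp only [AmpAlgorithm.failureProb_eq_cos_sq 𝒜 h𝒰 hU₀ hU hθ]
  exact tsum_growingSchedule_ofReal t fun k => by positivity

lemma reachFactor_le_one (t : ℕ) :
    ∑' k, growingSchedule t k * ENNReal.ofReal (𝒜.failureProb 𝒰 U₀ U k) ≤ 1 := by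
  rw [reachFactor_eq 𝒜 h𝒰 hU₀ hU hθ, ← ENNReal.ofReal_one]
  apply ENNReal.ofReal_le_ofReal
  have hpos : (0 : ℝ) < roundBound t := by exact_mod_cast roundBound_pos t
  rw [div_le_one hpos]
  calc ∑ k ∈ Finset.range (roundBound t), Real.cos ((2 * k + 1) * θ) ^ 2
      ≤ ∑ k ∈ Finset.range (roundBound t), (1 : ℝ) :=
        Finset.sum_le_sum fun k _ => Real.cos_sq_le_one _
    _ = _ := by simp

include h0 hc

lemma reachFactor_le (t : ℕ) (ht : 1 / Real.sin θ ≤ (6 / 5 : ℝ) ^ t) :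
    ∑' k, growingSchedule t k * ENNReal.ofReal (𝒜.failureProb 𝒰 U₀ U k) ≤
      ENNReal.ofReal (3 / 4) := by
  rw [reachFactor_eq 𝒜 h𝒰 hU₀ hU hθ]
  apply ENNReal.ofReal_le_ofReal
  have hpos : (0 : ℝ) < roundBound t := by exact_mod_cast roundBound_pos t
  rw [div_le_iff₀ hpos]
  exact sum_cos_sq_le h0 hc (ht.trans (le_roundBound t))

include hsch

/-- From attempt `t₀` on, the range of the random number of rounds exceeds 1 / sin θ and every
attempt fails with probability at most 3/4. The earlier attempts are bounded by one; truncated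
subtraction covers both regimes. -/
lemma reachProb_le {t₀ : ℕ} (ht₀ : 1 / Real.sin θ ≤ (6 / 5 : ℝ) ^ t₀) (t : ℕ) :
    𝒜.reachProb 𝒰 U₀ U t ≤ ENNReal.ofReal ((3 / 4) ^ (t - t₀)) := by
  induction t with
  | zero => simp [AmpAlgorithm.reachProb]
  | succ t ih =>
    rw [AmpAlgorithm.reachProb, Finset.prod_range_succ, ← AmpAlgorithm.reachProb, hsch]
    by_cases h : t₀ ≤ t
    · rw [Nat.succ_sub h, pow_succ, ENNReal.ofReal_mul (by positivity)]
      refine mul_le_mul' ih (reachFactor_le 𝒜 h𝒰 hU₀ hU hθ h0 hc t (ht₀.trans ?_))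
      exact pow_le_pow_right₀ (by norm_num) h
    · have e1 : t - t₀ = 0 := by omega
      have e2 : t + 1 - t₀ = 0 := by omega
      rw [e1] at ih
      rw [e2]
      calc _ ≤ _ := mul_le_mul' ih (reachFactor_le_one 𝒜 h𝒰 hU₀ hU hθ t)
        _ = _ := by simp

lemma tendsto_reachProb : Tendsto (𝒜.reachProb 𝒰 U₀ U) atTop (𝓝 0) := by
  obtain ⟨t₀, ht₀⟩ := pow_unbounded_of_one_lt (1 / Real.sin θ) (show (1 : ℝ) < 6 / 5 by norm_num)
  refine tendsto_of_tendsto_of_tendsto_of_le_of_le tendsto_const_nhds ?_ (fun t => zero_le)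
    (reachProb_le 𝒜 h𝒰 hU₀ hU hθ hsch h0 hc ht₀.le)
  rw [← ENNReal.ofReal_zero]
  refine ENNReal.tendsto_ofReal ?_
  exact (tendsto_pow_atTop_nhds_zero_of_lt_one (by norm_num) (by norm_num)).comp
    (tendsto_sub_atTop_nat t₀)

/-- Attempt `t` costs at most 2 (6/5)^t and is reached with probability at most (3/4)^(t - t₀).
Since 6/5 · 3/4 = 9/10 < 1, the series is dominated by (6/5)^t₀, which is at most 6/5 times 1 / sin
θ. -/
lemma expectedRounds_le : 𝒜.expectedRounds 𝒰 U₀ U ≤ ENNReal.ofReal (36 / Real.sin θ) := by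
  have h1 : 1 ≤ 1 / Real.sin θ := by
    rw [le_div_iff₀ h0, one_mul]; exact Real.sin_le_one θ
  obtain ⟨t₀, ht₀, ht₀'⟩ : ∃ t₀ : ℕ, 1 / Real.sin θ ≤ (6 / 5 : ℝ) ^ t₀ ∧
      (6 / 5 : ℝ) ^ t₀ ≤ 6 / 5 * (1 / Real.sin θ) := by
    obtain ⟨t, ht, ht'⟩ := exists_nat_pow_near h1 (show (1 : ℝ) < 6 / 5 by norm_num)
    refine ⟨t + 1, ht'.le, ?_⟩
    rw [pow_succ, mul_comm]
    gcongr
  have hterm : ∀ t, 𝒜.reachProb 𝒰 U₀ U t * ∑' k, 𝒜.schedule t k * ((k : ENNReal) + 1) ≤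
      ENNReal.ofReal (2 * (6 / 5) ^ t * (3 / 4) ^ (t - t₀)) := by
    intro t
    rw [hsch, mul_comm, ENNReal.ofReal_mul (by positivity)]
    exact mul_le_mul' (expected_succ_le t) (reachProb_le 𝒜 h𝒰 hU₀ hU hθ hsch h0 hc ht₀ t)
  have hshift : ∀ i : ℕ, (2 * (6 / 5) ^ (i + t₀) * (3 / 4) ^ (i + t₀ - t₀) : ℝ) =
      2 * (6 / 5) ^ t₀ * (9 / 10) ^ i := by
    intro i
    rw [Nat.add_sub_cancel, pow_add, show (9 / 10 : ℝ) = 6 / 5 * (3 / 4) by norm_num, mul_pow]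
    ring
  have hgeo := summable_geometric_of_lt_one (r := (9 / 10 : ℝ)) (by norm_num) (by norm_num)
  have hsum : Summable fun t : ℕ => (2 * (6 / 5) ^ t * (3 / 4) ^ (t - t₀) : ℝ) := by
    rw [← summable_nat_add_iff t₀]
    simp only [hshift]
    exact hgeo.mul_left _
  refine (ENNReal.tsum_le_tsum hterm).trans ?_
  rw [← ENNReal.ofReal_tsum_of_nonneg (fun t => by positivity) hsum]
  apply ENNReal.ofReal_le_ofReal
  -- The terms before `t₀` contribute less than 10 (6/5)^t₀ and the rest 20 (6/5)^t₀, which gives 30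
  -- · 6/5 = 36.
  rw [← hsum.sum_add_tsum_nat_add t₀]
  simp only [hshift]
  rw [tsum_mul_left, tsum_geometric_of_lt_one (by norm_num) (by norm_num)]
  have hfirst : ∑ t ∈ Finset.range t₀, (2 * (6 / 5) ^ t * (3 / 4) ^ (t - t₀) : ℝ) =
      10 * ((6 / 5) ^ t₀ - 1) := by
    rw [Finset.sum_congr rfl (g := fun t => 2 * (6 / 5 : ℝ) ^ t), ← Finset.mul_sum,
      geom_sum_eq (by norm_num)]
    · ring
    · intro t ht
      have : t - t₀ = 0 := by have := Finset.mem_range.mp ht; omega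
      simp [this]
  rw [hfirst]
  have : (36 / Real.sin θ : ℝ) = 30 * (6 / 5 * (1 / Real.sin θ)) := by ring
  rw [this]
  linarith

end Expectation

/-! ### Linear combinations of powers of a controlled unitary -/

section Lcu

variable {a n : ℕ}

lemma blockDiagonal_mem_unitaryGroup (G : Fin 2 → Matrix.unitaryGroup (Fin 2) ℂ) :
    blockDiagonal (fun s => (G s).1) ∈ Matrix.unitaryGroup (Fin 2 × Fin 2) ℂ := by
  rw [mem_unitaryGroup_iff, star_eq_conjTranspose, blockDiagonal_conjTranspose,
    ← blockDiagonal_mul, ← blockDiagonal_one]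
  congr 1
  funext s
  exact mem_unitaryGroup_iff.mp (G s).2

/-- The one-qubit gate `G s` on the ancilla qubit `t`, selected by the value `s` of the ancilla
qubit `c`. -/
def selectGate (t c : Fin a) (h : t ≠ c) (G : Fin 2 → Matrix.unitaryGroup (Fin 2) ℂ) : Gate a n :=
  .twoQubit (.inl t) (.inl c) (fun e => h (Sum.inl_injective e))
    ⟨_, blockDiagonal_mem_unitaryGroup G⟩

variable (𝒰 : Matrix (Sys n) (Sys n) ℂ) (U₀ U : Matrix (Sys n × Sys n) (Sys n × Sys n) ℂ)

lemma setBits_inl (z : Sys a) (w : Sys n × Sys n) (t c : Fin a) (s r : Fin 2) :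
    setBits ((z, w) : Basis a n) (.inl t) (.inl c) (s, r) =
      (Function.update (Function.update z t s) c r, w) := by
  apply bit_injective
  rw [bit_setBits]
  funext q
  rcases q with i | i | i
  · by_cases hc : i = c
    · subst hc; simp [bit]
    by_cases ht : i = t
    · subst ht; simp [bit, hc]
    simp [bit, hc, ht]
  · simp [bit]
  · simp [bit]

lemma run_selectGate (t c : Fin a) (h : t ≠ c) (G : Fin 2 → Matrix.unitaryGroup (Fin 2) ℂ)
    (v : Basis a n → ℂ) (z : Sys a) (w : Sys n × Sys n) :
    Circuit.run 𝒰 U₀ U [selectGate t c h G] v (z, w) =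
      ∑ s, (G (z c)).1 (z t) s * v (Function.update z t s, w) := by
  have hne : (Sum.inl t : Qubit a n) ≠ Sum.inl c := fun e => h (Sum.inl_injective e)
  simp only [Circuit.run, List.foldl_cons, List.foldl_nil, selectGate, Gate.op]
  rw [onTwoQubits_mulVec hne, Fintype.sum_prod_type]
  refine Finset.sum_congr rfl fun s _ => ?_
  rw [Finset.sum_eq_single (z c)]
  · rw [setBits_inl]
    have : Function.update (Function.update z t s) c (z c) = Function.update z t s := by
      rw [Function.update_eq_self_iff, Function.update_of_ne h.symm]
    rw [this]
    simp [blockDiagonal_apply, bit]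
  · intro r _ hr
    simp [blockDiagonal_apply, bit, Ne.symm hr]
  · simp

lemma twoLevel_mem_unitaryGroup {u v : ℂ} (h : ‖u‖ ^ 2 + ‖v‖ ^ 2 = 1) :
    !![u, v; -star v, star u] ∈ Matrix.unitaryGroup (Fin 2) ℂ := by
  have h1 : u * star u + v * star v = 1 := by
    rw [Complex.star_def, Complex.mul_conj, Complex.mul_conj,
      Complex.normSq_eq_norm_sq, Complex.normSq_eq_norm_sq]
    exact_mod_cast h
  rw [mem_unitaryGroup_iff]
  ext i j
  fin_cases i <;> fin_cases j <;> simp [mul_apply, star_apply, Fin.sum_univ_two] <;>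
    simp only [Complex.star_def] at h1 <;> first | linear_combination h1 | ring

/-- Two one-qubit gates whose two paths from `0` to `0` have prescribed amplitudes. -/
lemma exists_twoLevel (p : ℂ) {q : ℝ} (hq : 0 ≤ q) (h : ‖p‖ + q ≤ 1) :
    ∃ R S : Matrix.unitaryGroup (Fin 2) ℂ,
      S.1 0 0 * R.1 0 0 = p ∧ S.1 0 1 * R.1 1 0 = q := by
  have hp := norm_nonneg p
  -- With rotation angles α and γ the two paths have amplitudes cos α cos γ and sin α sin γ. Their
  -- sum and difference are cos(α - γ) and cos(α + γ), which are prescribed here; the phase of `p`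
  -- is put into the second gate.
  set A := Real.arccos (‖p‖ + q)
  set B := Real.arccos (‖p‖ - q)
  have hA : Real.cos A = ‖p‖ + q := Real.cos_arccos (by linarith) h
  have hB : Real.cos B = ‖p‖ - q := Real.cos_arccos (by linarith) (by linarith)
  set α := (A + B) / 2
  set γ := (B - A) / 2
  have eA : A = α - γ := by simp only [α, γ]; ring
  have eB : B = α + γ := by simp only [α, γ]; ring
  rw [eA, Real.cos_sub] at hA
  rw [eB, Real.cos_add] at hB
  set u : ℂ := Complex.exp (Complex.I * p.arg)
  have hu : ‖u‖ = 1 := by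
    rw [show u = Complex.exp (p.arg * Complex.I) by simp only [u, mul_comm],
      Complex.norm_exp_ofReal_mul_I]
  have hup : (‖p‖ : ℂ) * u = p := by
    have := Complex.norm_mul_exp_arg_mul_I p
    rwa [mul_comm (p.arg : ℂ)] at this
  refine ⟨⟨_, twoLevel_mem_unitaryGroup (u := (Real.cos γ : ℂ)) (v := ((-Real.sin γ : ℝ) : ℂ)) ?_⟩,
    ⟨_, twoLevel_mem_unitaryGroup (u := u * (Real.cos α : ℝ)) (v := ((Real.sin α : ℝ) : ℂ)) ?_⟩,
    ?_, ?_⟩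
  · simp only [Complex.norm_real, Real.norm_eq_abs, sq_abs]
    nlinarith [Real.sin_sq_add_cos_sq γ]
  · simp only [norm_mul, Complex.norm_real, Real.norm_eq_abs, sq_abs, hu, one_mul]
    nlinarith [Real.sin_sq_add_cos_sq α]
  · simp only [of_apply, cons_val_zero]
    rw [← hup, mul_assoc, mul_comm (‖p‖ : ℂ)]
    congr 1
    rw [← Complex.ofReal_mul]
    congr 1
    linarith
  · simp only [of_apply, cons_val_zero, cons_val_one, Complex.star_def, Complex.conj_ofReal]
    rw [← Complex.ofReal_neg, ← Complex.ofReal_mul]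
    congr 1
    linarith

/-- The vector vanishes unless all ancilla qubits after `k` are in the state `|0⟩`. -/
def Clean (k : Fin a) (v : Basis a n → ℂ) : Prop :=
  ∀ z w, (∃ i, k < i ∧ z i ≠ 0) → v (z, w) = 0

/-- The circuit `c`, started in and projected on the state `|0⟩` of the ancilla qubits after `k`,
acts as `F` controlled on the ancilla qubit `k`. -/
def Encodes (c : Circuit a n) (k : Fin a) (F : Matrix (Sys n × Sys n) (Sys n × Sys n) ℂ) : Prop :=
  ∀ v : Basis a n → ℂ, Clean k v → ∀ z w, (∀ i, k < i → z i = 0) →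
    Circuit.run 𝒰 U₀ U c v (z, w) = if z k = 1 then (F *ᵥ fun y => v (z, y)) w else v (z, w)

variable {𝒰 U₀ U}

lemma run_ctrlU (k : Fin a) (v : Basis a n → ℂ) (z : Sys a) (w : Sys n × Sys n) :
    Circuit.run 𝒰 U₀ U [Gate.ctrlU k] v (z, w) =
      if z k = 1 then (U *ᵥ fun y => v (z, y)) w else v (z, w) :=
  controlled_mulVec k U v z w

lemma run_ctrlUInv (k : Fin a) (v : Basis a n → ℂ) (z : Sys a) (w : Sys n × Sys n) :
    Circuit.run 𝒰 U₀ U [Gate.ctrlUInv k] v (z, w) =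
      if z k = 1 then (Uᴴ *ᵥ fun y => v (z, y)) w else v (z, w) :=
  controlled_mulVec k Uᴴ v z w

lemma Clean.ctrlU {k l : Fin a} {v : Basis a n → ℂ} (hv : Clean k v) :
    Clean k (Circuit.run 𝒰 U₀ U [Gate.ctrlU l] v) := by
  intro z w hz
  rw [run_ctrlU, hv z w hz]
  simp [hv z _ hz, mulVec, dotProduct]

lemma Encodes.ctrlU {c : Circuit a n} {k : Fin a}
    {F : Matrix (Sys n × Sys n) (Sys n × Sys n) ℂ} (hc : Encodes 𝒰 U₀ U c k F) :
    Encodes 𝒰 U₀ U ([Gate.ctrlU k] ++ c) k (F * U) := by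
  intro v hv z w hz
  rw [Circuit.run_append, hc _ hv.ctrlU z w hz]
  simp only [run_ctrlU]
  split_ifs with h
  · rw [← mulVec_mulVec]
  · rfl

lemma Encodes.nil (k : Fin a) : Encodes (n := n) 𝒰 U₀ U [] k 1 := by
  intro v hv z w hz
  simp [Circuit.run]

/-- The gate on a qubit that is `1` or `R`, depending on the control qubit. -/
def ifOne (R : Matrix.unitaryGroup (Fin 2) ℂ) : Fin 2 → Matrix.unitaryGroup (Fin 2) ℂ :=
  fun s => if s = 1 then R else 1

/-- Between `R` and `S` the qubit `l` follows two paths from 0 to 0: through 0, where the inner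
block is inactive, and through 1, where it acts as `F`. Projection on 0 adds their amplitudes. If
qubit `k` is 0, both gates are trivial and so is the block. -/
lemma Encodes.sandwich {c : Circuit a n} {k l : Fin a} (hkl : (l : ℕ) = k + 1)
    {F : Matrix (Sys n × Sys n) (Sys n × Sys n) ℂ} (hc : Encodes 𝒰 U₀ U c l F)
    (R S : Matrix.unitaryGroup (Fin 2) ℂ) (hne : l ≠ k) :
    Encodes 𝒰 U₀ U ([selectGate l k hne (ifOne R)] ++ c ++ [selectGate l k hne (ifOne S)]) k
      ((S.1 0 0 * R.1 0 0) • 1 + (S.1 0 1 * R.1 1 0) • F) := by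
  intro v hv z w hz
  have hlt : k < l := by rw [Fin.lt_def]; omega
  have hafter : ∀ i, l < i → k < i := fun i hi => hlt.trans hi
  have hzl : z l = 0 := hz l hlt
  have hz0 : Function.update z l 0 = z := by rw [Function.update_eq_self_iff, hzl]
  set v₁ := Circuit.run 𝒰 U₀ U [selectGate l k hne (ifOne R)] v with hv₁
  have hclean : Clean l v₁ := by
    rintro z w ⟨i, hi, hzi⟩
    rw [hv₁, run_selectGate]
    refine Finset.sum_eq_zero fun s _ => ?_
    rw [hv _ w ⟨i, hafter i hi, by rwa [Function.update_of_ne hi.ne']⟩, mul_zero]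
  have hupd : ∀ s i, l < i → Function.update z l s i = 0 := by
    intro s i hi
    rw [Function.update_of_ne hi.ne', hz i (hafter i hi)]
  have hdirty : ∀ w, v (Function.update z l 1, w) = 0 := fun w =>
    hv _ w ⟨l, hlt, by simp⟩
  have hval : ∀ s w, v₁ (Function.update z l s, w) = (ifOne R (z k)).1 s 0 * v (z, w) := by
    intro s w
    rw [hv₁, run_selectGate, Fin.sum_univ_two]
    simp only [Function.update_idem, Function.update_self, Function.update_of_ne hne.symm, hz0,
      hdirty, mul_zero, add_zero]
  rw [Circuit.run_append, Circuit.run_append, run_selectGate, Fin.sum_univ_two,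
    hc v₁ hclean _ w (hupd 0), hc v₁ hclean _ w (hupd 1)]
  simp only [Function.update_self, hval, hzl]
  simp only [zero_ne_one, if_true, if_false]
  have hF : (F *ᵥ fun y => (ifOne R (z k)).1 1 0 * v (z, y)) w =
      (ifOne R (z k)).1 1 0 * (F *ᵥ fun y => v (z, y)) w := by
    change (F *ᵥ ((ifOne R (z k)).1 1 0 • fun y => v (z, y))) w = _
    rw [mulVec_smul]
    rfl
  rw [hF]
  by_cases h : z k = 1
  · simp only [ifOne, h, if_true, add_mulVec, smul_mulVec, one_mulVec, Pi.add_apply,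
      Pi.smul_apply, smul_eq_mul]
    ring
  · simp [ifOne, h]

variable (n) in
/-- Polynomials in `U` with coefficients of absolute sum at most one are implemented by nested
blocks, one ancilla qubit per block. -/
lemma exists_encodes (d : ℕ) : ∀ (k : ℕ) (hk : k + d + 1 < a) (c : ℕ → ℂ),
    ∑ j ∈ Finset.range (d + 1), ‖c j‖ ≤ 1 →
    ∃ C : Circuit a n,
      C.uses .twoQubit = 2 * (d + 1) ∧ C.uses .ctrlU = d ∧ C.uses .ctrlUInv = 0 ∧
      C.uses .drive = 0 ∧ C.uses .driveInv = 0 ∧ C.uses .prep = 0 ∧ C.uses .prepInv = 0 ∧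
      C.uses .reflAnc = 0 ∧ C.uses .reflAll = 0 ∧
      ∀ 𝒰 U₀ U, Encodes 𝒰 U₀ U C ⟨k, by omega⟩ (∑ j ∈ Finset.range (d + 1), c j • U ^ j) := by
  induction d with
  | zero =>
    intro k hk c hc
    -- A constant polynomial still needs one further qubit, to realize a scalar of modulus below one
    -- as a projected amplitude; the path through 1 gets amplitude 0.
    obtain ⟨R, S, h0, h1⟩ := exists_twoLevel (c 0) (le_refl 0) (by simpa using hc)
    have hne : (⟨k + 1, by omega⟩ : Fin a) ≠ ⟨k, by omega⟩ := by simp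
    refine ⟨[selectGate _ _ hne (ifOne R)] ++ [] ++ [selectGate _ _ hne (ifOne S)], ?_, ?_, ?_, ?_,
      ?_, ?_, ?_, ?_, ?_, fun 𝒰 U₀ U => ?_⟩
    iterate 9 rfl
    have := (Encodes.nil (n := n) (𝒰 := 𝒰) (U₀ := U₀) (U := U) (⟨k + 1, by omega⟩ : Fin a)).sandwich
      (k := ⟨k, by omega⟩) rfl R S hne
    rw [h0, h1] at this
    simpa using this
  | succ d ih =>
    intro k hk c hc
    -- Horner's scheme: the polynomial is c₀ + q (∑ (c_{j+1} / q) U^j) U. The choice of `q` keeps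
    -- the coefficient sum of the inner polynomial at most one, so no normalization is lost in the
    -- recursion.
    set q : ℝ := ∑ j ∈ Finset.range (d + 1), ‖c (j + 1)‖ with hq
    have hq0 : 0 ≤ q := Finset.sum_nonneg fun _ _ => norm_nonneg _
    rw [Finset.sum_range_succ'] at hc
    obtain ⟨R, S, h0, h1⟩ := exists_twoLevel (c 0) hq0 (by linarith)
    have hdiv : ∑ j ∈ Finset.range (d + 1), ‖c (j + 1) / q‖ ≤ 1 := by
      simp only [norm_div, Complex.norm_real, Real.norm_of_nonneg hq0]
      rw [← Finset.sum_div]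
      exact div_self_le_one q
    obtain ⟨C, u1, u2, u3, u4, u5, u6, u7, u8, u9, hC⟩ :=
      ih (k + 1) (by omega) (fun j => c (j + 1) / q) hdiv
    have hne : (⟨k + 1, by omega⟩ : Fin a) ≠ ⟨k, by omega⟩ := by simp
    refine ⟨[selectGate _ _ hne (ifOne R)] ++ ([Gate.ctrlU ⟨k + 1, by omega⟩] ++ C) ++
      [selectGate _ _ hne (ifOne S)], ?_, ?_, ?_, ?_, ?_, ?_, ?_, ?_, ?_, fun 𝒰 U₀ U => ?_⟩
    iterate 9
      simp only [Circuit.uses_append, u1, u2, u3, u4, u5, u6, u7, u8, u9]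
      simp [Circuit.uses, Gate.kind, selectGate]
      try omega
    have := ((hC 𝒰 U₀ U).ctrlU).sandwich (k := ⟨k, by omega⟩) rfl R S hne
    rw [h0, h1] at this
    rw [Finset.sum_range_succ', pow_zero, add_comm (Finset.sum _ _)]
    convert this using 2
    rw [Finset.sum_mul, Finset.smul_sum]
    refine Finset.sum_congr rfl fun j hj => ?_
    rw [smul_mul_assoc, smul_smul, ← pow_succ]
    congr 1
    -- If q = 0, the remaining coefficients all vanish and division by zero is harmless.
    rcases eq_or_ne q 0 with hz | hz
    · have := (Finset.sum_eq_zero_iff_of_nonneg fun _ _ => norm_nonneg _).mp (hq.symm.trans hz) j hj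
      rw [norm_eq_zero] at this
      rw [this]; simp
    · field_simp

/-- The Pauli `X` gate. -/
def pauliX : Matrix.unitaryGroup (Fin 2) ℂ :=
  ⟨!![0, 1; 1, 0], by
    rw [mem_unitaryGroup_iff]
    ext i j
    fin_cases i <;> fin_cases j <;> simp [mul_apply, star_apply, Fin.sum_univ_two]⟩

lemma run_pauliX (t c : Fin a) (h : t ≠ c) (v : Basis a n → ℂ) (z : Sys a) (w : Sys n × Sys n) :
    Circuit.run 𝒰 U₀ U [selectGate t c h fun _ => pauliX] v (z, w) =
      v (Function.update z t (1 - z t), w) := by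
  rw [run_selectGate, Fin.sum_univ_two]
  rcases Fin.exists_fin_two.mp ⟨z t, rfl⟩ with h | h <;> simp [h, pauliX]

lemma run_replicate_ctrlUInv (k : Fin a) (v : Basis a n → ℂ) (J : ℕ) :
    Circuit.run 𝒰 U₀ U (List.replicate J (Gate.ctrlUInv k)) v =
      fun x => if x.1 k = 1 then (Uᴴ ^ J *ᵥ fun y => v (x.1, y)) x.2 else v x := by
  induction J with
  | zero => funext x; simp [Circuit.run]
  | succ J ih =>
    rw [List.replicate_succ', Circuit.run_append, ih]
    funext x
    obtain ⟨z, w⟩ := x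
    rw [run_ctrlUInv]
    by_cases h : z k = 1
    · simp only [h, if_true]
      rw [pow_succ', ← mulVec_mulVec]
    · simp [h]

variable (n) in
/-- A circuit that implements the Laurent polynomial `∑ j, c j U ^ (j - J)` when the ancilla
register is started in and projected on the state `|0⟩`. -/
lemma exists_laurent (d J : ℕ) (c : ℕ → ℂ) (hc : ∑ j ∈ Finset.range (d + 1), ‖c j‖ ≤ 1) :
    ∃ C : Circuit (d + 2) n,
      C.uses .twoQubit = 2 * d + 4 ∧ C.uses .ctrlU = d ∧ C.uses .ctrlUInv = J ∧
      C.uses .drive = 0 ∧ C.uses .driveInv = 0 ∧ C.uses .prep = 0 ∧ C.uses .prepInv = 0 ∧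
      C.uses .reflAnc = 0 ∧ C.uses .reflAll = 0 ∧
      ∀ 𝒰 U₀ U u w, Circuit.run 𝒰 U₀ U C (fun x => if x.1 = 0 then u x.2 else 0) (0, w) =
        (((∑ j ∈ Finset.range (d + 1), c j • U ^ j) * Uᴴ ^ J) *ᵥ u) w := by
  obtain ⟨C, u1, u2, u3, u4, u5, u6, u7, u8, u9, hC⟩ :=
    exists_encodes n (a := d + 2) d 0 (by omega) c hc
  have hne : (0 : Fin (d + 2)) ≠ 1 := by simp
  have hrep : ∀ k : Kind, Circuit.uses (List.replicate J (Gate.ctrlUInv 0 : Gate (d + 2) n)) k =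
      if k = .ctrlUInv then J else 0 := by
    intro k
    simp only [Circuit.uses, List.map_replicate, List.count_replicate]
    cases k <;> simp [Gate.kind]
  -- The X gates switch on the control qubit 0 of the outermost block and restore it. Qubit 1 is a
  -- dummy second qubit for them. In between, the inverse powers of `U` shift all exponents by -J.
  refine ⟨[selectGate 0 1 hne fun _ => pauliX] ++ List.replicate J (Gate.ctrlUInv 0) ++ C ++
    [selectGate 0 1 hne fun _ => pauliX], ?_, ?_, ?_, ?_, ?_, ?_, ?_, ?_, ?_,
    fun 𝒰 U₀ U u w => ?_⟩
  iterate 9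
    simp only [Circuit.uses_append, u1, u2, u3, u4, u5, u6, u7, u8, u9, hrep]
    simp [Circuit.uses, Gate.kind, selectGate]
    try omega
  simp only [Circuit.run_append]
  rw [run_pauliX, run_replicate_ctrlUInv]
  set v₁ := Circuit.run 𝒰 U₀ U [selectGate 0 1 hne fun _ => pauliX]
    (fun x : Basis (d + 2) n => if x.1 = 0 then u x.2 else 0) with hv₁
  have hval : ∀ z y, v₁ (z, y) = if Function.update z 0 (1 - z 0) = 0 then u y else 0 := by
    intro z y
    rw [hv₁, run_pauliX]
  have hclean : ∀ z y, (∃ i, (0 : Fin (d + 2)) < i ∧ z i ≠ 0) → v₁ (z, y) = 0 := by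
    rintro z y ⟨i, hi, hzi⟩
    rw [hval, if_neg]
    intro h
    have := congrFun h i
    rw [Function.update_of_ne hi.ne'] at this
    exact hzi this
  rw [show (⟨0, by omega⟩ : Fin (d + 2)) = 0 from rfl] at hC
  rw [hC 𝒰 U₀ U _ ?_ _ _ ?_]
  · simp only [Pi.zero_apply, sub_zero, Function.update_self, if_true]
    rw [← mulVec_mulVec]
    congr 2
    funext y
    congr 2
    funext y
    simp [hval]
  · intro z y hz
    simp only
    split_ifs
    · simp [hclean z _ hz, mulVec, dotProduct]
    · exact hclean z y hz
  · intro i hi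
    rw [Function.update_of_ne hi.ne']
    rfl

end Lcu

/-! ### A trigonometric approximation of the one-sided exponential -/

section Kernel

/-- A nonnegative trigonometric polynomial with period `2 ρ`, close to a Gaussian. -/
def kern (ρ : ℕ) (y : ℝ) : ℝ := ((1 + Real.cos (Real.pi / ρ * y)) / 2) ^ (ρ ^ 2)

lemma continuous_kern (ρ : ℕ) : Continuous (kern ρ) := by
  unfold kern; fun_prop

lemma kern_nonneg (ρ : ℕ) (y : ℝ) : 0 ≤ kern ρ y := by
  have := Real.neg_one_le_cos (Real.pi / ρ * y)
  exact pow_nonneg (by linarith) _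

lemma kern_le_one (ρ : ℕ) (y : ℝ) : kern ρ y ≤ 1 := by
  have := Real.neg_one_le_cos (Real.pi / ρ * y)
  have := Real.cos_le_one (Real.pi / ρ * y)
  exact pow_le_one₀ (by linarith) (by linarith)

/-- Within half a period cos u ≤ 1 - 2u²/π², so the base of the power is at most 1 - y²/ρ² ≤
e^{-y²/ρ²}; the exponent ρ² cancels the denominator. -/
lemma kern_le_exp {ρ : ℕ} (hρ : 0 < ρ) {y : ℝ} (hy : |y| ≤ ρ) :
    kern ρ y ≤ Real.exp (-y ^ 2) := by
  have hρ' : (0 : ℝ) < ρ := by exact_mod_cast hρ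
  have hpi := Real.pi_pos
  have h1 : |Real.pi / ρ * y| ≤ Real.pi := by
    rw [abs_mul, abs_of_pos (by positivity), div_mul_eq_mul_div, div_le_iff₀ hρ']
    gcongr
  have h2 := Real.cos_le_one_sub_mul_cos_sq h1
  have h3 : 2 / Real.pi ^ 2 * (Real.pi / ρ * y) ^ 2 = 2 * (y ^ 2 / ρ ^ 2) := by
    field_simp
  rw [h3] at h2
  have h4 := Real.neg_one_le_cos (Real.pi / ρ * y)
  have h5 : (1 + Real.cos (Real.pi / ρ * y)) / 2 ≤ Real.exp (-(y ^ 2 / ρ ^ 2)) := by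
    have := Real.add_one_le_exp (-(y ^ 2 / ρ ^ 2 : ℝ))
    linarith
  refine (pow_le_pow_left₀ (by linarith) h5 _).trans_eq ?_
  rw [← Real.exp_nat_mul]
  congr 1
  push_cast
  field_simp

/-- Bernoulli's inequality applied to cos u ≥ 1 - u²/2 gives the coefficient π²/4, which is at most
5/2. -/
lemma le_kern {ρ : ℕ} (hρ : 0 < ρ) (y : ℝ) : 1 - 5 / 2 * y ^ 2 ≤ kern ρ y := by
  have hρ' : (0 : ℝ) < ρ := by exact_mod_cast hρ
  have h1 := Real.one_sub_sq_div_two_le_cos (x := Real.pi / ρ * y)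
  have h4 := Real.neg_one_le_cos (Real.pi / ρ * y)
  have h2 := one_add_mul_le_pow
    (show -2 ≤ (1 + Real.cos (Real.pi / ρ * y)) / 2 - 1 by linarith) (ρ ^ 2)
  rw [add_sub_cancel] at h2
  refine le_trans ?_ h2
  have h5 : (ρ : ℝ) ^ 2 * (Real.pi / ρ * y) ^ 2 = Real.pi ^ 2 * y ^ 2 := by field_simp
  have h6 : Real.pi ^ 2 ≤ 10 := by
    have := Real.pi_lt_d2; have := Real.pi_pos; nlinarith
  push_cast
  have h7 : (ρ : ℝ) ^ 2 * (-((Real.pi / ρ * y) ^ 2 / 4)) ≤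
      (ρ : ℝ) ^ 2 * ((1 + Real.cos (Real.pi / ρ * y)) / 2 - 1) := by
    gcongr; linarith
  nlinarith [sq_nonneg y]

/-- The periodic one-sided exponential, smoothened with the kernel. -/
def smooth (ρ : ℕ) (z : ℝ) : ℝ := ∫ t in (0 : ℝ)..(2 * ρ), Real.exp (-t) * kern ρ (z - t)

/-- The weight of the exponential in its smoothened version. -/
def mass (ρ : ℕ) : ℝ := ∫ y in (-ρ : ℝ)..ρ, Real.exp y * kern ρ y

lemma intervalIntegrable_exp_mul_kern (ρ : ℕ) (a b : ℝ) :
    IntervalIntegrable (fun y => Real.exp y * kern ρ y) MeasureTheory.volume a b :=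
  (Real.continuous_exp.mul (continuous_kern ρ)).intervalIntegrable a b

lemma exp_mul_kern_nonneg (ρ : ℕ) (y : ℝ) : 0 ≤ Real.exp y * kern ρ y :=
  mul_nonneg (Real.exp_pos y).le (kern_nonneg ρ y)

/-- Only the window |y| ≤ 1/2 is used. There the integrand is at least (1 + y)(1 - 5y²/2), whose
integral is 19/24. -/
lemma half_le_mass {ρ : ℕ} (hρ : 0 < ρ) : 1 / 2 ≤ mass ρ := by
  have hρ' : (1 : ℝ) ≤ ρ := by exact_mod_cast hρ
  have h1 : ∫ y in (-(1 / 2) : ℝ)..(1 / 2), (1 + y - 5 / 2 * y ^ 2 - 5 / 2 * y ^ 3) ≤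
      ∫ y in (-(1 / 2) : ℝ)..(1 / 2), Real.exp y * kern ρ y := by
    refine intervalIntegral.integral_mono_on (by norm_num)
      (Continuous.intervalIntegrable (by fun_prop) _ _) (intervalIntegrable_exp_mul_kern ρ _ _) ?_
    intro y hy
    have hexp := Real.add_one_le_exp y
    have hk := le_kern hρ y
    obtain ⟨hy1, hy2⟩ := hy
    have : 0 ≤ 1 - 5 / 2 * y ^ 2 := by nlinarith
    nlinarith [Real.exp_pos y]
  have h2 : ∫ y in (-(1 / 2) : ℝ)..(1 / 2), Real.exp y * kern ρ y ≤ mass ρ := by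
    refine intervalIntegral.integral_mono_interval (by linarith) (by norm_num) (by linarith)
      (Filter.Eventually.of_forall fun y => exp_mul_kern_nonneg ρ y)
      (intervalIntegrable_exp_mul_kern ρ _ _)
  refine le_trans ?_ (h1.trans h2)
  rw [intervalIntegral.integral_sub, intervalIntegral.integral_sub, intervalIntegral.integral_add]
  · simp only [intervalIntegral.integral_const_mul, integral_pow, integral_id,
      intervalIntegral.integral_const]
    norm_num
  all_goals exact Continuous.intervalIntegrable (by fun_prop) _ _

lemma smooth_nonneg (ρ : ℕ) (z : ℝ) : 0 ≤ smooth ρ z :=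
  intervalIntegral.integral_nonneg (by positivity) fun _ _ =>
    mul_nonneg (Real.exp_pos _).le (kern_nonneg _ _)

lemma integral_exp_neg_le (a b : ℝ) : ∫ t in a..b, Real.exp (-t) ≤ Real.exp (-a) := by
  rw [intervalIntegral.integral_comp_neg fun x => Real.exp x, integral_exp]
  linarith [Real.exp_pos (-b)]

lemma smooth_le_one (ρ : ℕ) (z : ℝ) : smooth ρ z ≤ 1 := by
  have h : smooth ρ z ≤ ∫ t in (0 : ℝ)..(2 * ρ), Real.exp (-t) := by
    have := continuous_kern ρ
    refine intervalIntegral.integral_mono_on (by positivity)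
      (Continuous.intervalIntegrable (by fun_prop) _ _)
      (Continuous.intervalIntegrable (by fun_prop) _ _) fun t _ => ?_
    exact mul_le_of_le_one_right (Real.exp_pos _).le (kern_le_one _ _)
  exact h.trans ((integral_exp_neg_le _ _).trans (by simp))

lemma smooth_eq (ρ : ℕ) (z : ℝ) :
    smooth ρ z = Real.exp (-z) * ∫ y in (z - 2 * ρ)..z, Real.exp y * kern ρ y := by
  have h := intervalIntegral.integral_comp_sub_left (a := 0) (b := 2 * (ρ : ℝ))
    (fun y => Real.exp (-z) * (Real.exp y * kern ρ y)) z
  rw [sub_zero, intervalIntegral.integral_const_mul, intervalIntegral.integral_const_mul] at h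
  rw [← h, smooth, ← intervalIntegral.integral_const_mul]
  refine intervalIntegral.integral_congr fun t _ => ?_
  rw [← mul_assoc, ← Real.exp_add]
  congr 2
  ring

/-- The exact multiple of e^{-z} is separated from its two errors: the left integral is due to the
neighbouring period, the right one to the jump of the one-sided exponential at 0, which the kernel
smears out. -/
lemma smooth_split {ρ : ℕ} (z : ℝ) :
    smooth ρ z = Real.exp (-z) * ((∫ y in (z - 2 * ρ)..(-ρ : ℝ), Real.exp y * kern ρ y) +
      mass ρ - ∫ y in z..ρ, Real.exp y * kern ρ y) := by
  have hI := intervalIntegrable_exp_mul_kern ρ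
  rw [smooth_eq, mass,
    intervalIntegral.integral_add_adjacent_intervals (hI _ _) (hI _ _),
    ← intervalIntegral.integral_add_adjacent_intervals (hI (z - 2 * ρ) z) (hI z ρ),
    add_sub_cancel_right]

lemma left_tail_le {ρ : ℕ} {z : ℝ} (hz : z ≤ ρ) :
    ∫ y in (z - 2 * ρ)..(-ρ : ℝ), Real.exp y * kern ρ y ≤ Real.exp (-ρ) := by
  have h : ∫ y in (z - 2 * ρ)..(-ρ : ℝ), Real.exp y * kern ρ y ≤
      ∫ y in (z - 2 * ρ)..(-ρ : ℝ), Real.exp y :=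
    intervalIntegral.integral_mono_on (by linarith) (intervalIntegrable_exp_mul_kern ρ _ _)
      (Real.continuous_exp.intervalIntegrable _ _) fun y _ =>
        mul_le_of_le_one_right (Real.exp_pos _).le (kern_le_one _ _)
  rw [integral_exp] at h
  linarith [Real.exp_pos (z - 2 * ρ)]

lemma right_tail_le {ρ : ℕ} (hρ : 0 < ρ) {z : ℝ} (h1 : 1 ≤ z) (hz : z ≤ ρ) :
    ∫ y in z..ρ, Real.exp y * kern ρ y ≤ Real.exp (z - z ^ 2) := by
  have h : ∫ y in z..ρ, Real.exp y * kern ρ y ≤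
      ∫ y in z..ρ, Real.exp (2 * z - z ^ 2) * Real.exp (-y) := by
    refine intervalIntegral.integral_mono_on hz (intervalIntegrable_exp_mul_kern ρ _ _)
      (Continuous.intervalIntegrable (by fun_prop) _ _) fun y hy => ?_
    have hk := kern_le_exp hρ (y := y) (by rw [abs_of_nonneg (by linarith [hy.1])]; exact hy.2)
    refine (mul_le_mul_of_nonneg_left hk (Real.exp_pos y).le).trans ?_
    -- The exponents compare because 2y - y² decreases for y ≥ 1.
    rw [← Real.exp_add, ← Real.exp_add, Real.exp_le_exp]
    nlinarith [hy.1]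
  rw [intervalIntegral.integral_const_mul] at h
  refine h.trans ((mul_le_mul_of_nonneg_left (integral_exp_neg_le _ _)
    (Real.exp_pos _).le).trans_eq ?_)
  rw [← Real.exp_add]
  congr 1
  ring

lemma abs_smooth_sub_le {ρ : ℕ} (hρ : 0 < ρ) {z : ℝ} (h1 : 1 ≤ z) (hz : z ≤ ρ) :
    |smooth ρ z - mass ρ * Real.exp (-z)| ≤
      Real.exp (-z) * (Real.exp (-ρ) + Real.exp (z - z ^ 2)) := by
  have hl := left_tail_le hz
  have hr := right_tail_le hρ h1 hz
  have hl0 : 0 ≤ ∫ y in (z - 2 * ρ)..(-ρ : ℝ), Real.exp y * kern ρ y :=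
    intervalIntegral.integral_nonneg (by linarith) fun _ _ => exp_mul_kern_nonneg _ _
  have hr0 : 0 ≤ ∫ y in z..ρ, Real.exp y * kern ρ y :=
    intervalIntegral.integral_nonneg hz fun _ _ => exp_mul_kern_nonneg _ _
  rw [smooth_split, mul_comm (mass ρ), ← mul_sub, abs_mul, abs_of_pos (Real.exp_pos _)]
  refine mul_le_mul_of_nonneg_left ?_ (Real.exp_pos _).le
  rw [abs_le]
  constructor <;> linarith [Real.exp_pos (-ρ : ℝ), Real.exp_pos (z - z ^ 2)]

/-- Near and left of the jump no precision is available, but the function stays between 0 and twice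
the exponential: for z ≤ 0 because it is at most one, for z ≥ 0 because the left tail is below the
mass. -/
lemma abs_smooth_sub_le_mass {ρ : ℕ} (hρ : 0 < ρ) {z : ℝ} (hz : z ≤ ρ) :
    |smooth ρ z - mass ρ * Real.exp (-z)| ≤ mass ρ * Real.exp (-z) := by
  have hM := half_le_mass hρ
  have hρ' : (1 : ℝ) ≤ ρ := by exact_mod_cast hρ
  have h0 := smooth_nonneg ρ z
  suffices smooth ρ z ≤ 2 * mass ρ * Real.exp (-z) by
    rw [abs_le]; constructor <;> nlinarith
  rcases le_total z 0 with h | h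
  · have h1 : 1 ≤ Real.exp (-z) := Real.one_le_exp (by linarith)
    nlinarith [smooth_le_one ρ z]
  · have hl := left_tail_le hz
    have hr0 : 0 ≤ ∫ y in z..ρ, Real.exp y * kern ρ y :=
      intervalIntegral.integral_nonneg hz fun _ _ => exp_mul_kern_nonneg _ _
    have he : Real.exp (-ρ) ≤ 1 / 2 := by
      rw [Real.exp_neg, inv_le_comm₀ (Real.exp_pos _) (by norm_num)]
      have := Real.add_one_le_exp (ρ : ℝ)
      norm_num
      linarith
    rw [smooth_split, mul_comm (2 * mass ρ)]
    exact mul_le_mul_of_nonneg_left (by linarith) (Real.exp_pos _).le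

end Kernel

/-! ### Fourier coefficients of the kernel, their truncation, and the resulting filter. -/

section Fourier

/-- The Fourier coefficients of the kernel. -/
def kernCoeff (N i : ℕ) : ℝ := (2 * N).choose i / 4 ^ N

lemma kernCoeff_nonneg (N i : ℕ) : 0 ≤ kernCoeff N i := by
  unfold kernCoeff; positivity

/-- The right-hand side is ((e^{w/2} + e^{-w/2}) / 2)^{2N}, expanded by the binomial theorem.
Complex `w` serves two purposes: imaginary values give the Fourier series of the kernel, real ones
the moment generating function for the Chernoff bound. -/
lemma sum_kernCoeff_mul_exp (N : ℕ) (w : ℂ) :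
    ∑ i ∈ Finset.range (2 * N + 1), (kernCoeff N i : ℂ) * Complex.exp (((i : ℂ) - N) * w) =
      ((1 + Complex.cosh w) / 2) ^ N := by
  have h1 : (1 + Complex.cosh w) / 2 = Complex.exp (-w) * (1 + Complex.exp w) ^ 2 / 4 := by
    have : Complex.exp (-w) * Complex.exp w = 1 := by rw [← Complex.exp_add]; simp
    rw [Complex.cosh]
    linear_combination (-1 / 2 - Complex.exp w / 4) * this
  rw [h1, div_pow, mul_pow, ← pow_mul, add_comm (1 : ℂ), add_pow, Finset.mul_sum, Finset.sum_div]
  refine Finset.sum_congr rfl fun i _ => ?_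
  rw [one_pow, mul_one, ← Complex.exp_nat_mul, ← Complex.exp_nat_mul, kernCoeff, ← mul_assoc,
    ← Complex.exp_add]
  push_cast
  rw [show (i - N : ℂ) * w = N * -w + i * w by ring]
  ring

lemma sum_kernCoeff_mul_exp_real (N : ℕ) (l : ℝ) :
    ∑ i ∈ Finset.range (2 * N + 1), kernCoeff N i * Real.exp (((i : ℝ) - N) * l) =
      ((1 + Real.cosh l) / 2) ^ N := by
  have := sum_kernCoeff_mul_exp N l
  exact_mod_cast this

lemma sum_kernCoeff (N : ℕ) : ∑ i ∈ Finset.range (2 * N + 1), kernCoeff N i = 1 := by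
  have := sum_kernCoeff_mul_exp_real N 0
  simpa using this

lemma one_add_cosh_div_two_le (l : ℝ) : (1 + Real.cosh l) / 2 ≤ Real.exp (l ^ 2 / 4) := by
  have h1 := Real.cosh_le_exp_half_sq (l / 2)
  have h2 : (1 + Real.cosh l) / 2 = Real.cosh (l / 2) ^ 2 := by
    have := Real.cosh_sq (l / 2)
    have h3 := Real.cosh_two_mul (l / 2)
    rw [mul_div_cancel₀ _ two_ne_zero] at h3
    linarith
  rw [h2]
  refine (pow_le_pow_left₀ (Real.cosh_pos _).le h1 2).trans_eq ?_
  rw [← Real.exp_nat_mul]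
  congr 1
  push_cast
  ring

/-- The weight of the Fourier coefficients of the kernel beyond frequency `k ρ` is tiny. -/
lemma kernCoeff_tail {ρ : ℕ} (hρ : 0 < ρ) (k : ℕ) :
    ∑ i ∈ (Finset.range (2 * ρ ^ 2 + 1)).filter
      (fun i => ¬ (ρ ^ 2 - k * ρ ≤ i ∧ i ≤ ρ ^ 2 + k * ρ)), kernCoeff (ρ ^ 2) i ≤
      2 * Real.exp (-k ^ 2) := by
  have hρ' : (0 : ℝ) < ρ := by exact_mod_cast hρ
  set N := ρ ^ 2 with hN
  -- This is the optimal Chernoff parameter: it minimizes -kρ l + ρ² l²/4, and the minimum is -k².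
  set l : ℝ := 2 * k / ρ with hl
  have hl0 : 0 ≤ l := by positivity
  have key : ∀ l' : ℝ, l' ^ 2 = l ^ 2 →
      ∑ i ∈ Finset.range (2 * N + 1), kernCoeff N i *
        (Real.exp (-(k * ρ * l)) * Real.exp (((i : ℝ) - N) * l')) ≤ Real.exp (-k ^ 2) := by
    intro l' hl'
    simp only [mul_left_comm (kernCoeff N _)]
    rw [← Finset.mul_sum, sum_kernCoeff_mul_exp_real]
    have h1 : ((1 + Real.cosh l') / 2) ^ N ≤ Real.exp (N * (l ^ 2 / 4)) := by
      rw [Real.exp_nat_mul, ← hl']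
      exact pow_le_pow_left₀ (by linarith [Real.cosh_pos l']) (one_add_cosh_div_two_le l') _
    refine (mul_le_mul_of_nonneg_left h1 (Real.exp_pos _).le).trans_eq ?_
    rw [← Real.exp_add]
    congr 1
    rw [hl, hN]
    push_cast
    field_simp
    ring
  -- The parameters l and -l control the upper and the lower tail; outside the window one of the two
  -- weights is at least one.
  have h2 := add_le_add (key l rfl) (key (-l) (by ring))
  rw [← two_mul, ← Finset.sum_add_distrib] at h2
  refine le_trans ?_ h2
  refine (Finset.sum_le_sum fun i hi => ?_).trans (Finset.sum_le_sum_of_subset_of_nonneg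
    (Finset.filter_subset _ _) fun i _ _ => ?_)
  · rw [Finset.mem_filter] at hi
    have hB := kernCoeff_nonneg N i
    rw [← mul_add, ← mul_add]
    refine le_mul_of_one_le_right hB ?_
    rw [mul_add, ← Real.exp_add, ← Real.exp_add]
    by_cases h : i ≤ N + k * ρ
    · have h3 : (i : ℝ) + k * ρ ≤ N := by
        have : i + k * ρ ≤ N := by
          by_contra hcon
          exact hi.2 ⟨by omega, h⟩
        exact_mod_cast this
      have : 1 ≤ Real.exp (-(k * ρ * l) + (i - N) * -l) := Real.one_le_exp (by nlinarith)
      linarith [Real.exp_pos (-(k * ρ * l) + (i - N) * l)]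
    · have h3 : (N : ℝ) + k * ρ ≤ i := by
        have : N + k * ρ ≤ i := by omega
        exact_mod_cast this
      have : 1 ≤ Real.exp (-(k * ρ * l) + (i - N) * l) := Real.one_le_exp (by nlinarith)
      linarith [Real.exp_pos (-(k * ρ * l) + (i - N) * -l)]
  · have hB := kernCoeff_nonneg N i
    positivity

/-- The Fourier coefficients of the periodic one-sided exponential. -/
def expCoeff (ρ : ℕ) (i : ℕ) : ℂ :=
  ∫ t in (0 : ℝ)..(2 * ρ), (Real.exp (-t) : ℂ) *
    Complex.exp (((i : ℂ) - (ρ ^ 2 : ℕ)) * (Complex.I * (Real.pi / ρ * -t : ℝ)))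

lemma norm_exp_mul_I_mul (k : ℤ) (x : ℝ) :
    ‖Complex.exp ((k : ℂ) * (Complex.I * x))‖ = 1 := by
  rw [show (k : ℂ) * (Complex.I * x) = ((k * x : ℝ) : ℂ) * Complex.I by push_cast; ring,
    Complex.norm_exp_ofReal_mul_I]

lemma norm_expCoeff_le (ρ i : ℕ) : ‖expCoeff ρ i‖ ≤ 1 := by
  refine (intervalIntegral.norm_integral_le_of_norm_le (g := fun t => Real.exp (-t))
    (by positivity) ?_ (Continuous.intervalIntegrable (by fun_prop) _ _)).trans
    ((integral_exp_neg_le _ _).trans (by simp))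
  refine Filter.Eventually.of_forall fun t _ => ?_
  have := norm_exp_mul_I_mul ((i : ℤ) - (ρ ^ 2 : ℕ)) (Real.pi / ρ * -t)
  push_cast at this ⊢
  rw [norm_mul, this, mul_one, ← Complex.ofReal_neg, ← Complex.ofReal_exp, Complex.norm_real,
    Real.norm_of_nonneg (Real.exp_pos _).le]

/-- Convolution multiplies Fourier coefficients. The integral runs over one period of the kernel,
but only the finitely many frequencies of the kernel occur. -/
lemma smooth_eq_sum (ρ : ℕ) (z : ℝ) :
    (smooth ρ z : ℂ) = ∑ i ∈ Finset.range (2 * ρ ^ 2 + 1), kernCoeff (ρ ^ 2) i * expCoeff ρ i *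
      Complex.exp (((i : ℂ) - (ρ ^ 2 : ℕ)) * (Complex.I * (Real.pi / ρ * z : ℝ))) := by
  have h1 : (smooth ρ z : ℂ) = ∫ t in (0 : ℝ)..(2 * ρ),
      ∑ i ∈ Finset.range (2 * ρ ^ 2 + 1), (kernCoeff (ρ ^ 2) i *
        Complex.exp (((i : ℂ) - (ρ ^ 2 : ℕ)) * (Complex.I * (Real.pi / ρ * z : ℝ)))) *
      ((Real.exp (-t) : ℂ) *
        Complex.exp (((i : ℂ) - (ρ ^ 2 : ℕ)) * (Complex.I * (Real.pi / ρ * -t : ℝ)))) := by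
    rw [smooth, ← intervalIntegral.integral_ofReal]
    refine intervalIntegral.integral_congr fun t _ => ?_
    have h2 := sum_kernCoeff_mul_exp (ρ ^ 2) (Complex.I * (Real.pi / ρ * (z - t) : ℝ))
    have h3 : (kern ρ (z - t) : ℂ) =
        ((1 + Complex.cosh (Complex.I * (Real.pi / ρ * (z - t) : ℝ))) / 2) ^ (ρ ^ 2) := by
      rw [mul_comm, Complex.cosh_mul_I, kern]
      push_cast
      rfl
    rw [Complex.ofReal_mul, h3, ← h2, Finset.mul_sum]
    refine Finset.sum_congr rfl fun i _ => ?_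
    rw [show ((i : ℂ) - (ρ ^ 2 : ℕ)) * (Complex.I * (Real.pi / ρ * (z - t) : ℝ)) =
      ((i : ℂ) - (ρ ^ 2 : ℕ)) * (Complex.I * (Real.pi / ρ * z : ℝ)) +
      ((i : ℂ) - (ρ ^ 2 : ℕ)) * (Complex.I * (Real.pi / ρ * -t : ℝ)) by push_cast; ring,
      Complex.exp_add]
    ring
  rw [h1, intervalIntegral.integral_finsetSum]
  · refine Finset.sum_congr rfl fun i _ => ?_
    rw [intervalIntegral.integral_const_mul, ← expCoeff]
    ring
  · intro i _
    exact Continuous.intervalIntegrable (by fun_prop) _ _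

/-- A trigonometric polynomial of degree `k ρ` close to `smooth ρ`. -/
lemma exists_trig_approx {ρ k : ℕ} (hρ : 0 < ρ) (hk : k ≤ ρ) :
    ∃ c : ℕ → ℂ, ∑ j ∈ Finset.range (2 * (k * ρ) + 1), ‖c j‖ ≤ 1 ∧
      ∀ z : ℝ, ‖∑ j ∈ Finset.range (2 * (k * ρ) + 1), c j *
        Complex.exp (((j : ℂ) - (k * ρ : ℕ)) * (Complex.I * (Real.pi / ρ * z : ℝ))) -
          smooth ρ z‖ ≤ 2 * Real.exp (-k ^ 2) := by
  set N := ρ ^ 2 with hN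
  set m := k * ρ with hm
  -- This makes the natural subtraction N - m genuine, so that re-indexing the window of frequencies
  -- around N is a bijection.
  have hmN : m ≤ N := by rw [hN, hm, sq]; exact Nat.mul_le_mul_right _ hk
  set g : ℕ → ℂ := fun i => kernCoeff N i * expCoeff ρ i with hg
  have hgn : ∀ i, ‖g i‖ ≤ kernCoeff N i := by
    intro i
    rw [hg, norm_mul, Complex.norm_real, Real.norm_of_nonneg (kernCoeff_nonneg N i)]
    exact mul_le_of_le_one_right (kernCoeff_nonneg N i) (norm_expCoeff_le ρ i)
  have hre : ∀ {E : Type} [AddCommMonoid E] (f : ℕ → E),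
      ∑ j ∈ Finset.range (2 * m + 1), f (N - m + j) =
        ∑ i ∈ (Finset.range (2 * N + 1)).filter (fun i => N - m ≤ i ∧ i ≤ N + m), f i := by
    intro E _ f
    refine Finset.sum_bij' (fun j _ => N - m + j) (fun i _ => i - (N - m)) ?_ ?_ ?_ ?_ ?_
    · intro j hj
      simp only [Finset.mem_range, Finset.mem_filter] at hj ⊢
      omega
    · intro i hi
      simp only [Finset.mem_range, Finset.mem_filter] at hi ⊢
      omega
    · intro j _; simp
    · intro i hi
      simp only [Finset.mem_range, Finset.mem_filter] at hi
      omega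
    · intro j _; rfl
  refine ⟨fun j => g (N - m + j), ?_, fun z => ?_⟩
  · rw [hre fun i => ‖g i‖, ← sum_kernCoeff N]
    refine (Finset.sum_le_sum fun i _ => hgn i).trans (Finset.sum_le_sum_of_subset_of_nonneg
      (Finset.filter_subset _ _) fun i _ _ => kernCoeff_nonneg N i)
  · set f : ℕ → ℂ := fun i => g i *
      Complex.exp (((i : ℂ) - (N : ℕ)) * (Complex.I * (Real.pi / ρ * z : ℝ))) with hf
    have h1 : ∀ j, g (N - m + j) *
        Complex.exp (((j : ℂ) - (m : ℕ)) * (Complex.I * (Real.pi / ρ * z : ℝ))) =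
        f (N - m + j) := by
      intro j
      simp only [hf]
      congr 3
      push_cast [Nat.cast_sub hmN]
      ring
    rw [Finset.sum_congr rfl fun j _ => h1 j, hre f, smooth_eq_sum,
      ← Finset.sum_filter_add_sum_filter_not (Finset.range (2 * ρ ^ 2 + 1))
        (fun i => N - m ≤ i ∧ i ≤ N + m), ← sub_sub, sub_self, zero_sub, norm_neg]
    refine (norm_sum_le _ _).trans ((Finset.sum_le_sum fun i _ => ?_).trans (kernCoeff_tail hρ k))
    have := norm_exp_mul_I_mul ((i : ℤ) - (ρ ^ 2 : ℕ)) (Real.pi / ρ * z)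
    push_cast at this ⊢
    rw [norm_mul, this, mul_one]
    exact hgn i

/-- A trigonometric polynomial which is a multiple of `e^{-x}` up to a small relative error for
`0 ≤ x ≤ X`, and up to a bounded relative error for `x ≤ 0`. -/
lemma exists_exp_approx {l X : ℝ} (hl : 0 ≤ l) (hX : 0 ≤ X) {ρ k : ℕ} (hkρ : k ≤ ρ)
    (hρk : ρ ≤ k ^ 2) (hρ : X + 2 * l + 9 ≤ ρ) :
    ∃ (c : ℕ → ℂ) (r : ℝ), ∑ j ∈ Finset.range (2 * (k * ρ) + 1), ‖c j‖ ≤ 1 ∧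
      Real.exp (-(Real.sqrt l + 3)) / 2 ≤ r ∧
      (∀ x : ℝ, 0 ≤ x → x ≤ X → ‖∑ j ∈ Finset.range (2 * (k * ρ) + 1), c j *
        Complex.exp (((j : ℂ) - (k * ρ : ℕ)) * (Complex.I * (Real.pi / ρ * x : ℝ))) -
          (r * Real.exp (-x) : ℝ)‖ ≤ Real.exp (-l) / 6 * (r * Real.exp (-x))) ∧
      ∀ x : ℝ, x ≤ 0 → ‖∑ j ∈ Finset.range (2 * (k * ρ) + 1), c j *
        Complex.exp (((j : ℂ) - (k * ρ : ℕ)) * (Complex.I * (Real.pi / ρ * x : ℝ))) -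
          (r * Real.exp (-x) : ℝ)‖ ≤ 7 / 6 * (r * Real.exp (-x)) := by
  have hρ0 : 0 < ρ := by
    have : (0 : ℝ) < ρ := by linarith
    exact_mod_cast this
  obtain ⟨c, hc, hcz⟩ := exists_trig_approx hρ0 hkρ
  -- The filter is evaluated at x + s. For z ≥ s one has z² - z ≥ l + 5, so the smeared jump
  -- contributes a relative error of at most e^{-5-l}. The shift itself only changes the phases of
  -- the coefficients and puts e^{-s} into the prefactor `r`.
  set s := Real.sqrt l + 3 with hs
  have hsq : Real.sqrt l ^ 2 = l := Real.sq_sqrt hl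
  have hs0 := Real.sqrt_nonneg l
  have hsl : s ≤ l + 4 := by nlinarith [sq_nonneg (Real.sqrt l - 1 / 2)]
  have hM := half_le_mass hρ0
  have he5 : Real.exp (-5) ≤ 1 / 100 := by
    have h1 := Real.exp_one_gt_d9
    have h2 : Real.exp 5 = Real.exp 1 ^ 5 := by rw [← Real.exp_nat_mul]; norm_num
    rw [Real.exp_neg, inv_le_comm₀ (Real.exp_pos _) (by norm_num), h2]
    have : (2.7 : ℝ) ^ 5 ≤ Real.exp 1 ^ 5 := pow_le_pow_left₀ (by norm_num) (by linarith) 5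
    norm_num at this ⊢
    linarith
  have hkk : Real.exp (-(k : ℝ) ^ 2) ≤ Real.exp (-ρ) := by
    rw [Real.exp_le_exp, neg_le_neg_iff]; exact_mod_cast hρk
  have hval : ∀ x : ℝ, ∑ j ∈ Finset.range (2 * (k * ρ) + 1),
      c j * Complex.exp (((j : ℂ) - (k * ρ : ℕ)) * (Complex.I * (Real.pi / ρ * s : ℝ))) *
        Complex.exp (((j : ℂ) - (k * ρ : ℕ)) * (Complex.I * (Real.pi / ρ * x : ℝ))) =
      ∑ j ∈ Finset.range (2 * (k * ρ) + 1), c j *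
        Complex.exp (((j : ℂ) - (k * ρ : ℕ)) * (Complex.I * (Real.pi / ρ * (x + s) : ℝ))) := by
    intro x
    refine Finset.sum_congr rfl fun j _ => ?_
    rw [mul_assoc, ← Complex.exp_add]
    congr 2
    push_cast
    ring
  have hexp : ∀ x, Real.exp (-s) * mass ρ * Real.exp (-x) = mass ρ * Real.exp (-(x + s)) := by
    intro x
    rw [neg_add x s, Real.exp_add]; ring
  have herr : ∀ x b : ℝ, |smooth ρ (x + s) - mass ρ * Real.exp (-(x + s))| + 2 * Real.exp (-ρ) ≤ b →
      ‖∑ j ∈ Finset.range (2 * (k * ρ) + 1), c j *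
        Complex.exp (((j : ℂ) - (k * ρ : ℕ)) * (Complex.I * (Real.pi / ρ * (x + s) : ℝ))) -
          (mass ρ * Real.exp (-(x + s)) : ℝ)‖ ≤ b := by
    intro x b hb
    refine le_trans ?_ hb
    rw [← sub_add_sub_cancel _ (smooth ρ (x + s) : ℂ), ← Complex.ofReal_sub]
    refine (norm_add_le _ _).trans ?_
    rw [Complex.norm_real, Real.norm_eq_abs, add_comm]
    gcongr
    exact (hcz _).trans (by gcongr)
  refine ⟨fun j => c j *
    Complex.exp (((j : ℂ) - (k * ρ : ℕ)) * (Complex.I * (Real.pi / ρ * s : ℝ))),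
    Real.exp (-s) * mass ρ, ?_, ?_, fun x hx0 hxX => ?_, fun x hx0 => ?_⟩
  · refine (Finset.sum_congr rfl fun j _ => ?_).trans_le hc
    have := norm_exp_mul_I_mul ((j : ℤ) - (k * ρ : ℕ)) (Real.pi / ρ * s)
    push_cast at this ⊢
    rw [norm_mul, this, mul_one]
  · nlinarith [Real.exp_pos (-s)]
  · rw [hval, hexp]
    apply herr
    have h1 := abs_smooth_sub_le hρ0 (z := x + s) (by linarith) (by linarith)
    -- The lower bound on ρ pays for the left tail and for the truncation error: since s ≤ l + 4, it
    -- yields ρ ≥ 5 + l + (x + s), so even the absolute error e^{-ρ} is small relative to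
    -- e^{-(x+s)}.
    have h2 : Real.exp (-ρ) ≤ Real.exp (-5) * Real.exp (-l) := by
      rw [← Real.exp_add, Real.exp_le_exp]; linarith
    have h3 : Real.exp (x + s - (x + s) ^ 2) ≤ Real.exp (-5) * Real.exp (-l) := by
      rw [← Real.exp_add, Real.exp_le_exp]; nlinarith
    have h4 : Real.exp (-ρ) ≤ Real.exp (-5) * Real.exp (-l) * Real.exp (-(x + s)) := by
      rw [← Real.exp_add, ← Real.exp_add, Real.exp_le_exp]; linarith
    have h5 := Real.exp_pos (-(x + s))
    have h6 := Real.exp_pos (-l)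
    have h7 : Real.exp (-5) * Real.exp (-l) ≤ 1 / 100 * Real.exp (-l) := by gcongr
    calc _ ≤ Real.exp (-(x + s)) * (1 / 100 * Real.exp (-l) + 1 / 100 * Real.exp (-l)) +
          2 * (1 / 100 * Real.exp (-l) * Real.exp (-(x + s))) := by
            refine add_le_add (h1.trans ?_) ?_
            · gcongr <;> linarith
            · gcongr; exact h4.trans (by gcongr)
      _ ≤ Real.exp (-l) / 6 * (1 / 2 * Real.exp (-(x + s))) := by nlinarith [mul_pos h5 h6]
      _ ≤ _ := by gcongr
  · rw [hval, hexp]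
    apply herr
    have h1 := abs_smooth_sub_le_mass hρ0 (z := x + s) (by linarith)
    have h4 : Real.exp (-ρ) ≤ Real.exp (-5) * Real.exp (-(x + s)) := by
      rw [← Real.exp_add, Real.exp_le_exp]; linarith
    have h5 := Real.exp_pos (-(x + s))
    nlinarith [mul_le_mul_of_nonneg_right he5 h5.le, mul_le_mul_of_nonneg_right hM h5.le]

end Fourier

/-! ### The trace norm of a difference of reduced states -/

section TraceNorm

/-- The Frobenius norm. -/
def frob {m l : Type*} [Fintype m] [Fintype l] (A : Matrix m l ℂ) : ℝ :=
  Real.sqrt (∑ i, ∑ j, ‖A i j‖ ^ 2)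

lemma frob_sq {m l : Type*} [Fintype m] [Fintype l] (A : Matrix m l ℂ) :
    frob A ^ 2 = ∑ i, ∑ j, ‖A i j‖ ^ 2 :=
  Real.sq_sqrt (Finset.sum_nonneg fun _ _ => Finset.sum_nonneg fun _ _ => by positivity)

lemma frob_nonneg {m l : Type*} [Fintype m] [Fintype l] (A : Matrix m l ℂ) : 0 ≤ frob A :=
  Real.sqrt_nonneg _

/-- Bessel's inequality for an orthogonal family of unit or zero vectors. -/
lemma sum_norm_inner_sq_le {ι E : Type*} [Fintype ι] [NormedAddCommGroup E]
    [InnerProductSpace ℂ E] (y : ι → E) (h1 : ∀ i, y i = 0 ∨ ‖y i‖ = 1)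
    (h2 : ∀ i j, i ≠ j → inner ℂ (y i) (y j) = 0) (x : E) :
    ∑ i, ‖inner ℂ (y i) x‖ ^ 2 ≤ ‖x‖ ^ 2 := by
  classical
  have ho : Orthonormal ℂ fun i : {i // y i ≠ 0} => y i :=
    ⟨fun i => (h1 i).resolve_left i.2, fun i j hij => h2 _ _ fun h => hij (Subtype.ext h)⟩
  have h3 := ho.sum_inner_products_le x (s := Finset.univ)
  refine le_trans (le_of_eq ?_) h3
  rw [← Finset.sum_subtype (Finset.univ.filter (y · ≠ 0)) (by simp)
    fun i => ‖inner ℂ (y i) x‖ ^ 2, Finset.sum_filter_of_ne]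
  intro i _ h
  contrapose! h
  simp [h]

variable {m l : Type*} [Fintype m]

lemma inner_toLp (u v : m → ℂ) :
    inner ℂ (WithLp.toLp 2 u : EuclideanSpace ℂ m) (WithLp.toLp 2 v) = star u ⬝ᵥ v := by
  rw [EuclideanSpace.inner_toLp_toLp, dotProduct_comm]

lemma sum_norm_mul_norm_le {ι κ : Type*} [Fintype ι] [Fintype κ] (f g : ι → κ → ℂ) {F G : ℝ}
    (hF0 : 0 ≤ F) (hG0 : 0 ≤ G)
    (hF : ∑ i, ∑ j, ‖f i j‖ ^ 2 ≤ F ^ 2) (hG : ∑ i, ∑ j, ‖g i j‖ ^ 2 ≤ G ^ 2) :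
    ∑ i, ∑ j, ‖f i j‖ * ‖g i j‖ ≤ F * G := by
  rw [← Fintype.sum_prod_type'] at hF hG ⊢
  refine (Real.sum_mul_le_sqrt_mul_sqrt _ _ _).trans ?_
  exact mul_le_mul ((Real.sqrt_le_sqrt hF).trans_eq (Real.sqrt_sq hF0))
    ((Real.sqrt_le_sqrt hG).trans_eq (Real.sqrt_sq hG0)) (Real.sqrt_nonneg _) hF0

/-- The difference equals (A - B)Aᴴ + B(A - B)ᴴ. Each singular value is a matrix element of it
between singular vectors; Cauchy–Schwarz and Bessel's inequality then bound their sum by products of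
Frobenius norms. -/
lemma traceNorm_sub_le [DecidableEq m] [Fintype l] (A B : Matrix m l ℂ) :
    traceNorm (A * Aᴴ - B * Bᴴ) ≤ frob (A - B) * (frob A + frob B) := by
  set D := A * Aᴴ - B * Bᴴ with hD
  set hH := isHermitian_conjTranspose_mul_self D
  set x := hH.eigenvectorBasis
  set σ : m → ℝ := fun i => Real.sqrt (hH.eigenvalues i) with hσ
  have heig : ∀ i, 0 ≤ hH.eigenvalues i := fun i =>
    (posSemidef_conjTranspose_mul_self D).eigenvalues_nonneg i
  have hσ2 : ∀ i, σ i ^ 2 = hH.eigenvalues i := fun i => Real.sq_sqrt (heig i)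
  set Dx : m → EuclideanSpace ℂ m := fun i => WithLp.toLp 2 (D *ᵥ (x i).ofLp) with hDx
  have hDD : ∀ i j, inner ℂ (Dx i) (Dx j) = if i = j then ((σ i : ℂ)) ^ 2 else 0 := by
    intro i j
    have h1 := hH.mulVec_eigenvectorBasis j
    have h2 := (orthonormal_iff_ite (𝕜 := ℂ)).mp x.orthonormal i j
    rw [hDx, inner_toLp, star_mulVec, ← dotProduct_mulVec, mulVec_mulVec, h1]
    change star (x i).ofLp ⬝ᵥ (hH.eigenvalues j • (x j).ofLp) = _
    rw [dotProduct_smul, ← inner_toLp]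
    change hH.eigenvalues j • inner ℂ (x i) (x j) = _
    rw [h2]
    split_ifs with h
    · rw [← h, ← hσ2]; simp
    · simp
  -- These are the left singular vectors. For σ = 0 the convention 0⁻¹ = 0 makes them zero vectors,
  -- which Bessel's inequality tolerates.
  set y : m → EuclideanSpace ℂ m := fun i => ((σ i : ℂ))⁻¹ • Dx i with hy
  have hyy : ∀ i j, i ≠ j → inner ℂ (y i) (y j) = 0 := by
    intro i j hij
    rw [hy, inner_smul_left, inner_smul_right, hDD, if_neg hij]
    simp
  have hDn : ∀ i, ‖Dx i‖ = σ i := by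
    intro i
    have := hDD i i
    rw [if_pos rfl, inner_self_eq_norm_sq_to_K] at this
    have h3 : ‖Dx i‖ ^ 2 = σ i ^ 2 := Complex.ofReal_injective (by simpa using this)
    exact (pow_left_inj₀ (norm_nonneg _) (Real.sqrt_nonneg _) two_ne_zero).mp h3
  have hy1 : ∀ i, y i = 0 ∨ ‖y i‖ = 1 := by
    intro i
    by_cases h : σ i = 0
    · left; simp [hy, h]
    · right
      rw [hy, norm_smul, hDn, norm_inv, Complex.norm_real, Real.norm_of_nonneg (Real.sqrt_nonneg _),
        inv_mul_cancel₀ h]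
  have hyD : ∀ i, inner ℂ (y i) (Dx i) = (σ i : ℂ) := by
    intro i
    rw [hy, inner_smul_left, hDD, if_pos rfl]
    simp only [map_inv₀, Complex.conj_ofReal]
    by_cases h : σ i = 0
    · simp [h]
    · have : (σ i : ℂ) ≠ 0 := by exact_mod_cast h
      field_simp
  set col : Matrix m l ℂ → l → EuclideanSpace ℂ m := fun M j => WithLp.toLp 2 fun i => M i j
    with hcol
  have hcolsum : ∀ M : Matrix m l ℂ, ∑ j, ‖col M j‖ ^ 2 = frob M ^ 2 := by
    intro M
    rw [frob_sq, Finset.sum_comm]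
    refine Finset.sum_congr rfl fun j _ => ?_
    rw [EuclideanSpace.norm_sq_eq]
  have hbx : ∀ M : Matrix m l ℂ, ∑ i, ∑ j, ‖inner ℂ (col M j) (x i)‖ ^ 2 ≤ frob M ^ 2 := by
    intro M
    rw [← hcolsum, Finset.sum_comm]
    refine Finset.sum_le_sum fun j _ => ?_
    simp only [norm_inner_symm (col M j)]
    exact x.orthonormal.sum_inner_products_le _
  have hby : ∀ M : Matrix m l ℂ, ∑ i, ∑ j, ‖inner ℂ (y i) (col M j)‖ ^ 2 ≤ frob M ^ 2 := by
    intro M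
    rw [← hcolsum, Finset.sum_comm]
    exact Finset.sum_le_sum fun j _ => sum_norm_inner_sq_le y hy1 hyy _
  have hM : ∀ (M : Matrix m l ℂ) (v : EuclideanSpace ℂ m),
      (WithLp.toLp 2 ((M * Mᴴ) *ᵥ v.ofLp) : EuclideanSpace ℂ m) =
        ∑ j, inner ℂ (col M j) v • col M j := by
    intro M v
    ext i
    have : ∀ j, inner ℂ (col M j) v = (Mᴴ *ᵥ v.ofLp) j := by
      intro j
      rw [show v = WithLp.toLp 2 v.ofLp from rfl, hcol, inner_toLp]
      rfl
    simp only [this]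
    rw [← mulVec_mulVec]
    simp [mulVec, dotProduct, hcol, mul_comm]
  have hterm : ∀ i, σ i ≤ ∑ j, (‖inner ℂ (y i) (col (A - B) j)‖ * ‖inner ℂ (col A j) (x i)‖ +
      ‖inner ℂ (y i) (col B j)‖ * ‖inner ℂ (col (A - B) j) (x i)‖) := by
    intro i
    have h1 : Dx i = ∑ j, (inner ℂ (col A j) (x i) • col (A - B) j +
        inner ℂ (col (A - B) j) (x i) • col B j) := by
      have hsub : ∀ j, col (A - B) j = col A j - col B j := fun j => rfl
      change WithLp.toLp 2 ((A * Aᴴ - B * Bᴴ) *ᵥ (x i).ofLp) = _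
      rw [sub_mulVec, WithLp.toLp_sub, hM, hM, ← Finset.sum_sub_distrib]
      refine Finset.sum_congr rfl fun j _ => ?_
      rw [hsub, inner_sub_left, smul_sub, sub_smul]
      abel
    have h2 := hyD i
    rw [h1, inner_sum] at h2
    have h3 : σ i = ‖(σ i : ℂ)‖ := by
      rw [Complex.norm_real, Real.norm_of_nonneg (Real.sqrt_nonneg _)]
    rw [h3, ← h2]
    refine (norm_sum_le _ _).trans (Finset.sum_le_sum fun j _ => ?_)
    rw [inner_add_right, inner_smul_right, inner_smul_right]
    refine (norm_add_le _ _).trans ?_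
    rw [norm_mul, norm_mul, mul_comm, mul_comm ‖inner ℂ (col (A - B) j) (x i)‖]
  calc traceNorm D = ∑ i, σ i := rfl
    _ ≤ _ := Finset.sum_le_sum fun i _ => hterm i
    _ = _ := by simp only [Finset.sum_add_distrib]
    _ ≤ frob (A - B) * frob A + frob B * frob (A - B) :=
      add_le_add
        (sum_norm_mul_norm_le _ _ (frob_nonneg _) (frob_nonneg _) (hby _) (hbx _))
        (sum_norm_mul_norm_le _ _ (frob_nonneg _) (frob_nonneg _) (hby _) (hbx _))
    _ = _ := by ring

end TraceNorm

/-! ### Spectral decompositions -/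

section Spectral

variable {n : ℕ}

lemma exp_unitary_conj {ι : Type*} [Fintype ι] [DecidableEq ι] {V : Matrix ι ι ℂ}
    (hV : V * Vᴴ = 1) (A : Matrix ι ι ℂ) :
    NormedSpace.exp (V * A * Vᴴ) = V * NormedSpace.exp A * Vᴴ := by
  have h := Matrix.exp_conj V A (IsUnit.of_mul_eq_one _ hV)
  rwa [inv_eq_right_inv hV] at h

lemma exp_smul_unitary_conj {ι : Type*} [Fintype ι] [DecidableEq ι] {V : Matrix ι ι ℂ}
    (hV : V * Vᴴ = 1) (c : ℂ) (d : ι → ℝ) :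
    NormedSpace.exp (c • (V * diagonal (fun i => (d i : ℂ)) * Vᴴ)) =
      V * diagonal (fun i => Complex.exp (c * d i)) * Vᴴ := by
  rw [← smul_mul_assoc, ← mul_smul_comm, exp_unitary_conj hV, ← diagonal_smul, exp_diagonal]
  congr 3
  funext i
  rw [Pi.coe_exp, Complex.exp_eq_exp_ℂ]
  rfl

/-- The matrix of eigenvectors of a Hermitian matrix. -/
def eigvecs {ι : Type*} [Fintype ι] [DecidableEq ι] {H : Matrix ι ι ℂ} (h : H.IsHermitian) :
    Matrix ι ι ℂ := h.eigenvectorUnitary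

section

variable {ι : Type*} [Fintype ι] [DecidableEq ι] {H : Matrix ι ι ℂ} (h : H.IsHermitian)

lemma eigvecs_apply (i j : ι) : eigvecs h i j = h.eigenvectorBasis j i :=
  h.eigenvectorUnitary_apply i j

lemma eigvecs_mul_conjTranspose : eigvecs h * (eigvecs h)ᴴ = 1 :=
  mem_unitaryGroup_iff.mp h.eigenvectorUnitary.2

lemma conjTranspose_mul_eigvecs : (eigvecs h)ᴴ * eigvecs h = 1 :=
  mem_unitaryGroup_iff'.mp h.eigenvectorUnitary.2

lemma eigvecs_spectral :
    H = eigvecs h * diagonal (fun i => (h.eigenvalues i : ℂ)) * (eigvecs h)ᴴ := by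
  conv_lhs => rw [h.spectral_theorem, Unitary.conjStarAlgAut_apply]
  rfl

end

variable {H₀ H₁ : Matrix (Sys n) (Sys n) ℂ}

lemma gibbsOp_eq (β : ℝ) (h : H₀.IsHermitian) :
    gibbsOp β H₀ = eigvecs h * diagonal (fun i => ((Real.exp (-β * h.eigenvalues i) : ℝ) : ℂ)) *
      (eigvecs h)ᴴ := by
  rw [gibbsOp]
  conv_lhs => rw [eigvecs_spectral h]
  rw [exp_smul_unitary_conj (eigvecs_mul_conjTranspose h)]
  simp

lemma partitionFn_eq (β : ℝ) (h : H₀.IsHermitian) :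
    partitionFn β H₀ = ∑ i, Real.exp (-β * h.eigenvalues i) := by
  rw [partitionFn, gibbsOp_eq β h, trace_mul_comm, ← mul_assoc, conjTranspose_mul_eigvecs, one_mul,
    trace_diagonal, ← Complex.ofReal_sum, Complex.ofReal_re]

lemma partitionFn_pos (β : ℝ) (h : H₀.IsHermitian) : 0 < partitionFn β H₀ := by
  rw [partitionFn_eq β h]
  exact Finset.sum_pos (fun _ _ => Real.exp_pos _) Finset.univ_nonempty

lemma exp_freeEnergyDiff {β : ℝ} (h₀ : H₀.IsHermitian) (h₁ : H₁.IsHermitian) :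
    Real.exp (-(β * freeEnergyDiff β H₀ H₁)) = partitionFn β H₁ / partitionFn β H₀ := by
  have hp := div_pos (partitionFn_pos β h₁) (partitionFn_pos β h₀)
  by_cases hβ : β = 0
  · subst hβ
    have : ∀ {H : Matrix (Sys n) (Sys n) ℂ} (h : H.IsHermitian),
        partitionFn 0 H = Fintype.card (Sys n) := by
      intro H h
      rw [partitionFn_eq 0 h]; simp
    rw [this h₀, this h₁, div_self (by simp)]
    simp
  · have : -(β * freeEnergyDiff β H₀ H₁) = Real.log (partitionFn β H₁ / partitionFn β H₀) := by
      rw [freeEnergyDiff]; field_simp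
    rw [this, Real.exp_log hp]

/-- A matrix as a vector of the tensor product. -/
def flat (M : Matrix (Sys n) (Sys n) ℂ) : Sys n × Sys n → ℂ := fun p => M p.1 p.2

lemma kronecker_mulVec_flat (A B M : Matrix (Sys n) (Sys n) ℂ) :
    (A ⊗ₖ B) *ᵥ flat M = flat (A * M * Bᵀ) := by
  funext p
  simp only [mulVec, dotProduct, flat, kroneckerMap_apply, mul_apply, transpose_apply,
    Fintype.sum_prod_type, Finset.sum_mul]
  rw [Finset.sum_comm]
  exact Finset.sum_congr rfl fun i _ => Finset.sum_congr rfl fun j _ => by ring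

/-- The product of eigenbases, which diagonalizes the work operator. -/
def workBasis (h₀ : H₀.IsHermitian) (h₁ : H₁.IsHermitian) :
    Matrix (Sys n × Sys n) (Sys n × Sys n) ℂ :=
  eigvecs h₁ ⊗ₖ (eigvecs h₀).map (starRingEnd ℂ)

/-- The eigenvalues of the work operator. -/
def workVal (h₀ : H₀.IsHermitian) (h₁ : H₁.IsHermitian) (p : Sys n × Sys n) : ℝ :=
  h₁.eigenvalues p.1 - h₀.eigenvalues p.2

variable (h₀ : H₀.IsHermitian) (h₁ : H₁.IsHermitian)

lemma map_conj_mul_conjTranspose : (eigvecs h₀).map (starRingEnd ℂ) *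
    ((eigvecs h₀).map (starRingEnd ℂ))ᴴ = 1 := by
  have := congrArg (fun M => M.map (starRingEnd ℂ)) (eigvecs_mul_conjTranspose h₀)
  rw [Matrix.map_mul, Matrix.map_one _ (map_zero _) (map_one _)] at this
  exact this

lemma workBasis_mul_conjTranspose : workBasis h₀ h₁ * (workBasis h₀ h₁)ᴴ = 1 := by
  rw [workBasis, conjTranspose_kronecker, ← mul_kronecker_mul, eigvecs_mul_conjTranspose,
    map_conj_mul_conjTranspose, one_kronecker_one]

lemma workOp_eq : workOp H₀ H₁ =
    workBasis h₀ h₁ * diagonal (fun p => (workVal h₀ h₁ p : ℂ)) * (workBasis h₀ h₁)ᴴ := by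
  have hd : diagonal (fun p => (workVal h₀ h₁ p : ℂ)) =
      diagonal (fun i => (h₁.eigenvalues i : ℂ)) ⊗ₖ (1 : Matrix (Sys n) (Sys n) ℂ) -
      (1 : Matrix (Sys n) (Sys n) ℂ) ⊗ₖ diagonal (fun i => (h₀.eigenvalues i : ℂ)) := by
    rw [← diagonal_one, diagonal_kronecker_diagonal, diagonal_kronecker_diagonal, diagonal_sub]
    congr 1
    funext p
    simp [workVal]
  have hs : H₀.map star = (eigvecs h₀).map (starRingEnd ℂ) *
      diagonal (fun i => (h₀.eigenvalues i : ℂ)) * ((eigvecs h₀).map (starRingEnd ℂ))ᴴ := by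
    have := congrArg (fun M => M.map (starRingEnd ℂ)) (eigvecs_spectral h₀)
    rw [Matrix.map_mul, Matrix.map_mul, diagonal_map (map_zero _)] at this
    simp only [Complex.conj_ofReal] at this
    exact this
  rw [hd, workBasis, conjTranspose_kronecker, mul_sub, sub_mul, ← mul_kronecker_mul,
    ← mul_kronecker_mul, ← mul_kronecker_mul, ← mul_kronecker_mul, mul_one, mul_one,
    map_conj_mul_conjTranspose, eigvecs_mul_conjTranspose, ← hs, ← eigvecs_spectral, workOp]

lemma evolution_eq (δ β : ℝ) : evolution δ β H₀ H₁ =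
    workBasis h₀ h₁ *
      diagonal (fun p => Complex.exp (Complex.I * (δ * (β / 2 * workVal h₀ h₁ p) : ℝ))) *
      (workBasis h₀ h₁)ᴴ := by
  rw [evolution, workOp_eq h₀ h₁, exp_smul_unitary_conj (workBasis_mul_conjTranspose h₀ h₁)]
  congr 3
  funext p
  congr 1
  push_cast
  ring

lemma unitary_conj_mul {ι : Type*} [Fintype ι] [DecidableEq ι] {V : Matrix ι ι ℂ}
    (hV : Vᴴ * V = 1) (d e : ι → ℂ) :
    V * diagonal d * Vᴴ * (V * diagonal e * Vᴴ) = V * diagonal (fun i => d i * e i) * Vᴴ := by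
  rw [← diagonal_mul_diagonal]
  calc _ = V * diagonal d * (Vᴴ * V) * (diagonal e * Vᴴ) := by simp only [mul_assoc]
    _ = _ := by rw [hV]; simp only [mul_assoc, mul_one]

lemma unitary_conj_pow {ι : Type*} [Fintype ι] [DecidableEq ι] {V : Matrix ι ι ℂ}
    (hV : V * Vᴴ = 1) (d : ι → ℂ) (j : ℕ) :
    (V * diagonal d * Vᴴ) ^ j = V * diagonal (fun i => d i ^ j) * Vᴴ := by
  induction j with
  | zero => simp [hV]
  | succ j ih =>
    rw [pow_succ, ih, unitary_conj_mul (mul_eq_one_comm.mp hV)]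
    simp only [pow_succ]

lemma conjTranspose_unitary_conj {ι : Type*} [Fintype ι] [DecidableEq ι] (V : Matrix ι ι ℂ)
    (d : ι → ℂ) : (V * diagonal d * Vᴴ)ᴴ = V * diagonal (fun i => star (d i)) * Vᴴ := by
  rw [conjTranspose_mul, conjTranspose_mul, conjTranspose_conjTranspose, diagonal_conjTranspose,
    mul_assoc]
  rfl

include h₀ h₁ in
lemma evolution_mul_conjTranspose (δ β : ℝ) :
    evolution δ β H₀ H₁ * (evolution δ β H₀ H₁)ᴴ = 1 := by
  have hV := workBasis_mul_conjTranspose h₀ h₁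
  rw [evolution_eq h₀ h₁, conjTranspose_unitary_conj, unitary_conj_mul (mul_eq_one_comm.mp hV)]
  have : ∀ p, Complex.exp (Complex.I * (δ * (β / 2 * workVal h₀ h₁ p) : ℝ)) *
      star (Complex.exp (Complex.I * (δ * (β / 2 * workVal h₀ h₁ p) : ℝ))) = 1 := by
    intro p
    rw [Complex.star_def, Complex.mul_conj, Complex.normSq_eq_norm_sq, mul_comm Complex.I,
      Complex.norm_exp_ofReal_mul_I]
    simp
  simp only [this]
  rw [diagonal_one, mul_one, hV]

/-- All powers of `U` are diagonal in the work basis, so a Laurent polynomial in `U` acts there as a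
trigonometric polynomial of the work. -/
lemma laurent_evolution (δ β : ℝ) (c : ℕ → ℂ) (d J : ℕ) :
    (∑ j ∈ Finset.range d, c j • evolution δ β H₀ H₁ ^ j) * (evolution δ β H₀ H₁)ᴴ ^ J =
      workBasis h₀ h₁ * diagonal (fun p => ∑ j ∈ Finset.range d, c j *
        Complex.exp (((j : ℂ) - J) * (Complex.I * (δ * (β / 2 * workVal h₀ h₁ p) : ℝ)))) *
        (workBasis h₀ h₁)ᴴ := by
  have hV := workBasis_mul_conjTranspose h₀ h₁
  have hV' := mul_eq_one_comm.mp hV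
  rw [evolution_eq h₀ h₁, conjTranspose_unitary_conj, unitary_conj_pow hV, Finset.sum_mul]
  simp only [unitary_conj_pow hV, smul_mul_assoc, unitary_conj_mul hV']
  have hs : ∀ (a : ℂ) (f : Sys n × Sys n → ℂ),
      a • (workBasis h₀ h₁ * diagonal f * (workBasis h₀ h₁)ᴴ) =
        workBasis h₀ h₁ * diagonal (a • f) * (workBasis h₀ h₁)ᴴ := by
    intro a f
    rw [diagonal_smul, mul_smul_comm, smul_mul_assoc]
  have hsum : ∀ f : ℕ → Sys n × Sys n → ℂ, ∑ j ∈ Finset.range d, diagonal (f j) =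
      diagonal (∑ j ∈ Finset.range d, f j) := fun f =>
    (map_sum (diagonalAddMonoidHom (Sys n × Sys n) ℂ) f _).symm
  simp only [hs]
  rw [← Finset.sum_mul, ← Finset.mul_sum, hsum]
  congr 3
  funext p
  rw [Finset.sum_apply]
  refine Finset.sum_congr rfl fun j _ => ?_
  simp only [Pi.smul_apply, smul_eq_mul]
  rw [Complex.star_def, ← Complex.exp_conj, ← Complex.exp_nat_mul, ← Complex.exp_nat_mul,
    ← Complex.exp_add]
  congr 2
  simp only [map_mul, Complex.conj_I, Complex.conj_ofReal]
  ring

/-- The transition amplitudes `⟨φ₁ₖ| 𝒰 |φ₀ₘ⟩`. -/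
def transAmp (𝒰 : Matrix (Sys n) (Sys n) ℂ) : Matrix (Sys n) (Sys n) ℂ :=
  (eigvecs h₁)ᴴ * 𝒰 * eigvecs h₀

lemma transitionProb_eq (𝒰 : Matrix (Sys n) (Sys n) ℂ) (m k : Sys n) :
    transitionProb h₀ h₁ 𝒰 m k = ‖transAmp h₀ h₁ 𝒰 k m‖ ^ 2 := by
  rw [transitionProb, transAmp, mul_assoc, mul_apply]
  simp only [conjTranspose_apply, mul_apply, eigvecs_apply]

/-- The amplitudes of the driven purification in the work basis. -/
def workAmp (β : ℝ) (𝒰 : Matrix (Sys n) (Sys n) ℂ) (p : Sys n × Sys n) : ℂ :=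
  ((Real.sqrt (partitionFn β H₀) : ℝ) : ℂ)⁻¹ *
    (transAmp h₀ h₁ 𝒰 p.1 p.2 * ((Real.exp (-β * h₀.eigenvalues p.2 / 2) : ℝ) : ℂ))

lemma norm_workAmp_sq (β : ℝ) (𝒰 : Matrix (Sys n) (Sys n) ℂ) (p : Sys n × Sys n) :
    ‖workAmp h₀ h₁ β 𝒰 p‖ ^ 2 = transitionProb h₀ h₁ 𝒰 p.2 p.1 *
      (Real.exp (-β * h₀.eigenvalues p.2) / partitionFn β H₀) := by
  rw [workAmp, norm_mul, norm_mul, mul_pow, mul_pow, norm_inv, Complex.norm_real, Complex.norm_real,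
    transitionProb_eq, inv_pow, Real.norm_eq_abs, sq_abs, Real.norm_eq_abs, sq_abs,
    Real.sq_sqrt (partitionFn_pos β h₀).le, ← Real.exp_nat_mul]
  push_cast
  rw [mul_div_cancel₀ _ two_ne_zero]
  ring

/-- Multiplication of vectors in the work basis. -/
lemma workBasis_mulVec (f : Sys n × Sys n → ℂ) :
    workBasis h₀ h₁ *ᵥ f =
      flat (eigvecs h₁ * (of fun i j => f (i, j)) * (eigvecs h₀)ᴴ) :=
  kronecker_mulVec_flat _ _ (of fun i j => f (i, j))

lemma purification_eq (β : ℝ) : purification β h₀ =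
    flat (((Real.sqrt (partitionFn β H₀) : ℝ) : ℂ)⁻¹ • (eigvecs h₀ *
      diagonal (fun m => ((Real.exp (-β * h₀.eigenvalues m / 2) : ℝ) : ℂ)) * (eigvecs h₀)ᴴ)) := by
  funext p
  simp only [purification, flat, Matrix.smul_apply, smul_eq_mul]
  congr 1
  rw [mul_apply]
  refine Finset.sum_congr rfl fun m _ => ?_
  rw [mul_diagonal, conjTranspose_apply, eigvecs_apply, eigvecs_apply]
  ring

lemma drive_purification (β : ℝ) (𝒰 : Matrix (Sys n) (Sys n) ℂ) :
    (𝒰 ⊗ₖ (1 : Matrix (Sys n) (Sys n) ℂ)) *ᵥ purification β h₀ =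
      workBasis h₀ h₁ *ᵥ workAmp h₀ h₁ β 𝒰 := by
  have hamp : (of fun i j => workAmp h₀ h₁ β 𝒰 (i, j)) =
      ((Real.sqrt (partitionFn β H₀) : ℝ) : ℂ)⁻¹ • (transAmp h₀ h₁ 𝒰 *
        diagonal (fun m => ((Real.exp (-β * h₀.eigenvalues m / 2) : ℝ) : ℂ))) := by
    ext i j
    simp only [of_apply, workAmp, Matrix.smul_apply, smul_eq_mul, mul_diagonal]
  rw [purification_eq, kronecker_mulVec_flat, workBasis_mulVec, hamp, transAmp]
  congr 1
  simp only [mul_smul_comm, smul_mul_assoc, transpose_one, mul_one]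
  congr 1
  simp only [← mul_assoc]
  rw [eigvecs_mul_conjTranspose, one_mul]

end Spectral

/-! ### The work distribution in the work basis -/

section Work

variable {n : ℕ} {H₀ H₁ : Matrix (Sys n) (Sys n) ℂ} (h₀ : H₀.IsHermitian) (h₁ : H₁.IsHermitian)
  {𝒰 : Matrix (Sys n) (Sys n) ℂ}

lemma transAmp_mul_conjTranspose (h𝒰 : 𝒰 * 𝒰ᴴ = 1) :
    transAmp h₀ h₁ 𝒰 * (transAmp h₀ h₁ 𝒰)ᴴ = 1 := by
  rw [transAmp, conjTranspose_mul, conjTranspose_mul, conjTranspose_conjTranspose]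
  calc _ = (eigvecs h₁)ᴴ * (𝒰 * (eigvecs h₀ * (eigvecs h₀)ᴴ) * 𝒰ᴴ) * eigvecs h₁ := by
        simp only [mul_assoc]
    _ = 1 := by rw [eigvecs_mul_conjTranspose, mul_one, h𝒰, mul_one, conjTranspose_mul_eigvecs]

lemma sum_norm_sq_row {ι : Type*} [Fintype ι] [DecidableEq ι] {T : Matrix ι ι ℂ}
    (hT : T * Tᴴ = 1) (k : ι) : ∑ m, ‖T k m‖ ^ 2 = 1 := by
  have h := congrFun (congrFun hT k) k
  rw [mul_apply, one_apply_eq] at h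
  rw [← Complex.ofReal_inj, Complex.ofReal_one, ← h, Complex.ofReal_sum]
  refine Finset.sum_congr rfl fun m _ => ?_
  rw [conjTranspose_apply, Complex.star_def, Complex.mul_conj, Complex.normSq_eq_norm_sq]

lemma sum_norm_sq_col {ι : Type*} [Fintype ι] [DecidableEq ι] {T : Matrix ι ι ℂ}
    (hT : T * Tᴴ = 1) (m : ι) : ∑ k, ‖T k m‖ ^ 2 = 1 := by
  have h := sum_norm_sq_row (T := Tᴴ) (by rw [conjTranspose_conjTranspose, mul_eq_one_comm, hT]) m
  simpa [conjTranspose_apply] using h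

lemma sum_norm_workAmp_sq (β : ℝ) (h𝒰 : 𝒰 * 𝒰ᴴ = 1) :
    ∑ p, ‖workAmp h₀ h₁ β 𝒰 p‖ ^ 2 = 1 := by
  simp only [norm_workAmp_sq, transitionProb_eq]
  rw [Fintype.sum_prod_type, Finset.sum_comm]
  simp only [← Finset.sum_mul, sum_norm_sq_col (transAmp_mul_conjTranspose h₀ h₁ h𝒰), one_mul]
  rw [← Finset.sum_div, ← partitionFn_eq β h₀, div_self (partitionFn_pos β h₀).ne']

/-- Jarzynski's equality. -/
lemma sum_norm_workAmp_sq_mul_exp (β : ℝ) (h𝒰 : 𝒰 * 𝒰ᴴ = 1) :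
    ∑ p, ‖workAmp h₀ h₁ β 𝒰 p‖ ^ 2 *
      Real.exp (-β * (workVal h₀ h₁ p - freeEnergyDiff β H₀ H₁)) = 1 := by
  have hZ₀ := partitionFn_pos β h₀
  have hZ₁ := partitionFn_pos β h₁
  have he : ∀ p, Real.exp (-β * (workVal h₀ h₁ p - freeEnergyDiff β H₀ H₁)) =
      Real.exp (-β * h₁.eigenvalues p.1) * (Real.exp (-β * h₀.eigenvalues p.2))⁻¹ *
        (partitionFn β H₁ / partitionFn β H₀)⁻¹ := by
    intro p
    rw [← exp_freeEnergyDiff h₀ h₁, ← Real.exp_neg, ← Real.exp_neg, ← Real.exp_add, ← Real.exp_add,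
      workVal]
    congr 1
    ring
  have ht : ∀ p, ‖workAmp h₀ h₁ β 𝒰 p‖ ^ 2 *
      Real.exp (-β * (workVal h₀ h₁ p - freeEnergyDiff β H₀ H₁)) =
      ‖transAmp h₀ h₁ 𝒰 p.1 p.2‖ ^ 2 *
        (Real.exp (-β * h₁.eigenvalues p.1) / partitionFn β H₁) := by
    intro p
    rw [norm_workAmp_sq, transitionProb_eq, he]
    have := Real.exp_pos (-β * h₀.eigenvalues p.2)
    field_simp
  simp only [ht]
  rw [Fintype.sum_prod_type]
  simp only [← Finset.sum_mul, sum_norm_sq_row (transAmp_mul_conjTranspose h₀ h₁ h𝒰), one_mul]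
  rw [← Finset.sum_div, ← partitionFn_eq β h₁, div_self hZ₁.ne']

lemma workDist_eq (β : ℝ) (w : ℝ) : workDist β h₀ h₁ 𝒰 w =
    ∑ p, if workVal h₀ h₁ p = w then ‖workAmp h₀ h₁ β 𝒰 p‖ ^ 2 else 0 := by
  simp only [norm_workAmp_sq]
  rw [Fintype.sum_prod_type, Finset.sum_comm, workDist]
  rfl

/-- P(w) is a sum of nonnegative terms, so degenerate work values cannot cancel and every eigenvalue
carrying a nonzero amplitude lies in the support. -/
lemma workVal_le_of_support {β wmin wmax : ℝ}
    (hsupp : ∀ w, workDist β h₀ h₁ 𝒰 w ≠ 0 → wmin ≤ w ∧ w ≤ wmax) (p : Sys n × Sys n)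
    (hp : workAmp h₀ h₁ β 𝒰 p ≠ 0) : workVal h₀ h₁ p ≤ wmax := by
  refine (hsupp _ ?_).2
  rw [workDist_eq]
  refine ne_of_gt (Finset.sum_pos' (fun q _ => ?_) ⟨p, Finset.mem_univ p, ?_⟩)
  · split_ifs <;> positivity
  · rw [if_pos rfl]; positivity

lemma workTail_eq (β wl : ℝ) : workTail β h₀ h₁ 𝒰 wl =
    ∑ p with workVal h₀ h₁ p < wl, ‖workAmp h₀ h₁ β 𝒰 p‖ ^ 2 *
      Real.exp (-β * (workVal h₀ h₁ p - freeEnergyDiff β H₀ H₁)) := by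
  simp only [workTail, workDist_eq, Finset.sum_mul, ite_mul, zero_mul]
  rw [Finset.sum_comm, Finset.sum_filter]
  refine Finset.sum_congr rfl fun p _ => ?_
  rw [Finset.sum_ite_eq]
  refine if_congr ?_ rfl rfl
  rw [Finset.mem_filter]
  exact and_iff_right (Finset.mem_image_of_mem _ (Finset.mem_univ p))

/-- The dimensionless work relative to the cutoff. -/
def relWork (β wl : ℝ) (p : Sys n × Sys n) : ℝ := β / 2 * (workVal h₀ h₁ p - wl)

/-- The norm of the exact, unnormalized target state. -/
def targetNorm (β wl : ℝ) (H₀ H₁ : Matrix (Sys n) (Sys n) ℂ) : ℝ :=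
  Real.exp (-(β / 2 * (freeEnergyDiff β H₀ H₁ - wl)))

lemma exp_relWork (β wl : ℝ) (p : Sys n × Sys n) :
    Real.exp (-relWork h₀ h₁ β wl p) ^ 2 = targetNorm β wl H₀ H₁ ^ 2 *
      Real.exp (-β * (workVal h₀ h₁ p - freeEnergyDiff β H₀ H₁)) := by
  rw [targetNorm, relWork, ← Real.exp_nat_mul, ← Real.exp_nat_mul, ← Real.exp_add]
  congr 1
  push_cast
  ring

lemma sum_target_sq (β wl : ℝ) (h𝒰 : 𝒰 * 𝒰ᴴ = 1) :
    ∑ p, ‖workAmp h₀ h₁ β 𝒰 p‖ ^ 2 * Real.exp (-relWork h₀ h₁ β wl p) ^ 2 =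
      targetNorm β wl H₀ H₁ ^ 2 := by
  simp only [exp_relWork, mul_left_comm _ (targetNorm β wl H₀ H₁ ^ 2)]
  rw [← Finset.mul_sum, sum_norm_workAmp_sq_mul_exp h₀ h₁ β h𝒰, mul_one]

lemma sum_target_tail {β wl b : ℝ} (htail : workTail β h₀ h₁ 𝒰 wl ≤ b) :
    ∑ p with workVal h₀ h₁ p < wl,
      ‖workAmp h₀ h₁ β 𝒰 p‖ ^ 2 * Real.exp (-relWork h₀ h₁ β wl p) ^ 2 ≤
      b * targetNorm β wl H₀ H₁ ^ 2 := by
  simp only [exp_relWork, mul_left_comm _ (targetNorm β wl H₀ H₁ ^ 2)]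
  rw [← Finset.mul_sum, ← workTail_eq, mul_comm]
  gcongr

/-- The exact target state in the work basis. -/
def target (β wl : ℝ) (𝒰 : Matrix (Sys n) (Sys n) ℂ) (p : Sys n × Sys n) : ℂ :=
  ((Real.exp (-relWork h₀ h₁ β wl p) / targetNorm β wl H₀ H₁ : ℝ) : ℂ) * workAmp h₀ h₁ β 𝒰 p

lemma targetNorm_pos (β wl : ℝ) (H₀ H₁ : Matrix (Sys n) (Sys n) ℂ) :
    0 < targetNorm β wl H₀ H₁ := Real.exp_pos _

/-- The initial energies cancel and Z₀ is replaced by Z₁: as a matrix, the target is e^{-βH₁/2} 𝒰 /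
√Z₁ in the two eigenbases, whatever the cutoff. -/
lemma target_eq (β wl : ℝ) (p : Sys n × Sys n) : target h₀ h₁ β wl 𝒰 p =
    ((Real.sqrt (partitionFn β H₁))⁻¹ * Real.exp (-β * h₁.eigenvalues p.1 / 2) : ℝ) *
      transAmp h₀ h₁ 𝒰 p.1 p.2 := by
  have hZ₀ := partitionFn_pos β h₀
  have hZ₁ := partitionFn_pos β h₁
  have h1 : Real.exp (-(β * freeEnergyDiff β H₀ H₁) / 2) =
      Real.sqrt (partitionFn β H₁) / Real.sqrt (partitionFn β H₀) := by
    rw [Real.exp_half, exp_freeEnergyDiff h₀ h₁, Real.sqrt_div hZ₁.le]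
  have h2 : Real.exp (-relWork h₀ h₁ β wl p) / targetNorm β wl H₀ H₁ *
      Real.exp (-β * h₀.eigenvalues p.2 / 2) * Real.exp (-(β * freeEnergyDiff β H₀ H₁) / 2) =
      Real.exp (-β * h₁.eigenvalues p.1 / 2) := by
    rw [targetNorm, ← Real.exp_sub, ← Real.exp_add, ← Real.exp_add, relWork, workVal]
    congr 1
    ring
  rw [h1] at h2
  have hs₀ := Real.sqrt_pos.mpr hZ₀
  have hs₁ := Real.sqrt_pos.mpr hZ₁
  rw [target, workAmp, ← h2]
  have e₀ : ((Real.sqrt (partitionFn β H₀) : ℝ) : ℂ) ≠ 0 := by exact_mod_cast hs₀.ne'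
  have e₁ : ((Real.sqrt (partitionFn β H₁) : ℝ) : ℂ) ≠ 0 := by exact_mod_cast hs₁.ne'
  rw [Complex.ofReal_mul, Complex.ofReal_mul, Complex.ofReal_mul, Complex.ofReal_div (√_),
    Complex.ofReal_inv]
  field_simp

/-- The matrix of a vector that is given in the work basis. -/
def workMat (f : Sys n × Sys n → ℂ) : Matrix (Sys n) (Sys n) ℂ :=
  eigvecs h₁ * (of fun i j => f (i, j)) * (eigvecs h₀)ᴴ

/-- The transition amplitudes form a unitary matrix, which cancels in M Mᴴ; only the final Gibbs
weights remain. -/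
lemma thermalState_eq (β wl : ℝ) (h𝒰 : 𝒰 * 𝒰ᴴ = 1) : thermalState β H₁ =
    workMat h₀ h₁ (target h₀ h₁ β wl 𝒰) * (workMat h₀ h₁ (target h₀ h₁ β wl 𝒰))ᴴ := by
  have hZ₁ := partitionFn_pos β h₁
  set d : Sys n → ℂ := fun i =>
    ((Real.sqrt (partitionFn β H₁))⁻¹ * Real.exp (-β * h₁.eigenvalues i / 2) : ℝ) with hd
  have h1 : (of fun i j => target h₀ h₁ β wl 𝒰 (i, j)) = diagonal d * transAmp h₀ h₁ 𝒰 := by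
    ext i j
    rw [of_apply, target_eq, diagonal_mul]
  have hdd : diagonal d * (diagonal d)ᴴ = ((partitionFn β H₁ : ℂ))⁻¹ •
      diagonal (fun i => ((Real.exp (-β * h₁.eigenvalues i) : ℝ) : ℂ)) := by
    rw [diagonal_conjTranspose, diagonal_mul_diagonal, ← diagonal_smul]
    congr 1
    funext i
    simp only [hd, Pi.star_apply, Complex.star_def, Complex.conj_ofReal, Pi.smul_apply,
      smul_eq_mul]
    rw [← Complex.ofReal_mul, ← Complex.ofReal_inv, ← Complex.ofReal_mul]
    congr 1
    rw [mul_mul_mul_comm, ← mul_inv, Real.mul_self_sqrt hZ₁.le, ← Real.exp_add]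
    congr 2
    ring
  rw [workMat, h1, thermalState, gibbsOp_eq β h₁]
  simp only [conjTranspose_mul, conjTranspose_conjTranspose]
  calc _ = eigvecs h₁ * (diagonal d * (diagonal d)ᴴ) * (eigvecs h₁)ᴴ := by
        rw [hdd, mul_smul_comm, smul_mul_assoc]
    _ = eigvecs h₁ * (diagonal d * (transAmp h₀ h₁ 𝒰 * (transAmp h₀ h₁ 𝒰)ᴴ) * (diagonal d)ᴴ) *
        (eigvecs h₁)ᴴ := by rw [transAmp_mul_conjTranspose h₀ h₁ h𝒰, mul_one]
    _ = eigvecs h₁ * (diagonal d * (transAmp h₀ h₁ 𝒰 * ((eigvecs h₀)ᴴ * eigvecs h₀) *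
        (transAmp h₀ h₁ 𝒰)ᴴ) * (diagonal d)ᴴ) * (eigvecs h₁)ᴴ := by
          rw [conjTranspose_mul_eigvecs, mul_one]
    _ = _ := by simp only [mul_assoc]

lemma sum_norm_sq_mulVec {ι : Type*} [Fintype ι] [DecidableEq ι] {V : Matrix ι ι ℂ}
    (hV : V * Vᴴ = 1) (v : ι → ℂ) : ∑ i, ‖(V *ᵥ v) i‖ ^ 2 = ∑ i, ‖v i‖ ^ 2 := by
  rw [← Complex.ofReal_inj, ← AmpAlgorithm.dotProduct_star_self,
    ← AmpAlgorithm.dotProduct_star_self, star_mulVec, ← dotProduct_mulVec, mulVec_mulVec,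
    mul_eq_one_comm.mp hV, one_mulVec]

lemma frob_workMat_sq (f : Sys n × Sys n → ℂ) :
    frob (workMat h₀ h₁ f) ^ 2 = ∑ p, ‖f p‖ ^ 2 := by
  rw [frob_sq, ← sum_norm_sq_mulVec (workBasis_mul_conjTranspose h₀ h₁), workBasis_mulVec,
    Fintype.sum_prod_type]
  rfl

lemma workMat_sub (f g : Sys n × Sys n → ℂ) :
    workMat h₀ h₁ (f - g) = workMat h₀ h₁ f - workMat h₀ h₁ g := by
  rw [workMat, workMat, workMat, ← sub_mul, ← mul_sub]
  rfl

lemma workMat_smul (c : ℂ) (f : Sys n × Sys n → ℂ) :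
    workMat h₀ h₁ (c • f) = c • workMat h₀ h₁ f := by
  rw [workMat, workMat, ← smul_mul_assoc, ← mul_smul_comm]
  rfl

lemma sum_norm_target_sq (β wl : ℝ) (h𝒰 : 𝒰 * 𝒰ᴴ = 1) :
    ∑ p, ‖target h₀ h₁ β wl 𝒰 p‖ ^ 2 = 1 := by
  have hκ := targetNorm_pos β wl H₀ H₁
  have h : ∀ p, ‖target h₀ h₁ β wl 𝒰 p‖ ^ 2 = (‖workAmp h₀ h₁ β 𝒰 p‖ ^ 2 *
      Real.exp (-relWork h₀ h₁ β wl p) ^ 2) / targetNorm β wl H₀ H₁ ^ 2 := by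
    intro p
    rw [target, norm_mul, Complex.norm_real, mul_pow, Real.norm_eq_abs, sq_abs, div_pow]
    ring
  simp only [h]
  rw [← Finset.sum_div, sum_target_sq h₀ h₁ β wl h𝒰, div_self (by positivity)]

/-- The output state of an algorithm whose good component is close to the target. -/
lemma exists_output (𝒜 : AmpAlgorithm n) {U₀ U : Matrix (Sys n × Sys n) (Sys n × Sys n) ℂ}
    (h𝒰 : 𝒰 * 𝒰ᴴ = 1) (hU₀ : U₀ * U₀ᴴ = 1) (hU : U * Uᴴ = 1) {β wl ε : ℝ} (hε : 0 ≤ ε)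
    {ψ : Sys n × Sys n → ℂ} (hψ : 𝒜.good 𝒰 U₀ U = workBasis h₀ h₁ *ᵥ ψ) {N : ℝ} (hN : 0 < N)
    (hNψ : ∑ p, ‖ψ p‖ ^ 2 = N ^ 2)
    (hclose : ∑ p, ‖ψ p / N - target h₀ h₁ β wl 𝒰 p‖ ^ 2 ≤ ε ^ 2) :
    𝒜.goodProb 𝒰 U₀ U = N ^ 2 ∧ ∃ τ₁ : Matrix (Sys n) (Sys n) ℂ,
      τ₁.PosSemidef ∧ τ₁.trace = 1 ∧
      (∀ k, 𝒜.outcome 𝒰 U₀ U k = (𝒜.successProb 𝒰 U₀ U k : ℂ) • τ₁) ∧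
      1 / 2 * traceNorm (τ₁ - thermalState β H₁) ≤ ε := by
  have hgood : 𝒜.goodProb 𝒰 U₀ U = N ^ 2 := by
    rw [AmpAlgorithm.goodProb, hψ, sum_norm_sq_mulVec (workBasis_mul_conjTranspose h₀ h₁), hNψ]
  have hNC : (N : ℂ) ≠ 0 := by exact_mod_cast hN.ne'
  refine ⟨hgood, ?_⟩
  set A := workMat h₀ h₁ (fun p => ψ p / N) with hA
  have hfA : frob A = 1 := by
    have h1 : frob A ^ 2 = 1 := by
      rw [hA, frob_workMat_sq]
      simp only [norm_div, div_pow, Complex.norm_real, Real.norm_eq_abs, sq_abs]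
      rw [← Finset.sum_div, hNψ, div_self (by positivity)]
    exact (pow_eq_one_iff_of_nonneg (frob_nonneg A) two_ne_zero).mp h1
  have hGA : ∀ i l, 𝒜.good 𝒰 U₀ U (i, l) = N * A i l := by
    intro i l
    have h2 : workMat h₀ h₁ ψ = (N : ℂ) • A := by
      rw [hA, ← workMat_smul]
      congr 1
      funext p
      simp only [Pi.smul_apply, smul_eq_mul]
      field_simp
    rw [hψ, workBasis_mulVec]
    change workMat h₀ h₁ ψ i l = _
    rw [h2]
    rfl
  refine ⟨A * Aᴴ, posSemidef_self_mul_conjTranspose A, ?_, fun k => ?_, ?_⟩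
  · have h3 : (A * Aᴴ).trace = ((frob A ^ 2 : ℝ) : ℂ) := by
      rw [frob_sq, Complex.ofReal_sum, trace]
      refine Finset.sum_congr rfl fun i _ => ?_
      rw [diag_apply, mul_apply, Complex.ofReal_sum]
      refine Finset.sum_congr rfl fun j _ => ?_
      rw [conjTranspose_apply, Complex.star_def, Complex.mul_conj, Complex.normSq_eq_norm_sq]
    rw [h3, hfA]
    simp
  · rw [AmpAlgorithm.outcome_eq 𝒜 h𝒰 hU₀ hU, AmpAlgorithm.successProb_eq 𝒜 h𝒰 hU₀ hU, hgood,
      Complex.ofReal_mul, mul_smul]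
    congr 1
    ext i j
    simp only [Matrix.smul_apply, smul_eq_mul, mul_apply, hGA, Finset.mul_sum,
      conjTranspose_apply]
    refine Finset.sum_congr rfl fun l _ => ?_
    rw [star_mul', Complex.star_def, Complex.conj_ofReal]
    push_cast
    ring
  · have hfB : frob (workMat h₀ h₁ (target h₀ h₁ β wl 𝒰)) = 1 := by
      have h1 : frob (workMat h₀ h₁ (target h₀ h₁ β wl 𝒰)) ^ 2 = 1 := by
        rw [frob_workMat_sq, sum_norm_target_sq h₀ h₁ β wl h𝒰]
      exact (pow_eq_one_iff_of_nonneg (frob_nonneg _) two_ne_zero).mp h1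
    -- Both Frobenius norms are one, so the bound is twice the distance of the vectors, which the
    -- factor 1/2 in the trace distance cancels.
    have h4 := traceNorm_sub_le A (workMat h₀ h₁ (target h₀ h₁ β wl 𝒰))
    rw [← thermalState_eq h₀ h₁ β wl h𝒰, hfA, hfB, hA, ← workMat_sub] at h4
    have h5 : frob (workMat h₀ h₁ ((fun p => ψ p / N) - target h₀ h₁ β wl 𝒰)) ≤ ε := by
      refine (sq_le_sq₀ (frob_nonneg _) hε).mp ?_
      rw [frob_workMat_sq]
      exact hclose
    linarith

end Work

/-! ### Approximate filtering of a vector -/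

lemma norm_normalize_sub_le {E : Type*} [NormedAddCommGroup E] [NormedSpace ℂ E] {a b : E}
    (ha : a ≠ 0) (hb : b ≠ 0) :
    ‖((‖a‖ : ℝ) : ℂ)⁻¹ • a - ((‖b‖ : ℝ) : ℂ)⁻¹ • b‖ ≤ 2 * ‖a - b‖ / ‖b‖ := by
  have ha' : 0 < ‖a‖ := norm_pos_iff.mpr ha
  have hb' : 0 < ‖b‖ := norm_pos_iff.mpr hb
  have e : ((‖a‖ : ℝ) : ℂ)⁻¹ • a - ((‖b‖ : ℝ) : ℂ)⁻¹ • b =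
      (((‖b‖ - ‖a‖) / (‖a‖ * ‖b‖) : ℝ) : ℂ) • a + ((‖b‖ : ℝ) : ℂ)⁻¹ • (a - b) := by
    have hac : ((‖a‖ : ℝ) : ℂ) ≠ 0 := by exact_mod_cast ha'.ne'
    have hbc : ((‖b‖ : ℝ) : ℂ) ≠ 0 := by exact_mod_cast hb'.ne'
    rw [smul_sub, ← add_sub_assoc, ← add_smul]
    congr 2
    push_cast
    field_simp
    ring
  rw [e]
  refine (norm_add_le _ _).trans ?_
  rw [norm_smul, norm_smul, norm_inv, Complex.norm_real, Complex.norm_real, Real.norm_eq_abs,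
    norm_norm, abs_div, abs_of_pos (mul_pos ha' hb')]
  have h1 : |‖b‖ - ‖a‖| ≤ ‖a - b‖ := by rw [norm_sub_rev]; exact abs_norm_sub_norm_le b a
  have h2 : |‖b‖ - ‖a‖| / (‖a‖ * ‖b‖) * ‖a‖ = |‖b‖ - ‖a‖| / ‖b‖ := by field_simp
  rw [h2, inv_mul_eq_div, ← add_div]
  gcongr
  linarith

/-- The squared error relative to (r κ)² is at most (ε/6)² from outside `S` plus (7/6)² (ε/6)² from
`S`, together below (ε/3)². Normalizing at most doubles the relative error, leaving 2ε/3. The norm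
of the filtered vector drops by a factor of at least 1 - 1/3 only. -/
lemma filter_estimate {ι : Type*} [Fintype ι] [DecidableEq ι] {γ f : ι → ℂ} {x : ι → ℝ}
    {S : Finset ι} {r κ ε : ℝ} (hr : 0 < r) (hκ : 0 < κ) (hε : 0 < ε) (hε1 : ε ≤ 1)
    (hsum : ∑ p, ‖γ p‖ ^ 2 * Real.exp (-x p) ^ 2 = κ ^ 2)
    (htail : ∑ p ∈ S, ‖γ p‖ ^ 2 * Real.exp (-x p) ^ 2 ≤ (ε / 6) ^ 2 * κ ^ 2)
    (hf : ∀ p ∉ S, γ p ≠ 0 →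
      ‖f p - (r * Real.exp (-x p) : ℝ)‖ ≤ ε / 6 * (r * Real.exp (-x p)))
    (hf' : ∀ p ∈ S, ‖f p - (r * Real.exp (-x p) : ℝ)‖ ≤ 7 / 6 * (r * Real.exp (-x p))) :
    ∃ N, 2 / 3 * (r * κ) ≤ N ∧ ∑ p, ‖f p * γ p‖ ^ 2 = N ^ 2 ∧
      ∑ p, ‖f p * γ p / N - ((Real.exp (-x p) / κ : ℝ) : ℂ) * γ p‖ ^ 2 ≤ ε ^ 2 := by
  set a : EuclideanSpace ℂ ι := WithLp.toLp 2 fun p => f p * γ p with ha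
  set b : EuclideanSpace ℂ ι := WithLp.toLp 2 fun p => ((r * Real.exp (-x p) : ℝ) : ℂ) * γ p
    with hb
  have hbn : ‖b‖ = r * κ := by
    refine (pow_left_inj₀ (norm_nonneg _) (by positivity) two_ne_zero).mp ?_
    rw [EuclideanSpace.norm_sq_eq, mul_pow, ← hsum, Finset.mul_sum]
    refine Finset.sum_congr rfl fun p _ => ?_
    simp only [hb, norm_mul, Complex.norm_real, Real.norm_eq_abs, mul_pow, sq_abs]
    ring
  have hab : ‖a - b‖ ≤ ε / 3 * (r * κ) := by
    refine (sq_le_sq₀ (norm_nonneg _) (by positivity)).mp ?_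
    rw [EuclideanSpace.norm_sq_eq]
    have hterm : ∀ p, ‖(a - b).ofLp p‖ ^ 2 ≤ (ε / 6) ^ 2 * r ^ 2 *
        (‖γ p‖ ^ 2 * Real.exp (-x p) ^ 2) + if p ∈ S then (7 / 6) ^ 2 * r ^ 2 *
        (‖γ p‖ ^ 2 * Real.exp (-x p) ^ 2) else 0 := by
      intro p
      have h1 : ‖(a - b).ofLp p‖ ^ 2 =
          ‖f p - (r * Real.exp (-x p) : ℝ)‖ ^ 2 * ‖γ p‖ ^ 2 := by
        simp only [ha, hb, PiLp.sub_apply]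
        rw [← sub_mul, norm_mul, mul_pow]
      rw [h1]
      by_cases hp : p ∈ S
      · rw [if_pos hp]
        have h2 := pow_le_pow_left₀ (norm_nonneg _) (hf' p hp) 2
        have h3 := mul_le_mul_of_nonneg_right h2 (sq_nonneg ‖γ p‖)
        have h4 : 0 ≤ (ε / 6) ^ 2 * r ^ 2 * (‖γ p‖ ^ 2 * Real.exp (-x p) ^ 2) := by positivity
        linarith [h3, h4]
      · rw [if_neg hp, add_zero]
        by_cases hγ : γ p = 0
        · simp [hγ]
        · have h2 := pow_le_pow_left₀ (norm_nonneg _) (hf p hp hγ) 2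
          have h3 := mul_le_mul_of_nonneg_right h2 (sq_nonneg ‖γ p‖)
          linarith [h3]
    refine (Finset.sum_le_sum fun p _ => hterm p).trans ?_
    rw [Finset.sum_add_distrib, ← Finset.mul_sum, hsum, ← Finset.sum_filter, ← Finset.mul_sum]
    simp only [Finset.filter_univ_mem]
    have h5 : (7 / 6) ^ 2 * r ^ 2 * ∑ p ∈ S, ‖γ p‖ ^ 2 * Real.exp (-x p) ^ 2 ≤
        (7 / 6) ^ 2 * r ^ 2 * ((ε / 6) ^ 2 * κ ^ 2) := by gcongr
    have h6 : 0 ≤ ε ^ 2 * (r ^ 2 * κ ^ 2) := by positivity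
    nlinarith
  have hb0 : b ≠ 0 := by rw [← norm_pos_iff, hbn]; positivity
  have han : 2 / 3 * (r * κ) ≤ ‖a‖ := by
    have h1 := norm_sub_norm_le b a
    rw [norm_sub_rev, hbn] at h1
    have : ε / 3 * (r * κ) ≤ 1 / 3 * (r * κ) := by gcongr
    linarith
  have ha0 : a ≠ 0 := by
    rw [← norm_pos_iff]
    exact lt_of_lt_of_le (by positivity) han
  refine ⟨‖a‖, han, (EuclideanSpace.norm_sq_eq a).symm, ?_⟩
  have h7 := norm_normalize_sub_le ha0 hb0
  have h8 : 2 * ‖a - b‖ / ‖b‖ ≤ ε := by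
    rw [hbn, div_le_iff₀ (by positivity)]
    have : 0 ≤ ε * (r * κ) := by positivity
    linarith
  have h9 := pow_le_pow_left₀ (norm_nonneg _) (h7.trans h8) 2
  rw [EuclideanSpace.norm_sq_eq] at h9
  refine le_trans (le_of_eq (Finset.sum_congr rfl fun p _ => ?_)) h9
  congr 2
  simp only [PiLp.sub_apply, PiLp.smul_apply, smul_eq_mul, hbn]
  have hr' : (r : ℂ) ≠ 0 := by exact_mod_cast hr.ne'
  have hκ' : (κ : ℂ) ≠ 0 := by exact_mod_cast hκ.ne'
  simp only [ha, hb]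
  push_cast
  field_simp

/-! ### The algorithm -/

section Algorithm

/-- There is an algorithm for the given parameters, with resources bounded in terms of `C`. -/
def Achievable (C : ℝ) (n : ℕ) (β ε wl wmax : ℝ) : Prop :=
  ∃ (δ : ℝ) (𝒜 : AmpAlgorithm n),
    0 < δ ∧ δ ≤ Real.pi / 16 ∧
    𝒜.round.uses .reflAnc = 1 ∧ 𝒜.round.uses .reflAll = 1 ∧
    𝒜.round.uses .drive = 1 ∧ 𝒜.round.uses .driveInv = 1 ∧
    𝒜.round.uses .prep = 1 ∧ 𝒜.round.uses .prepInv = 1 ∧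
    (𝒜.round.uses .ctrlU + 𝒜.round.uses .ctrlUInv : ℝ) ≤
      C * (Real.log (1 / ε) + β * (wmax - wl)) ^ (3 / 2 : ℝ) ∧
    (𝒜.round.uses .twoQubit : ℝ) ≤
      C * (Real.log (1 / ε) + β * (wmax - wl)) ^ (3 / 2 : ℝ) ∧
    (𝒜.anc : ℝ) ≤ C * (Real.log (1 / ε) + β * (wmax - wl)) ^ (3 / 2 : ℝ) ∧
    ∀ (H₀ H₁ : Matrix (Sys n) (Sys n) ℂ) (h₀ : H₀.IsHermitian) (h₁ : H₁.IsHermitian)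
      (𝒰 : Matrix (Sys n) (Sys n) ℂ) (U₀ : Matrix (Sys n × Sys n) (Sys n × Sys n) ℂ)
      (wmin : ℝ),
      𝒰 ∈ Matrix.unitaryGroup (Sys n) ℂ →
      U₀ ∈ Matrix.unitaryGroup (Sys n × Sys n) ℂ →
      U₀ *ᵥ ket 0 = purification β h₀ →
      (∀ w, workDist β h₀ h₁ 𝒰 w ≠ 0 → wmin ≤ w ∧ w ≤ wmax) →
      wmin ≤ wl →
      workTail β h₀ h₁ 𝒰 wl ≤ (ε / 6) ^ 2 →
      ∃ τ₁ : Matrix (Sys n) (Sys n) ℂ,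
        τ₁.PosSemidef ∧ τ₁.trace = 1 ∧
        (∀ k, 𝒜.outcome 𝒰 U₀ (evolution δ β H₀ H₁) k =
          (𝒜.successProb 𝒰 U₀ (evolution δ β H₀ H₁) k : ℂ) • τ₁) ∧
        1 / 2 * traceNorm (τ₁ - thermalState β H₁) ≤ ε ∧
        Tendsto (𝒜.reachProb 𝒰 U₀ (evolution δ β H₀ H₁)) atTop (𝓝 0) ∧
        𝒜.expectedRounds 𝒰 U₀ (evolution δ β H₀ H₁) ≤
          ENNReal.ofReal (C * Real.exp (Real.sqrt (Real.log (1 / ε))) *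
            Real.exp (β / 2 * (freeEnergyDiff β H₀ H₁ - wl)))

variable {a n : ℕ}

lemma one_kronecker_mulVec (M : Matrix (Sys n × Sys n) (Sys n × Sys n) ℂ)
    (u : Sys n × Sys n → ℂ) :
    ((1 : Matrix (Sys a) (Sys a) ℂ) ⊗ₖ M) *ᵥ (fun x => if x.1 = 0 then u x.2 else 0) =
      fun x => if x.1 = 0 then (M *ᵥ u) x.2 else 0 := by
  funext x
  obtain ⟨z, y⟩ := x
  simp only [mulVec, dotProduct, kroneckerMap_apply]
  rw [Fintype.sum_prod_type, Finset.sum_eq_single z]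
  · by_cases hz : z = 0
    · simp [hz]
    · simp [hz]
  · intro b _ hb
    simp [one_apply, Ne.symm hb]
  · simp

lemma run_prep_drive (𝒰 : Matrix (Sys n) (Sys n) ℂ)
    (U₀ U : Matrix (Sys n × Sys n) (Sys n × Sys n) ℂ) :
    Circuit.run 𝒰 U₀ U [Gate.prep, Gate.drive] (ket (0 : Basis a n)) = fun x =>
      if x.1 = 0 then ((𝒰 ⊗ₖ (1 : Matrix (Sys n) (Sys n) ℂ)) *ᵥ (U₀ *ᵥ ket 0)) x.2 else 0 := by
  have hk : ket (0 : Basis a n) = fun x => if x.1 = 0 then ket 0 x.2 else 0 := by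
    funext x
    obtain ⟨z, y⟩ := x
    rw [ket, ket, Pi.single_apply, Pi.single_apply]
    by_cases hz : z = 0 <;> by_cases hy : y = 0 <;>
      simp [hz, hy, Prod.ext_iff]
  rw [hk]
  simp only [Circuit.run, List.foldl_cons, List.foldl_nil, Gate.op]
  rw [one_kronecker_mulVec, one_kronecker_mulVec]

lemma inv_targetNorm (β wl : ℝ) (H₀ H₁ : Matrix (Sys n) (Sys n) ℂ) :
    Real.exp (β / 2 * (freeEnergyDiff β H₀ H₁ - wl)) = (targetNorm β wl H₀ H₁)⁻¹ := by
  rw [targetNorm, Real.exp_neg, inv_inv]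

/-- For small L the allowed number of ancilla qubits and gates may be below one, so the only safe
choice is no filter at all: the driven purification is output directly. Its distance to the target
is controlled because κ is close to or above one and ε is bounded below. -/
lemma achievable_of_small {C : ℝ} (hC : 2 ≤ C) (n : ℕ) {β ε wl wmax : ℝ} (hβ : 0 ≤ β)
    (hε : 0 < ε) (hε1 : ε ≤ 1) (hw : wl ≤ wmax)
    (hL : Real.log (1 / ε) + β * (wmax - wl) ≤ 1 / 4) : Achievable C n β ε wl wmax := by
  have hl0 : 0 ≤ Real.log (1 / ε) := Real.log_nonneg (by rw [le_div_iff₀ hε]; linarith)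
  have hX0 : 0 ≤ β * (wmax - wl) := mul_nonneg hβ (by linarith)
  have hbound : 0 ≤ C * (Real.log (1 / ε) + β * (wmax - wl)) ^ (3 / 2 : ℝ) := by positivity
  refine ⟨Real.pi / 16, ⟨0, [Gate.prep, Gate.drive], fun _ => PMF.pure 0⟩, by positivity, le_rfl,
    rfl, rfl, rfl, rfl, rfl, rfl, ?_, ?_, ?_, ?_⟩
  · exact le_of_eq_of_le (show ((0 : ℕ) : ℝ) + ((0 : ℕ) : ℝ) = 0 by simp) hbound
  · exact le_of_eq_of_le (show ((0 : ℕ) : ℝ) = 0 by simp) hbound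
  · exact le_of_eq_of_le (by simp) hbound
  intro H₀ H₁ h₀ h₁ 𝒰 U₀ wmin h𝒰 hU₀ hprep hsupp _ htail
  rw [mem_unitaryGroup_iff] at h𝒰 hU₀
  have hU := evolution_mul_conjTranspose h₀ h₁ (Real.pi / 16) β
  set 𝒜 : AmpAlgorithm n := ⟨0, [Gate.prep, Gate.drive], fun _ => PMF.pure 0⟩ with h𝒜
  set γ := workAmp h₀ h₁ β 𝒰 with hγ
  set x := relWork h₀ h₁ β wl with hx
  set κ := targetNorm β wl H₀ H₁ with hκ
  have hκ0 : 0 < κ := targetNorm_pos β wl H₀ H₁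
  set S : Finset (Sys n × Sys n) := Finset.univ.filter fun p => workVal h₀ h₁ p < wl with hS
  have hgood : 𝒜.good 𝒰 U₀ (evolution (Real.pi / 16) β H₀ H₁) = workBasis h₀ h₁ *ᵥ γ := by
    funext y
    rw [AmpAlgorithm.good, h𝒜, run_prep_drive, hprep, drive_purification h₀ h₁]
    simp [hγ]
  have hsum1 : ∑ p, ‖γ p‖ ^ 2 = 1 := sum_norm_workAmp_sq h₀ h₁ β h𝒰
  have hsum2 : ∑ p, ‖γ p‖ ^ 2 * Real.exp (-x p) ^ 2 = κ ^ 2 := sum_target_sq h₀ h₁ β wl h𝒰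
  have hsum3 : ∑ p ∈ S, ‖γ p‖ ^ 2 * Real.exp (-x p) ^ 2 ≤ (ε / 6) ^ 2 * κ ^ 2 :=
    sum_target_tail h₀ h₁ htail
  have hsplit := Finset.sum_add_sum_compl S fun p => ‖γ p‖ ^ 2 * Real.exp (-x p) ^ 2
  rw [hsum2] at hsplit
  have hsum4 : 35 / 36 * κ ^ 2 ≤ ∑ p ∈ Sᶜ, ‖γ p‖ ^ 2 * Real.exp (-x p) ^ 2 := by
    have : (ε / 6) ^ 2 ≤ 1 / 36 := by nlinarith
    have := mul_le_mul_of_nonneg_right this (sq_nonneg κ)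
    linarith
  have hexp1 : ∀ p ∈ Sᶜ, Real.exp (-x p) ≤ 1 := by
    intro p hp
    simp only [hS, Finset.mem_compl, Finset.mem_filter, Finset.mem_univ, true_and, not_lt] at hp
    rw [Real.exp_le_one_iff, neg_nonpos]
    exact mul_nonneg (by positivity) (by linarith)
  have hκ2 : κ ≤ 2 := by
    have h1 : ∑ p ∈ Sᶜ, ‖γ p‖ ^ 2 * Real.exp (-x p) ^ 2 ≤ ∑ p, ‖γ p‖ ^ 2 := by
      refine (Finset.sum_le_sum fun p hp => ?_).trans
        (Finset.sum_le_sum_of_subset_of_nonneg (Finset.subset_univ Sᶜ) fun _ _ _ => by positivity)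
      exact mul_le_of_le_one_right (by positivity)
        (pow_le_one₀ (Real.exp_pos _).le (hexp1 p hp))
    nlinarith
  -- This bounds the overlap with the target: above the cutoff e^{-x} ≤ 1, hence e^{-x} ≥ e^{-2x},
  -- and all but 1/36 of the target's weight lies there.
  have hfid : 35 / 36 * κ ^ 2 ≤ ∑ p, ‖γ p‖ ^ 2 * Real.exp (-x p) := by
    refine hsum4.trans ((Finset.sum_le_sum fun p hp => ?_).trans
      (Finset.sum_le_sum_of_subset_of_nonneg (Finset.subset_univ Sᶜ) fun _ _ _ => by positivity))
    gcongr
    have := hexp1 p hp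
    nlinarith [Real.exp_pos (-x p)]
  have hκX : Real.exp (-(β / 2 * (wmax - wl))) ≤ κ := by
    refine (sq_le_sq₀ (Real.exp_pos _).le hκ0.le).mp ?_
    rw [← hsum2, ← one_mul (Real.exp _ ^ 2), ← hsum1, Finset.sum_mul]
    refine Finset.sum_le_sum fun p _ => ?_
    by_cases hp : γ p = 0
    · simp [hp]
    · have hwp := workVal_le_of_support h₀ h₁ hsupp p hp
      gcongr
      exact mul_le_mul_of_nonneg_left (by linarith) (by positivity)
  have hclose : ∑ p, ‖γ p / ((1 : ℝ) : ℂ) - target h₀ h₁ β wl 𝒰 p‖ ^ 2 ≤ ε ^ 2 := by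
    have hterm : ∀ p, ‖γ p / ((1 : ℝ) : ℂ) - target h₀ h₁ β wl 𝒰 p‖ ^ 2 =
        ‖γ p‖ ^ 2 - 2 / κ * (‖γ p‖ ^ 2 * Real.exp (-x p)) +
          1 / κ ^ 2 * (‖γ p‖ ^ 2 * Real.exp (-x p) ^ 2) := by
      intro p
      have : γ p / ((1 : ℝ) : ℂ) - target h₀ h₁ β wl 𝒰 p =
          ((1 - Real.exp (-x p) / κ : ℝ) : ℂ) * γ p := by
        rw [target]; push_cast; ring
      rw [this, norm_mul, Complex.norm_real, mul_pow, Real.norm_eq_abs, sq_abs]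
      field_simp
      ring
    simp only [hterm]
    rw [Finset.sum_add_distrib, Finset.sum_sub_distrib, ← Finset.mul_sum, ← Finset.mul_sum, hsum1,
      hsum2, one_div_mul_cancel (by positivity)]
    have h1 : 35 / 18 * κ ≤ 2 / κ * ∑ p, ‖γ p‖ ^ 2 * Real.exp (-x p) := by
      refine le_trans (le_of_eq ?_) (mul_le_mul_of_nonneg_left hfid (by positivity))
      field_simp
      ring
    have h2 := Real.add_one_le_exp (-(β / 2 * (wmax - wl)))
    have h3 : ε ^ 2 = Real.exp (-(2 * Real.log (1 / ε))) := by
      rw [one_div, Real.log_inv, mul_neg, neg_neg, two_mul, Real.exp_add, Real.exp_log hε]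
      ring
    have h4 := Real.add_one_le_exp (-(2 * Real.log (1 / ε)))
    -- The squared distance is at most 2 - 35κ/18. With κ ≥ 1 - X and ε² ≥ 1 - 2l, where X is half
    -- of β(w_max - w_l), the claim follows from l + 2X ≤ 1/4.
    rw [h3]
    linarith
  obtain ⟨-, τ, hτ1, hτ2, hτ3, hτ4⟩ := exists_output h₀ h₁ 𝒜 h𝒰 hU₀ hU hε.le hgood one_pos
    (by rw [hsum1]; norm_num) hclose
  -- Without ancilla qubits the measurement has a single outcome, so the first attempt always
  -- succeeds.
  have hfail : ∀ k, 𝒜.failureProb 𝒰 U₀ (evolution (Real.pi / 16) β H₀ H₁) k = 0 := by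
    intro k
    refine Finset.sum_eq_zero fun x _ => if_pos ?_
    funext i
    exact i.elim0
  have hreach : ∀ t, 𝒜.reachProb 𝒰 U₀ (evolution (Real.pi / 16) β H₀ H₁) (t + 1) = 0 := by
    intro t
    rw [AmpAlgorithm.reachProb, Finset.prod_range_succ]
    simp [hfail]
  refine ⟨τ, hτ1, hτ2, hτ3, hτ4, ?_, ?_⟩
  · rw [← tendsto_add_atTop_iff_nat 1]
    simp only [hreach]
    exact tendsto_const_nhds
  · rw [AmpAlgorithm.expectedRounds, tsum_eq_single 0]
    · have h1 : ∑' k, 𝒜.schedule 0 k * ((k : ENNReal) + 1) = 1 := by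
        rw [tsum_eq_single 0]
        · simp [h𝒜]
        · intro k hk
          simp [h𝒜, hk]
      rw [h1, AmpAlgorithm.reachProb, Finset.range_zero, Finset.prod_empty, one_mul,
        inv_targetNorm, ← hκ, ← ENNReal.ofReal_one]
      apply ENNReal.ofReal_le_ofReal
      have h2 : 1 ≤ Real.exp (Real.sqrt (Real.log (1 / ε))) :=
        Real.one_le_exp (Real.sqrt_nonneg _)
      rw [← div_eq_mul_inv, le_div_iff₀ hκ0]
      nlinarith
    · intro t ht
      obtain ⟨t, rfl⟩ := Nat.exists_eq_succ_of_ne_zero ht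
      rw [Nat.succ_eq_add_one, hreach, zero_mul]

/-- The size parameters of the filter. -/
lemma exists_size {L : ℝ} (hL : 1 / 4 ≤ L) : ∃ ρ k : ℕ, 16 ≤ ρ ∧ k ≤ ρ ∧ ρ ≤ k ^ 2 ∧
    2 * L + 9 ≤ ρ ∧ 1 ≤ k ∧ (16 * (k * ρ : ℕ) : ℝ) ≤ 23328 * L ^ (3 / 2 : ℝ) := by
  -- For L ≥ 1/4 the factor 64 ensures ρ ≥ 16, hence δ = π/ρ ≤ π/16, and also ρ ≥ 2L + 9. Since ρ ≤
  -- 81 L and k ≤ 18 √L, the constant is 16 · 18 · 81 = 23328.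
  set ρ := ⌈64 * L⌉₊ with hρ
  have h1 : 64 * L ≤ ρ := Nat.le_ceil _
  have h2 : (ρ : ℝ) < 64 * L + 1 := Nat.ceil_lt_add_one (by linarith)
  have h3 : 16 ≤ ρ := by
    have : (16 : ℝ) ≤ ρ := by linarith
    exact_mod_cast this
  have h4 : 4 ≤ Nat.sqrt ρ := Nat.le_sqrt.mpr (by omega)
  have h5 := Nat.sqrt_le ρ
  refine ⟨ρ, Nat.sqrt ρ + 1, h3, by nlinarith, ?_, by linarith, by omega, ?_⟩
  · have := Nat.lt_succ_sqrt ρ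
    rw [sq]
    exact this.le
  · have h6 : ((Nat.sqrt ρ : ℕ) : ℝ) ≤ Real.sqrt ρ := by
      refine Real.le_sqrt_of_sq_le ?_
      rw [sq]
      exact_mod_cast h5
    have h7 : Real.sqrt ρ ≤ 9 * Real.sqrt L := by
      rw [show (9 : ℝ) = Real.sqrt 81 by rw [show (81 : ℝ) = 9 ^ 2 by norm_num]; simp,
        ← Real.sqrt_mul (by norm_num)]
      exact Real.sqrt_le_sqrt (by linarith)
    have h8 : (1 : ℝ) ≤ Real.sqrt ρ := by
      rw [Real.one_le_sqrt]
      exact_mod_cast (by omega : 1 ≤ ρ)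
    have h9 : L ^ (3 / 2 : ℝ) = L * Real.sqrt L := by
      rw [show (3 / 2 : ℝ) = 1 + 1 / 2 by norm_num, Real.rpow_add (by linarith), Real.rpow_one,
        Real.sqrt_eq_rpow]
    have h10 := Real.sqrt_nonneg L
    rw [h9]
    push_cast
    have h11 : ((Nat.sqrt ρ : ℕ) : ℝ) + 1 ≤ 18 * Real.sqrt L := by linarith
    calc 16 * ((((Nat.sqrt ρ : ℕ) : ℝ) + 1) * ρ) ≤ 16 * (18 * Real.sqrt L * (81 * L)) := by
          gcongr
          linarith
      _ = _ := by ring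

/-- The algorithm that amplifies the outcome of a trigonometric filter of the work. -/
lemma exists_filter_algorithm (n : ℕ) (β wl : ℝ) (ρ m : ℕ) {c : ℕ → ℂ}
    (hc : ∑ j ∈ Finset.range (2 * m + 1), ‖c j‖ ≤ 1) :
    ∃ 𝒜 : AmpAlgorithm n, 𝒜.schedule = growingSchedule ∧ 𝒜.anc = 2 * m + 2 ∧
      𝒜.round.uses .reflAnc = 1 ∧ 𝒜.round.uses .reflAll = 1 ∧
      𝒜.round.uses .drive = 1 ∧ 𝒜.round.uses .driveInv = 1 ∧
      𝒜.round.uses .prep = 1 ∧ 𝒜.round.uses .prepInv = 1 ∧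
      𝒜.round.uses .ctrlU = 3 * m ∧ 𝒜.round.uses .ctrlUInv = 3 * m ∧
      𝒜.round.uses .twoQubit = 8 * m + 8 ∧
      ∀ (H₀ H₁ : Matrix (Sys n) (Sys n) ℂ) (h₀ : H₀.IsHermitian) (h₁ : H₁.IsHermitian)
        (𝒰 : Matrix (Sys n) (Sys n) ℂ) (U₀ : Matrix (Sys n × Sys n) (Sys n × Sys n) ℂ),
        U₀ *ᵥ ket 0 = purification β h₀ →
        𝒜.good 𝒰 U₀ (evolution (Real.pi / ρ) β H₀ H₁) = workBasis h₀ h₁ *ᵥ fun p =>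
          (1 / 2 * ∑ j ∈ Finset.range (2 * m + 1), c j * Complex.exp (((j : ℂ) - m) *
            (Complex.I * (Real.pi / ρ * relWork h₀ h₁ β wl p : ℝ)))) * workAmp h₀ h₁ β 𝒰 p := by
  -- The phases replace W by W - w_l, so the circuit needs only the evolution of W. The factor 1/2
  -- keeps the good amplitude at most 1/2, as required for cos θ ≥ 1/2 in the amplification.
  set c' : ℕ → ℂ := fun j => 1 / 2 * (c j *
    Complex.exp (((j : ℂ) - m) * (Complex.I * (Real.pi / ρ * (β / 2 * -wl) : ℝ)))) with hc'
  have hc'n : ∑ j ∈ Finset.range (2 * m + 1), ‖c' j‖ ≤ 1 := by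
    have : ∀ j, ‖c' j‖ = 1 / 2 * ‖c j‖ := by
      intro j
      have := norm_exp_mul_I_mul ((j : ℤ) - m) (Real.pi / ρ * (β / 2 * -wl))
      push_cast at this
      rw [hc']
      push_cast
      rw [norm_mul, norm_mul, this, mul_one]
      norm_num
    simp only [this]
    rw [← Finset.mul_sum]
    linarith
  obtain ⟨Q, u1, u2, u3, u4, u5, u6, u7, u8, u9, hQ⟩ := exists_laurent n (2 * m) m c' hc'n
  have hround : ∀ K : Kind, Circuit.uses (AmpAlgorithm.round
      ⟨2 * m + 2, [Gate.prep, Gate.drive] ++ Q, growingSchedule⟩) K =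
      (Circuit.uses [(Gate.prep : Gate (2 * m + 2) n), Gate.drive] K + Circuit.uses Q K) +
      (Circuit.uses [(Gate.prep : Gate (2 * m + 2) n), Gate.drive] K.inv + Circuit.uses Q K.inv) +
      ((if K = .reflAnc then 1 else 0) + if K = .reflAll then 1 else 0) := by
    intro K
    rw [AmpAlgorithm.uses_round, Circuit.uses_append, Circuit.uses_append]
  have hpd : ∀ K : Kind, Circuit.uses [(Gate.prep : Gate (2 * m + 2) n), Gate.drive] K =
      if K = .prep ∨ K = .drive then 1 else 0 := by
    intro K
    cases K <;> rfl
  refine ⟨⟨2 * m + 2, [Gate.prep, Gate.drive] ++ Q, growingSchedule⟩, rfl, rfl, ?_, ?_, ?_, ?_,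
    ?_, ?_, ?_, ?_, ?_, fun H₀ H₁ h₀ h₁ 𝒰 U₀ hprep => ?_⟩
  · rw [hround, hpd, hpd, Kind.inv, u8]; rfl
  · rw [hround, hpd, hpd, Kind.inv, u9]; rfl
  · rw [hround, hpd, hpd, Kind.inv, u4, u5]; rfl
  · rw [hround, hpd, hpd, Kind.inv, u4, u5]; rfl
  · rw [hround, hpd, hpd, Kind.inv, u6, u7]; rfl
  · rw [hround, hpd, hpd, Kind.inv, u6, u7]; rfl
  · rw [hround, hpd, hpd, Kind.inv, u2, u3]; simp; omega
  · rw [hround, hpd, hpd, Kind.inv, u2, u3]; simp; omega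
  · rw [hround, hpd, hpd, Kind.inv, u1]; simp; omega
  funext y
  rw [AmpAlgorithm.good]
  simp only
  rw [Circuit.run_append, run_prep_drive, hprep, drive_purification h₀ h₁, hQ,
    laurent_evolution h₀ h₁, mulVec_mulVec, mul_assoc _ _ (workBasis h₀ h₁),
    mul_eq_one_comm.mp (workBasis_mul_conjTranspose h₀ h₁), mul_one, ← mulVec_mulVec]
  congr 2
  funext p
  rw [mulVec_diagonal]
  congr 1
  rw [Finset.mul_sum]
  refine Finset.sum_congr rfl fun j _ => ?_
  rw [hc', mul_assoc, mul_assoc, ← Complex.exp_add]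
  congr 3
  rw [relWork]
  push_cast
  ring

lemma achievable_of_large (n : ℕ) {β ε wl wmax : ℝ} (hβ : 0 ≤ β)
    (hε : 0 < ε) (hε1 : ε ≤ 1) (hw : wl ≤ wmax)
    (hL : 1 / 4 ≤ Real.log (1 / ε) + β * (wmax - wl)) : Achievable 23328 n β ε wl wmax := by
  obtain ⟨ρ, k, hρ16, hkρ, hρk, hρL, hk1, hsize⟩ := exists_size hL
  set l := Real.log (1 / ε) with hl
  set X := β / 2 * (wmax - wl) with hX
  have hl0 : 0 ≤ l := Real.log_nonneg (by rw [le_div_iff₀ hε]; linarith)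
  have hX0 : 0 ≤ X := mul_nonneg (by linarith) (by linarith)
  have hlε : Real.exp (-l) = ε := by
    rw [hl, one_div, Real.log_inv, neg_neg, Real.exp_log hε]
  have hXL : X + 2 * l + 9 ≤ ρ := by
    have : β * (wmax - wl) = 2 * X := by rw [hX]; ring
    rw [this] at hρL
    linarith
  obtain ⟨c, r, hc, hr, hcx, hcx'⟩ := exists_exp_approx hl0 hX0 hkρ hρk hXL
  set m := k * ρ with hm
  have hm1 : 1 ≤ m := Nat.mul_pos hk1 (by omega)
  have hr0 : 0 < r := lt_of_lt_of_le (by positivity) hr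
  have hρ0 : (0 : ℝ) < ρ := by
    have : 0 < ρ := by omega
    exact_mod_cast this
  obtain ⟨𝒜, hsch, hanc, u1, u2, u3, u4, u5, u6, u7, u8, u9, hgood⟩ :=
    exists_filter_algorithm n β wl ρ m hc
  have hm1' : (1 : ℝ) ≤ m := by exact_mod_cast hm1
  refine ⟨Real.pi / ρ, 𝒜, by positivity, ?_, u1, u2, u3, u4, u5, u6, ?_, ?_, ?_, ?_⟩
  · have : (16 : ℝ) ≤ ρ := by exact_mod_cast hρ16
    gcongr
  · rw [u7, u8]
    refine le_trans ?_ hsize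
    push_cast
    linarith
  · rw [u9]
    refine le_trans ?_ hsize
    push_cast
    linarith
  · rw [hanc]
    refine le_trans ?_ hsize
    push_cast
    linarith
  intro H₀ H₁ h₀ h₁ 𝒰 U₀ wmin h𝒰 hU₀ hprep hsupp _ htail
  rw [mem_unitaryGroup_iff] at h𝒰 hU₀
  have hU := evolution_mul_conjTranspose h₀ h₁ (Real.pi / ρ) β
  set γ := workAmp h₀ h₁ β 𝒰 with hγ
  set x := relWork h₀ h₁ β wl with hx
  set κ := targetNorm β wl H₀ H₁ with hκ
  have hκ0 : 0 < κ := targetNorm_pos β wl H₀ H₁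
  set f : Sys n × Sys n → ℂ := fun p => 1 / 2 * ∑ j ∈ Finset.range (2 * m + 1), c j *
        Complex.exp (((j : ℂ) - m) * (Complex.I * (Real.pi / ρ * x p : ℝ))) with hf
  have hgood := hgood H₀ H₁ h₀ h₁ 𝒰 U₀ hprep
  have hfsub : ∀ p, ‖f p - (r / 2 * Real.exp (-x p) : ℝ)‖ = 1 / 2 *
      ‖∑ j ∈ Finset.range (2 * m + 1), c j *
        Complex.exp (((j : ℂ) - m) * (Complex.I * (Real.pi / ρ * x p : ℝ))) -
          (r * Real.exp (-x p) : ℝ)‖ := by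
    intro p
    rw [show (1 / 2 : ℝ) = ‖(1 / 2 : ℂ)‖ by norm_num, ← norm_mul]
    congr 1
    simp only [hf]
    push_cast
    ring
  have hfn : ∀ p, ‖f p‖ ≤ 1 / 2 := by
    intro p
    simp only [hf]
    rw [norm_mul, show ‖(1 / 2 : ℂ)‖ = 1 / 2 by norm_num]
    refine mul_le_of_le_one_right (by norm_num) ((norm_sum_le _ _).trans ?_)
    refine (Finset.sum_congr rfl fun j _ => ?_).trans_le hc
    have := norm_exp_mul_I_mul ((j : ℤ) - m) (Real.pi / ρ * x p)
    push_cast at this ⊢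
    rw [norm_mul, this, mul_one]
  have hsum1 : ∑ p, ‖γ p‖ ^ 2 = 1 := sum_norm_workAmp_sq h₀ h₁ β h𝒰
  -- The support condition places the relevant arguments above the cutoff in [0, X], where the
  -- filter is precise; those below the cutoff fall under the coarse bound. The prefactor is r/2
  -- because of the halved coefficients.
  obtain ⟨N, hN1, hN2, hN3⟩ := filter_estimate (γ := γ) (f := f) (x := x)
    (S := Finset.univ.filter fun p => workVal h₀ h₁ p < wl) (half_pos hr0) hκ0 hε hε1
    (sum_target_sq h₀ h₁ β wl h𝒰) (sum_target_tail h₀ h₁ htail)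
    (by
      intro p hp hγp
      simp only [Finset.mem_filter, Finset.mem_univ, true_and, not_lt] at hp
      have hwp := workVal_le_of_support h₀ h₁ hsupp p hγp
      have h1 := hcx (x p) (mul_nonneg (by linarith) (by linarith))
        (mul_le_mul_of_nonneg_left (by linarith) (by linarith))
      rw [hlε] at h1
      rw [hfsub]
      linarith)
    (by
      intro p hp
      simp only [Finset.mem_filter, Finset.mem_univ, true_and] at hp
      have h1 := hcx' (x p) (mul_nonpos_of_nonneg_of_nonpos (by linarith) (by linarith))
      rw [hfsub]
      linarith)
  have hN0 : 0 < N := lt_of_lt_of_le (by positivity) hN1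
  obtain ⟨hp, τ, hτ1, hτ2, hτ3, hτ4⟩ := exists_output h₀ h₁ 𝒜 h𝒰 hU₀ hU hε.le hgood hN0 hN2 hN3
  have hNhalf : N ^ 2 ≤ 1 / 4 := by
    have h1 : ∑ p, ‖f p * γ p‖ ^ 2 ≤ ∑ p, 1 / 4 * ‖γ p‖ ^ 2 := by
      refine Finset.sum_le_sum fun p _ => ?_
      rw [norm_mul, mul_pow]
      gcongr
      have := pow_le_pow_left₀ (norm_nonneg _) (hfn p) 2
      norm_num at this ⊢
      exact this
    rw [← Finset.mul_sum, hsum1, hN2] at h1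
    linarith
  have hN1' : N ≤ 1 / 2 :=
    (sq_le_sq₀ hN0.le (by norm_num)).mp (hNhalf.trans_eq (by norm_num))
  have hsin : Real.sin (Real.arcsin N) = N := Real.sin_arcsin (by linarith) (by linarith)
  have hcos : 1 / 2 ≤ Real.cos (Real.arcsin N) := by
    rw [Real.cos_arcsin]
    exact Real.le_sqrt_of_sq_le (by linarith)
  have hθ : 𝒜.goodProb 𝒰 U₀ (evolution (Real.pi / ρ) β H₀ H₁) =
      Real.sin (Real.arcsin N) ^ 2 := by rw [hp, hsin]
  refine ⟨τ, hτ1, hτ2, hτ3, hτ4,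
    tendsto_reachProb 𝒜 h𝒰 hU₀ hU hθ hsch (by rw [hsin]; exact hN0) hcos,
    (expectedRounds_le 𝒜 h𝒰 hU₀ hU hθ hsch (by rw [hsin]; exact hN0) hcos).trans ?_⟩
  apply ENNReal.ofReal_le_ofReal
  rw [hsin, inv_targetNorm, ← hκ, ← div_eq_mul_inv, div_le_div_iff₀ hN0 hκ0]
  have he3 : Real.exp (-(Real.sqrt l + 3)) = (Real.exp (Real.sqrt l))⁻¹ * (Real.exp 1 ^ 3)⁻¹ := by
    rw [← Real.exp_nat_mul, ← Real.exp_neg, ← Real.exp_neg, ← Real.exp_add]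
    congr 1
    push_cast
    ring
  have he27 : Real.exp 1 ^ 3 ≤ 27 := by
    have h1 := Real.exp_one_lt_d9
    calc Real.exp 1 ^ 3 ≤ 3 ^ 3 := pow_le_pow_left₀ (Real.exp_pos _).le (by linarith) 3
      _ = 27 := by norm_num
  have hE : 1 / 54 ≤ Real.exp (Real.sqrt l) * r := by
    rw [he3] at hr
    have h1 := mul_le_mul_of_nonneg_left hr (Real.exp_pos (Real.sqrt l)).le
    refine le_trans ?_ h1
    have h2 : Real.exp (Real.sqrt l) * ((Real.exp (Real.sqrt l))⁻¹ * (Real.exp 1 ^ 3)⁻¹ / 2) =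
        (Real.exp 1 ^ 3)⁻¹ / 2 := by field_simp
    rw [h2]
    have h3 : (27 : ℝ)⁻¹ ≤ (Real.exp 1 ^ 3)⁻¹ := inv_anti₀ (by positivity) he27
    linarith
  -- Here N ≥ (2/3)(r/2) κ and e^{√l} r ≥ 1 / (2 · 27). The gate count fixes the constant; 36 · 3 ·
  -- 54 = 5832 would suffice at this point.
  calc 36 * κ ≤ 23328 * (1 / 54) * (1 / 3 * κ) := by linarith
    _ ≤ 23328 * (Real.exp (Real.sqrt l) * r) * (1 / 3 * κ) := by gcongr
    _ = 23328 * Real.exp (Real.sqrt l) * (2 / 3 * (r / 2 * κ)) := by ring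
    _ ≤ _ := by gcongr

end Algorithm

end ThermalPrep

end

/-! ### The main theorem. -/

open ThermalPrep in
theorem theorem1 :
    ∃ C : ℝ, 0 < C ∧
      ∀ (n : ℕ) (β ε wl wmax : ℝ), 0 ≤ β → 0 < ε → ε ≤ 1 → wl ≤ wmax →
      -- the algorithm depends on these parameters only
      ∃ (δ : ℝ) (𝒜 : AmpAlgorithm n),
        0 < δ ∧ δ ≤ Real.pi / 16 ∧
        -- resources of one amplitude amplification round
        𝒜.round.uses .reflAnc = 1 ∧ 𝒜.round.uses .reflAll = 1 ∧
        𝒜.round.uses .drive = 1 ∧ 𝒜.round.uses .driveInv = 1 ∧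
        𝒜.round.uses .prep = 1 ∧ 𝒜.round.uses .prepInv = 1 ∧
        (𝒜.round.uses .ctrlU + 𝒜.round.uses .ctrlUInv : ℝ) ≤
          C * (Real.log (1 / ε) + β * (wmax - wl)) ^ (3 / 2 : ℝ) ∧
        (𝒜.round.uses .twoQubit : ℝ) ≤
          C * (Real.log (1 / ε) + β * (wmax - wl)) ^ (3 / 2 : ℝ) ∧
        (𝒜.anc : ℝ) ≤ C * (Real.log (1 / ε) + β * (wmax - wl)) ^ (3 / 2 : ℝ) ∧
        ∀ (H₀ H₁ : Matrix (Sys n) (Sys n) ℂ) (h₀ : H₀.IsHermitian) (h₁ : H₁.IsHermitian)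
          (𝒰 : Matrix (Sys n) (Sys n) ℂ) (U₀ : Matrix (Sys n × Sys n) (Sys n × Sys n) ℂ)
          (wmin : ℝ),
          𝒰 ∈ Matrix.unitaryGroup (Sys n) ℂ →
          U₀ ∈ Matrix.unitaryGroup (Sys n × Sys n) ℂ →
          U₀ *ᵥ ket 0 = purification β h₀ →
          (∀ w, workDist β h₀ h₁ 𝒰 w ≠ 0 → wmin ≤ w ∧ w ≤ wmax) →
          wmin ≤ wl →
          workTail β h₀ h₁ 𝒰 wl ≤ (ε / 6) ^ 2 →
          ∃ τ₁ : Matrix (Sys n) (Sys n) ℂ,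
            τ₁.PosSemidef ∧ τ₁.trace = 1 ∧
            -- whenever an attempt succeeds, the register `s` is in the state `τ₁`
            (∀ k, 𝒜.outcome 𝒰 U₀ (evolution δ β H₀ H₁) k =
              (𝒜.successProb 𝒰 U₀ (evolution δ β H₀ H₁) k : ℂ) • τ₁) ∧
            1 / 2 * traceNorm (τ₁ - thermalState β H₁) ≤ ε ∧
            -- the algorithm stops with probability one
            Tendsto (𝒜.reachProb 𝒰 U₀ (evolution δ β H₀ H₁)) atTop (𝓝 0) ∧
            𝒜.expectedRounds 𝒰 U₀ (evolution δ β H₀ H₁) ≤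
              ENNReal.ofReal (C * Real.exp (Real.sqrt (Real.log (1 / ε))) *
                Real.exp (β / 2 * (freeEnergyDiff β H₀ H₁ - wl))) := by
  refine ⟨23328, by norm_num, fun n β ε wl wmax hβ hε hε1 hw => ?_⟩
  -- The case distinction is needed because the resource bound tends to zero with L, whereas the
  -- filter always uses some ancilla qubits and gates.
  rcases le_total (Real.log (1 / ε) + β * (wmax - wl)) (1 / 4) with h | h
  · exact achievable_of_small (by norm_num) n hβ hε hε1 hw h
  · exact achievable_of_large n hβ hε hε1 hw h
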